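/- **Theorem.** An instance of NWT (Negative-Weight Triangle) is a tripartite graph $G$, given with its three vertex classes, and a symmetric function $w:V(G)^2\to\mathbb{Z}$; the problem is to decide whether $G$ has a triangle $abc$ with $w(a,b)+w(b,c)+w(c,a)<0$. The problem #NWT is to compute the number $\#(G,w)$ of such triangles. Algorithms are randomised word-RAM programs with words of logarithmic length (on an input of $N$ words, all numbers that occur are at most $(N+2)^{\kappa}$ for a constant $\kappa$ of the algorithm); one step may draw a uniformly random element of $\{0,\dots,k-1\}$ for a word $k$. Running times are worst-case over the random choices. Graphs and weights are given as arrays of words, with integers that are too long for one word split over several words. Let $T:\mathbb{Z}_{\ge 0}^2\to\mathbb{Z}_{\ge 0}$, and suppose that there is a randomised algorithm that decides each instance of NWT correctly with probability at least $2/3$ and that runs in time at most $T(n,W)$ on every $n$-vertex instance whose weights all lie in $[-W,W]$. Then there are functions $f,g$ with $f(n)=O((\log n)^6)$ and $g(n)=\tilde O(n^2)$ as $n\to\infty$ (that is, $g(n)=O((\log n)^c n^2)$ for some constant $c$) and a randomised algorithm that, given an instance $(G,w)$ of #NWT and a rational number $0<\varepsilon<1$, outputs a rational number $z$ such that $|z-\#(G,w)|\le\varepsilon\cdot\#(G,w)$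 with probability at least $2/3$, and that for every $n$-vertex instance with all weights in $[-W,W]$ runs in time at most $$\varepsilon^{-2}\,T(n,W)\,f(n)+\varepsilon^{-4}\,\max\{1,\log W\}\,g(n),$$ where $\max\{1,\log W\}$ is read as $1$ if $W=0$. -/

import Mathlib

open Filter Asymptotics
open scoped ENNReal

/-! ### Randomised word-RAM

A machine has registers and a random-access memory, both holding natural numbers, and runs a
structured program with unit-cost instructions. Words have logarithmic length: on an input of `N`
words, every number that ever occurs must be at most `(N + 2) ^ κ`, for a constant `κ` of the
algorithm (see `RAM.RunsIn`), so that each register and each memory cell holds `O(log N)` bits. -/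

namespace RAM

/-- The arithmetic, comparison and bitwise word operations. -/
inductive BinOp where
  | add | sub | mul | div | mod | lt | eq | and | or | xor | shl | shr

def BinOp.eval : BinOp → ℕ → ℕ → ℕ
  | .add, a, b => a + b
  | .sub, a, b => a - b
  | .mul, a, b => a * b
  | .div, a, b => a / b
  | .mod, a, b => a % b
  | .lt, a, b => if a < b then 1 else 0
  | .eq, a, b => if a = b then 1 else 0
  | .and, a, b => a &&& b
  | .or, a, b => a ||| b
  | .xor, a, b => a ^^^ b
  | .shl, a, b => a <<< b
  | .shr, a, b => a >>> b

/-- Programs; `d`, `a`, `b`, `r` are names of registers.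
* `const d k`: `reg d := k`;
* `op o d a b`: `reg d := o (reg a) (reg b)`;
* `load d a`: `reg d := mem (reg a)`;
* `store a b`: `mem (reg a) := reg b`;
* `rand d a`: `reg d :=` a uniformly random element of `{0, …, reg a - 1}`;
* `seq p q`: first `p`, then `q`;
* `cond r p q`: if `reg r ≠ 0` then `p` else `q`;
* `loop r p`: while `reg r ≠ 0` do `p`. -/
inductive Program where
  | const (d k : ℕ)
  | op (o : BinOp) (d a b : ℕ)
  | load (d a : ℕ)
  | store (a b : ℕ)
  | rand (d a : ℕ)
  | seq (p q : Program)
  | cond (r : ℕ) (p q : Program)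
  | loop (r : ℕ) (p : Program)

/-- The contents of the registers and of the memory. -/
structure Store where
  reg : ℕ → ℕ
  mem : ℕ → ℕ

def Store.setReg (s : Store) (d v : ℕ) : Store := { s with reg := Function.update s.reg d v }

def Store.setMem (s : Store) (a v : ℕ) : Store := { s with mem := Function.update s.mem a v }

/-- The store at the start: the input stands at the beginning of the memory, register `0` holds its
length in words, and everything else is `0`. -/
def Store.init (x : List ℕ) : Store where
  reg := Function.update (fun _ => 0) 0 x.length
  mem := fun i => x.getD i 0

/-- A configuration: the list of programs still to be executed, and the store. The machine has
halted when this list is empty. -/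
abbrev Config : Type := List Program × Store

/-- The distribution of a random number from `{0, …, k - 1}` (and the number `0` if `k = 0`). -/
noncomputable def uniformBelow (k : ℕ) : PMF ℕ :=
  PMF.uniformOfFinset (Finset.range (max k 1)) ⟨0, by simp⟩

/-- One time step of the machine. -/
noncomputable def step : Config → PMF Config
  | ([], s) => PMF.pure ([], s)
  | (.const d k :: K, s) => PMF.pure (K, s.setReg d k)
  | (.op o d a b :: K, s) => PMF.pure (K, s.setReg d (o.eval (s.reg a) (s.reg b)))
  | (.load d a :: K, s) => PMF.pure (K, s.setReg d (s.mem (s.reg a)))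
  | (.store a b :: K, s) => PMF.pure (K, s.setMem (s.reg a) (s.reg b))
  | (.rand d a :: K, s) => (uniformBelow (s.reg a)).map fun v => (K, s.setReg d v)
  | (.seq p q :: K, s) => PMF.pure (p :: q :: K, s)
  | (.cond r p q :: K, s) => PMF.pure (if s.reg r = 0 then q :: K else p :: K, s)
  | (.loop r p :: K, s) => PMF.pure (if s.reg r = 0 then K else p :: .loop r p :: K, s)

/-- The distribution of the configuration of `P` on input `x` after `t` steps. -/
noncomputable def configAfter (P : Program) (x : List ℕ) : ℕ → PMF Config
  | 0 => PMF.pure ([P], Store.init x)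
  | t + 1 => (configAfter P x t).bind step

/-- Every register and every memory cell holds a number that is at most `m`. -/
def Store.Fits (s : Store) (m : ℕ) : Prop := (∀ i, s.reg i ≤ m) ∧ ∀ i, s.mem i ≤ m

/-- On input `x`, the program `P` uses words of logarithmic length (with constant `κ`), halts after
at most `t` steps whatever the random choices are, and with probability at least `2 / 3` it ends in
a store that satisfies `ok`. -/
def RunsIn (P : Program) (κ : ℕ) (x : List ℕ) (t : ℕ) (ok : Store → Prop) : Prop :=
  (∀ k, ∀ c ∈ (configAfter P x k).support, c.2.Fits ((x.length + 2) ^ κ)) ∧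
  (∀ c ∈ (configAfter P x t).support, c.1 = []) ∧
  (2 / 3 : ℝ≥0∞) ≤ (configAfter P x t).toOuterMeasure {c | ok c.2}

end RAM

/-! ### Negative-weight triangles -/

/-- An instance: a tripartite graph on `n` vertices, given together with its three vertex classes
(a proper colouring with three colours), and a symmetric integer weight function on pairs of
vertices. -/
structure NWTInstance where
  n : ℕ
  graph : SimpleGraph (Fin n)
  cls : graph.Coloring (Fin 3)
  weight : Fin n → Fin n → ℤ
  weight_symm : ∀ u v, weight u v = weight v u

namespace NWTInstance

variable (I : NWTInstance)

/-- All weights lie in `[-W, W]`. -/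
def WeightsIn (W : ℕ) : Prop := ∀ u v, |I.weight u v| ≤ (W : ℤ)

/-- `a`, `b`, `c` form a triangle of negative total weight. -/
def IsNegTriangle (a b c : Fin I.n) : Prop :=
  I.graph.Adj a b ∧ I.graph.Adj b c ∧ I.graph.Adj c a ∧
    I.weight a b + I.weight b c + I.weight c a < 0

/-- The decision problem. -/
def HasNegTriangle : Prop := ∃ a b c, I.IsNegTriangle a b c

/-- The counting problem: the number of triangles (as sets of three vertices) of negative total
weight. -/
noncomputable def numNegTriangles : ℕ :=
  {s : Finset (Fin I.n) | ∃ a b c, s = {a, b, c} ∧ I.IsNegTriangle a b c}.ncard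

/-! #### Encoding of instances as arrays of words

Integers are written with as many words of `wordLen` bits as they need, at least one. The number
`2 ^ wordLen` is polynomial in the length of the input. -/

/-- The largest number of bits of the absolute value of a weight. -/
def bitLen : ℕ := Finset.univ.sup fun p : Fin I.n × Fin I.n => (I.weight p.1 p.2).natAbs.size

/-- The number of bits in a word of the encoding. -/
def wordLen : ℕ := (I.n + I.bitLen).size + 1

/-- The number of words that the absolute value of a weight takes. -/
def numWords : ℕ := I.bitLen / I.wordLen + 1

/-- A weight: a word for the sign, then the absolute value, least significant word first. -/
def encodeWeight (z : ℤ) : List ℕ :=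
  (if z < 0 then 1 else 0) ::
    (List.range I.numWords).map fun j => z.natAbs / 2 ^ (I.wordLen * j) % 2 ^ I.wordLen

/-- An instance: a header, the array of vertex classes, the adjacency matrix and the weight
matrix (both row by row). -/
noncomputable def encode : List ℕ :=
  open Classical in
  [I.n, I.wordLen, I.numWords] ++
  ((List.finRange I.n).map fun u => (I.cls u : ℕ)) ++
  ((List.finRange I.n).flatMap fun u => (List.finRange I.n).map fun v =>
    if I.graph.Adj u v then 1 else 0) ++
  ((List.finRange I.n).flatMap fun u => (List.finRange I.n).flatMap fun v =>
    I.encodeWeight (I.weight u v))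

/-- An instance with an error tolerance `ε > 0`: the instance, and then the numerator and the
denominator of `ε` in lowest terms, preceded by their lengths in words, least significant word
first. -/
noncomputable def encodeWithTolerance (ε : ℚ) : List ℕ :=
  let p := Nat.digits (2 ^ I.wordLen) ε.num.natAbs
  let q := Nat.digits (2 ^ I.wordLen) ε.den
  I.encode ++ [p.length, q.length] ++ p ++ q

end NWTInstance

/-- There is a randomised algorithm for the decision problem whose running time on all `n`-vertex
instances with weights from `[-W, W]` is at most `T n W`. The answer is `yes` if register `0` is
nonzero at the end. -/
def HasNWTAlgorithm (T : ℕ → ℕ → ℕ) : Prop :=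
  ∃ (P : RAM.Program) (κ : ℕ), ∀ (I : NWTInstance) (W : ℕ), I.WeightsIn W →
    RAM.RunsIn P κ I.encode (T I.n W) fun s => s.reg 0 ≠ 0 ↔ I.HasNegTriangle

/-- There is a randomised approximation algorithm for the counting problem, with the rational error
tolerance `ε` as part of the input, whose running time on all `n`-vertex instances with weights from
`[-W, W]` is at most `B ε n W`. The output is the quotient of registers `0` and `1`. -/
def HasApproxCountNWTAlgorithm (B : ℚ → ℕ → ℕ → ℝ) : Prop :=
  ∃ (Q : RAM.Program) (κ : ℕ), ∀ (I : NWTInstance) (W : ℕ) (ε : ℚ), I.WeightsIn W → 0 < ε → ε < 1 →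
    ∃ t : ℕ, (t : ℝ) ≤ B ε I.n W ∧
      RAM.RunsIn Q κ (I.encodeWithTolerance ε) t fun s =>
        s.reg 1 ≠ 0 ∧
          |(s.reg 0 : ℚ) / (s.reg 1 : ℚ) - (I.numNegTriangles : ℚ)| ≤ ε * (I.numNegTriangles : ℚ)

/-- `f = Õ(g)`: for some constant `c`, `f(n) = O((log n)^c g(n))` as `n → ∞`. -/
def IsSoftO (f g : ℕ → ℝ) : Prop :=
  ∃ c : ℝ, f =O[atTop] fun n => Real.log n ^ c * g n

/-! Every negative triangle has exactly one vertex in each class. If `deg a` is the number of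
negative triangles at the vertex `a` of the first class, the task is therefore to estimate the sum
`e` of these degrees. The estimate comes from repeated halving: in each of `L` levels every living
vertex survives with probability 1/2 and the weight of the survivors doubles. Before level `i` the
estimate is `z + 2 ^ i * degSum A`, where `z` is the part already counted and `A` is the set of
living vertices. Its expectation never changes, and with `2 ^ L ≥ 32 n` probably no vertex is alive
at the end, so that `z` is the result. A halving step adds the variance `4 ^ i * ∑ deg²`, which is
too large if a few vertices have most of the triangles; such vertices must be found and counted
exactly before each halving.

To find them, every pair `(b, c)` is chosen independently with probability `1/k`, and the edges
between the second and the third class that are not chosen are removed. Whether a living vertex in a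
given range forms a negative triangle with a chosen pair ("is hit") is then a decision query on a
subgraph with the same `n` and the same weights (`hasNegTriangle_restrict`), and binary search finds
such a vertex. If the living vertices have degree sum `x`, at most `x / k` of them are hit on
average (`avg_card_hits`), and the squares of the degrees of the others sum up to at most `x * (k -
1)` on average (`avg_sum_sq_sdiff_hits`). For `k` near `x / X` this means `O(X)` searches and a
remaining variance of `x ^ 2 / X` times the squared weight; `X = 40 L M ^ 2` suffices, where `M` is
about `1 / ε`. As `x` is unknown, all powers of two are tried for `k`, with at most `K` removals for
each. Superfluous rounds do no harm: removing any vertex together with its exact contribution leaves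
the estimate unchanged (`wp_killVertex`).

A majority vote makes the errors of the queries negligible (`wp_voteProg`, `total_error_le`). The
number of queries is the product of the number of levels, rounds, removals, search steps and votes,
that is `O(M ^ 2 * (log n) ^ 6)`. If `M ^ 4 ≥ n`, exact counting by brute force fits into the second
term of the time bound.

The probability estimates are carried out in a program logic with error credits (`Good`, `WP`): a
program starts with a credit that bounds the probability of failure, and each random choice may
redistribute the credit, keeping its average. Credit of at least 1 pays for everything, hence the
many guarantees of the form `r < 1 → …`. Chebyshev's inequality becomes a potential function
(`theta`, `isPotential`, `wp_mainLoop`) that contains the squared relative error of the estimate.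
The decision program runs as a subroutine in shifted registers and in a fresh part of the memory
(`relocate`).

Main registers of the counting program: `14` start of the free memory, `20` the weight `2 ^ i`, `21`
the number `k`, `22` the sum `z`, `27` to `29` the range of a search, `31` the vertex found, `61` to
`63` scratch, `64` and above the subroutine. -/

namespace RAM

/-! ### Elementary semantics: finite averages instead of probability measures. -/

/-- The number of equally likely outcomes of the next step. -/
def width : Config → ℕ
  | (.rand _ a :: _, s) => max (s.reg a) 1
  | _ => 1

/-- The next configuration if the random choice of the step is `v`. -/
def next : Config → ℕ → Config
  | ([], s), _ => ([], s)
  | (.const d k :: K, s), _ => (K, s.setReg d k)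
  | (.op o d a b :: K, s), _ => (K, s.setReg d (o.eval (s.reg a) (s.reg b)))
  | (.load d a :: K, s), _ => (K, s.setReg d (s.mem (s.reg a)))
  | (.store a b :: K, s), _ => (K, s.setMem (s.reg a) (s.reg b))
  | (.rand d _ :: K, s), v => (K, s.setReg d v)
  | (.seq p q :: K, s), _ => (p :: q :: K, s)
  | (.cond r p q :: K, s), _ => (if s.reg r = 0 then q :: K else p :: K, s)
  | (.loop r p :: K, s), _ => (if s.reg r = 0 then K else p :: .loop r p :: K, s)

theorem width_pos (c : Config) : 0 < width c := by
  unfold width; split <;> simp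

theorem uniformBelow_max_one (k : ℕ) : uniformBelow (max k 1) = uniformBelow k := by
  unfold uniformBelow; congr 2; simp

theorem uniformBelow_apply {k : ℕ} (hk : 0 < k) (v : ℕ) :
    uniformBelow k v = if v < k then (k : ℝ≥0∞)⁻¹ else 0 := by
  have hm : max k 1 = k := max_eq_left hk
  refine (PMF.uniformOfFinset_apply _ v).trans ?_
  simp [hm]

theorem uniformBelow_one : uniformBelow 1 = PMF.pure 0 := by
  ext v
  simp [uniformBelow, PMF.uniformOfFinset_apply, PMF.pure_apply]

/-- Deterministic instructions count as a choice among one outcome, so that all later arguments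
treat every step in the same way. -/
theorem step_eq (c : Config) : step c = (uniformBelow (width c)).map (next c) := by
  obtain ⟨K, s⟩ := c
  rcases K with _ | ⟨p, K⟩
  · simp [step, width, next, uniformBelow_one, PMF.pure_map]
  · cases p <;>
      simp [step, width, next, uniformBelow_one, PMF.pure_map, uniformBelow_max_one]; rfl

/-- The distribution of the configuration after `t` steps from `c`. -/
noncomputable def runFrom : ℕ → Config → PMF Config
  | 0, c => PMF.pure c
  | t + 1, c => (step c).bind (runFrom t)

theorem configAfter_add (P : Program) (x : List ℕ) (k j : ℕ) :
    configAfter P x (k + j) = (configAfter P x k).bind (runFrom j) := by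
  induction j generalizing k with
  | zero => simp [runFrom]
  | succ j ih =>
    rw [show k + (j + 1) = (k + 1) + j by omega, ih (k + 1)]
    simp [configAfter, PMF.bind_bind, runFrom]

theorem configAfter_eq_runFrom (P : Program) (x : List ℕ) (t : ℕ) :
    configAfter P x t = runFrom t ([P], Store.init x) := by
  have := configAfter_add P x 0 t
  simpa [configAfter] using this

theorem mem_support_step (c c' : Config) :
    c' ∈ (step c).support ↔ ∃ v < width c, next c v = c' := by
  rw [step_eq, PMF.mem_support_map_iff]
  simp [uniformBelow, Nat.one_le_iff_ne_zero, (width_pos c).ne']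

/-- From `c` the machine halts within `t` steps, and all numbers that occur are at most `m`. -/
def Safe (m : ℕ) : ℕ → Config → Prop
  | 0, c => c.2.Fits m ∧ c.1 = []
  | t + 1, c => c.2.Fits m ∧ ∀ v < width c, Safe m t (next c v)

/-- The expectation of `h` after `t` steps from `c`. -/
noncomputable def expect (h : Store → ℝ) : ℕ → Config → ℝ
  | 0, c => h c.2
  | t + 1, c => (∑ v ∈ Finset.range (width c), expect h t (next c v)) / width c

variable {m : ℕ} {h : Store → ℝ}

theorem Safe.fits {t : ℕ} {c : Config} (H : Safe m t c) : c.2.Fits m := by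
  cases t <;> exact H.1

theorem Safe.succ {t : ℕ} {c : Config} (H : Safe m t c) : Safe m (t + 1) c := by
  induction t generalizing c with
  | zero =>
    refine ⟨H.1, fun v _ => ?_⟩
    obtain ⟨K, s⟩ := c
    obtain ⟨h1, rfl⟩ := H
    exact ⟨h1, rfl⟩
  | succ t ih => exact ⟨H.1, fun v hv => ih (H.2 v hv)⟩

/-- A safe configuration has halted on every branch after `t` steps, and a halted machine stays
where it is. -/
theorem expect_succ {t : ℕ} {c : Config} (H : Safe m t c) :
    expect h (t + 1) c = expect h t c := by
  induction t generalizing c with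
  | zero =>
    obtain ⟨K, s⟩ := c
    obtain ⟨h1, rfl⟩ := H
    simp [expect, width, next]
  | succ t ih =>
    rw [expect, expect]
    congr 1
    exact Finset.sum_congr rfl fun v hv => ih (H.2 v (Finset.mem_range.1 hv))

theorem expect_const (a : ℝ) (t : ℕ) (c : Config) : expect (fun _ => a) t c = a := by
  induction t generalizing c with
  | zero => rfl
  | succ t ih =>
    have : (width c : ℝ) ≠ 0 := by exact_mod_cast (width_pos c).ne'
    simp only [expect, ih]
    simp; field_simp

theorem expect_add (h₁ h₂ : Store → ℝ) (t : ℕ) (c : Config) :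
    expect (fun s => h₁ s + h₂ s) t c = expect h₁ t c + expect h₂ t c := by
  induction t generalizing c with
  | zero => rfl
  | succ t ih => simp only [expect, ih, Finset.sum_add_distrib, add_div]

theorem expect_mul (a : ℝ) (h : Store → ℝ) (t : ℕ) (c : Config) :
    expect (fun s => a * h s) t c = a * expect h t c := by
  induction t generalizing c with
  | zero => rfl
  | succ t ih => simp only [expect, ih, ← Finset.mul_sum, mul_div_assoc]

theorem expect_mono {h₁ h₂ : Store → ℝ} (H : ∀ s, h₁ s ≤ h₂ s) (t : ℕ) (c : Config) :
    expect h₁ t c ≤ expect h₂ t c := by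
  induction t generalizing c with
  | zero => exact H _
  | succ t ih =>
    simp only [expect]
    gcongr
    exact ih _

open Classical in
/-- The indicator function of failure. -/
noncomputable def failure (ok : Store → Prop) (s : Store) : ℝ := if ok s then 0 else 1

theorem failure_le_one (ok : Store → Prop) (s : Store) : failure ok s ≤ 1 := by
  unfold failure; split <;> simp

/-- From `c` the machine halts within `t` steps, all numbers that occur are at most `m`, and the
probability that the final store does not satisfy `ok` is at most `r`. -/
def Good (m : ℕ) (ok : Store → Prop) (t : ℕ) (c : Config) (r : ℝ) : Prop :=
  Safe m t c ∧ expect (failure ok) t c ≤ r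

theorem Good.mono {ok : Store → Prop} {t t' : ℕ} {c : Config} {r r' : ℝ}
    (H : Good m ok t c r) (ht : t ≤ t') (hr : r ≤ r') : Good m ok t' c r' := by
  induction ht with
  | refl => exact ⟨H.1, H.2.trans hr⟩
  | step _ ih => exact ⟨ih.1.succ, (expect_succ ih.1).trans_le ih.2⟩

theorem Good.fits {ok : Store → Prop} {t : ℕ} {c : Config} {r : ℝ}
    (H : Good m ok t c r) : c.2.Fits m := H.1.fits

/-- The rule for one step. -/
theorem Good.step {ok : Store → Prop} {t : ℕ} {c : Config} {r : ℝ} (f : ℕ → ℝ)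
    (hc : c.2.Fits m) (H : ∀ v < width c, Good m ok t (next c v) (f v))
    (hf : ∑ v ∈ Finset.range (width c), f v ≤ width c * r) : Good m ok (t + 1) c r := by
  refine ⟨⟨hc, fun v hv => (H v hv).1⟩, ?_⟩
  have : (0 : ℝ) < width c := by exact_mod_cast width_pos c
  rw [expect, div_le_iff₀ this, mul_comm]
  refine le_trans (Finset.sum_le_sum fun v hv => (H v (Finset.mem_range.1 hv)).2) hf

theorem Good.step_det {ok : Store → Prop} {t : ℕ} {c : Config} {r : ℝ}
    (hc : c.2.Fits m) (hw : width c = 1) (H : Good m ok t (next c 0) r) :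
    Good m ok (t + 1) c r := by
  refine Good.step (fun _ => r) hc (fun v hv => ?_) (by simp [hw])
  obtain rfl : v = 0 := by omega
  exact H

/-- The bridge from the distributions of the machine model to the recursion `expect`; both are
unfolded at the first step of the run. -/
theorem expect_eq_outerMeasure (S : Set Store) (t : ℕ) (c : Config) :
    (runFrom t c).toOuterMeasure {c | c.2 ∈ S} =
      ENNReal.ofReal (expect (S.indicator fun _ => 1) t c) := by
  have h0 : ∀ t c, 0 ≤ expect (S.indicator fun _ => 1) t c := fun t c => by
    have := expect_mono (h₁ := fun _ => 0) (h₂ := S.indicator fun _ => 1)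
      (fun s => Set.indicator_nonneg (by simp) s) t c
    rwa [expect_const] at this
  induction t generalizing c with
  | zero =>
    rw [runFrom, expect, PMF.toOuterMeasure_pure_apply]
    by_cases hc : c.2 ∈ S <;> simp [hc]
  | succ t ih =>
    have hw := width_pos c
    rw [runFrom, expect, step_eq, PMF.bind_map, PMF.toOuterMeasure_bind_apply]
    simp only [Function.comp, ih]
    rw [tsum_eq_sum (s := Finset.range (width c))]
    · rw [ENNReal.ofReal_div_of_pos (by exact_mod_cast hw),
        ENNReal.ofReal_sum_of_nonneg (fun _ _ => h0 _ _), ENNReal.div_eq_inv_mul, Finset.mul_sum]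
      refine Finset.sum_congr rfl fun v hv => ?_
      rw [uniformBelow_apply hw, if_pos (Finset.mem_range.1 hv)]
      simp
    · intro v hv
      rw [uniformBelow_apply hw, if_neg (by simpa using hv), zero_mul]

theorem prob_ok_eq (ok : Store → Prop) (P : Program) (x : List ℕ) (t : ℕ) :
    (configAfter P x t).toOuterMeasure {c | ok c.2} =
      ENNReal.ofReal (1 - expect (failure ok) t ([P], Store.init x)) := by
  rw [configAfter_eq_runFrom]
  have := expect_eq_outerMeasure {s | ok s} t ([P], Store.init x)
  rw [show {c : Config | c.2 ∈ {s | ok s}} = {c | ok c.2} from rfl] at this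
  rw [this]
  congr 1
  rw [eq_sub_iff_add_eq, ← expect_add]
  refine Eq.trans ?_ (expect_const 1 t ([P], Store.init x))
  congr 1
  ext s
  by_cases hs : ok s <;> simp [failure, hs]

theorem Safe.of_mem_support {t : ℕ} {P : Program} {x : List ℕ}
    (H : Safe m t ([P], Store.init x)) {k : ℕ} {c : Config}
    (hc : c ∈ (configAfter P x k).support) : Safe m (t - k) c := by
  induction k generalizing c with
  | zero =>
    simp only [configAfter, PMF.mem_support_pure_iff] at hc
    rw [hc]; exact H
  | succ k ih =>
    simp only [configAfter, PMF.mem_support_bind_iff] at hc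
    obtain ⟨c', hc', h⟩ := hc
    obtain ⟨v, hv, rfl⟩ := (mem_support_step _ _).1 h
    have h1 := ih hc'
    -- The subtraction is truncated: past time `t` the machine has halted, and `Safe m 0` persists.
    rcases Nat.eq_zero_or_pos (t - k) with h0 | h0
    · have : t - (k + 1) = 0 := by omega
      rw [this]; rw [h0] at h1
      exact h1.succ.2 v hv
    · obtain ⟨j, hj⟩ : ∃ j, t - k = j + 1 := ⟨t - k - 1, by omega⟩
      rw [show t - (k + 1) = j by omega]
      rw [hj] at h1
      exact h1.2 v hv

/-- With `RunsIn.good` this gives both directions between the model and the program logic: the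
counting program is verified on the side of `Good`, and the hypothesis about the decision program is
brought there as well. -/
theorem Good.runsIn {P : Program} {κ : ℕ} {x : List ℕ} {t : ℕ} {ok : Store → Prop}
    (H : Good ((x.length + 2) ^ κ) ok t ([P], Store.init x) (1 / 3)) : RunsIn P κ x t ok := by
  refine ⟨fun k c hc => (H.1.of_mem_support hc).fits, fun c hc => ?_, ?_⟩
  · have := H.1.of_mem_support hc
    rw [Nat.sub_self] at this
    exact this.2
  · rw [prob_ok_eq, show (2 / 3 : ℝ≥0∞) = ENNReal.ofReal (2 / 3) by
      rw [ENNReal.ofReal_div_of_pos (by norm_num)]; simp]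
    exact ENNReal.ofReal_le_ofReal (by linarith [H.2])

theorem RunsIn.good {P : Program} {κ : ℕ} {x : List ℕ} {t : ℕ} {ok : Store → Prop}
    (H : RunsIn P κ x t ok) : Good ((x.length + 2) ^ κ) ok t ([P], Store.init x) (1 / 3) := by
  obtain ⟨h1, h2, h3⟩ := H
  constructor
  · have key : ∀ j k, k + j = t → ∀ c ∈ (configAfter P x k).support,
        Safe ((x.length + 2) ^ κ) j c := by
      intro j
      induction j with
      | zero => intro k hk c hc; subst hk; exact ⟨h1 _ c hc, h2 c hc⟩
      | succ j ih =>
        intro k hk c hc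
        refine ⟨h1 _ c hc, fun v hv => ih (k + 1) (by omega) _ ?_⟩
        rw [configAfter, PMF.mem_support_bind_iff]
        exact ⟨c, hc, (mem_support_step _ _).2 ⟨v, hv, rfl⟩⟩
    exact key t 0 (by omega) _ (by simp [configAfter])
  · rw [prob_ok_eq, show (2 / 3 : ℝ≥0∞) = ENNReal.ofReal (2 / 3) by
      rw [ENNReal.ofReal_div_of_pos (by norm_num)]; simp] at h3
    rw [ENNReal.ofReal_le_ofReal_iff'] at h3
    rcases h3 with h3 | h3
    · linarith
    · norm_num at h3

end RAM

/-! ### Program logic with error credits. -/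

namespace RAM

/-- `writes P q`: the program `P` contains an instruction that writes to register `q`. -/
def writes : Program → ℕ → Prop
  | .const d _, q => q = d
  | .op _ d _ _, q => q = d
  | .load d _, q => q = d
  | .store _ _, _ => False
  | .rand d _, q => q = d
  | .seq p p', q => writes p q ∨ writes p' q
  | .cond _ p p', q => writes p q ∨ writes p' q
  | .loop _ p, q => writes p q

/-- Total correctness with error credits. If `P` is started in the store `s` with the credit `r`,
then after at most `t` steps it ends in a store and with a credit that satisfy `Post`; a random
choice may distribute the credit over its outcomes, keeping the average. The credit bounds the
probability of failure of what follows. -/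
def WP (m : ℕ) (P : Program) (t : ℕ) (Post : Store → ℝ → Prop) (s : Store) (r : ℝ) : Prop :=
  ∀ (ok : Store → Prop) (K : List Program) (t' : ℕ), s.Fits m →
    (∀ s' r', s'.Fits m → (∀ q, ¬ writes P q → s'.reg q = s.reg q) → Post s' r' →
      Good m ok t' (K, s') r') →
    Good m ok (t + t') (P :: K, s) r

@[simp] theorem Store.setReg_reg (s : Store) (d v q : ℕ) :
    (s.setReg d v).reg q = if q = d then v else s.reg q := by
  simp [Store.setReg, Function.update_apply]

@[simp] theorem Store.setReg_mem (s : Store) (d v : ℕ) : (s.setReg d v).mem = s.mem := rfl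

@[simp] theorem Store.setMem_reg (s : Store) (a v : ℕ) : (s.setMem a v).reg = s.reg := rfl

@[simp] theorem Store.setMem_mem (s : Store) (a v q : ℕ) :
    (s.setMem a v).mem q = if q = a then v else s.mem q := by
  simp [Store.setMem, Function.update_apply]

theorem Store.Fits.setReg {m : ℕ} {s : Store} (h : s.Fits m) {d v : ℕ} (hv : v ≤ m) :
    (s.setReg d v).Fits m := by
  refine ⟨fun q => ?_, h.2⟩
  rw [Store.setReg_reg]; split
  · exact hv
  · exact h.1 q

theorem Store.Fits.setMem {m : ℕ} {s : Store} (h : s.Fits m) {d v : ℕ} (hv : v ≤ m) :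
    (s.setMem d v).Fits m := by
  refine ⟨h.1, fun q => ?_⟩
  rw [Store.setMem_mem]; split
  · exact hv
  · exact h.2 q

variable {m t : ℕ} {P p p' : Program} {Post : Store → ℝ → Prop} {s : Store} {r : ℝ}

namespace WP

theorem conseq {Post' : Store → ℝ → Prop} (H : WP m P t Post s r) {t' : ℕ} (ht : t ≤ t')
    (h : ∀ s' r', s'.Fits m → (∀ q, ¬ writes P q → s'.reg q = s.reg q) → Post s' r' →
      Post' s' r') : WP m P t' Post' s r := fun ok K u hs hK =>
  (H ok K u hs fun s' r' h1 h2 h3 => hK s' r' h1 h2 (h s' r' h1 h2 h3)).mono (by omega) le_rfl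

theorem mono_time (H : WP m P t Post s r) {t' : ℕ} (ht : t ≤ t') : WP m P t' Post s r :=
  H.conseq ht fun _ _ _ _ h => h

theorem of_fits (H : s.Fits m → WP m P t Post s r) : WP m P t Post s r :=
  fun ok K u hs hK => H hs ok K u hs hK

theorem const {d k : ℕ} (hk : k ≤ m) (h : Post (s.setReg d k) r) :
    WP m (.const d k) 1 Post s r := fun ok K t' hs hK => by
  rw [add_comm]
  exact Good.step_det hs rfl (hK _ _ (hs.setReg hk) (fun q hq => by simp_all [writes]) h)

theorem op {o : BinOp} {d a b : ℕ} (hk : o.eval (s.reg a) (s.reg b) ≤ m)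
    (h : Post (s.setReg d (o.eval (s.reg a) (s.reg b))) r) :
    WP m (.op o d a b) 1 Post s r := fun ok K t' hs hK => by
  rw [add_comm]
  exact Good.step_det hs rfl (hK _ _ (hs.setReg hk) (fun q hq => by simp_all [writes]) h)

theorem load {d a : ℕ} (h : Post (s.setReg d (s.mem (s.reg a))) r) :
    WP m (.load d a) 1 Post s r := fun ok K t' hs hK => by
  rw [add_comm]
  exact Good.step_det hs rfl (hK _ _ (hs.setReg (hs.2 _)) (fun q hq => by simp_all [writes]) h)

theorem store {a b : ℕ} (h : Post (s.setMem (s.reg a) (s.reg b)) r) :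
    WP m (.store a b) 1 Post s r := fun ok K t' hs hK => by
  rw [add_comm]
  exact Good.step_det hs rfl (hK _ _ (hs.setMem (hs.1 _)) (fun q hq => by simp) h)

theorem rand {d a : ℕ} (f : ℕ → ℝ) (hk : 0 < s.reg a)
    (hf : ∑ v ∈ Finset.range (s.reg a), f v ≤ s.reg a * r)
    (h : ∀ v < s.reg a, Post (s.setReg d v) (f v)) :
    WP m (.rand d a) 1 Post s r := fun ok K t' hs hK => by
  rw [add_comm]
  have hw : width (.rand d a :: K, s) = s.reg a := max_eq_left hk
  refine Good.step f hs (fun v hv => ?_) (by rwa [hw])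
  rw [hw] at hv
  exact hK _ _ (hs.setReg (hv.le.trans (hs.1 a))) (fun q hq => by simp_all [writes]) (h v hv)

theorem seq {t' : ℕ} (h : WP m p t (fun s' r' => WP m p' t' Post s' r') s r) :
    WP m (.seq p p') (1 + t + t') Post s r := fun ok K u hs hK => by
  rw [show 1 + t + t' + u = (t + (t' + u)) + 1 by omega]
  refine Good.step_det hs rfl (h ok _ _ hs fun s' r' h1 h2 h3 => ?_)
  refine h3 ok K u h1 fun s'' r'' h4 h5 h6 => hK s'' r'' h4 (fun q hq => ?_) h6
  simp only [writes, not_or] at hq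
  rw [h5 q hq.2, h2 q hq.1]

theorem cond {d : ℕ} (h1 : s.reg d ≠ 0 → WP m p t Post s r)
    (h2 : s.reg d = 0 → WP m p' t Post s r) :
    WP m (.cond d p p') (1 + t) Post s r := fun ok K u hs hK => by
  rw [show 1 + t + u = (t + u) + 1 by omega]
  refine Good.step_det hs rfl ?_
  by_cases hd : s.reg d = 0
  · simp only [next, hd, if_true]
    exact h2 hd ok K u hs fun s' r' h1 h2 h3 => hK s' r' h1
      (fun q hq => h2 q (by simp only [writes, not_or] at hq; exact hq.2)) h3
  · simp only [next, hd, if_false]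
    exact h1 hd ok K u hs fun s' r' h1 h2 h3 => hK s' r' h1
      (fun q hq => h2 q (by simp only [writes, not_or] at hq; exact hq.1)) h3

/-- The number of iterations is fixed beforehand, and the invariant alone determines the guard. All
loops of the counting program are counting loops, so no variant is needed and the time is a plain
product. -/
theorem loop {d n tb : ℕ} (Inv : ℕ → Store → ℝ → Prop) (h0 : Inv 0 s r)
    (hn : ∀ s' r', Inv n s' r' → s'.reg d = 0)
    (hk : ∀ k < n, ∀ s' r', Inv k s' r' → s'.reg d ≠ 0)
    (hstep : ∀ k < n, ∀ s' r', s'.Fits m → (∀ q, ¬ writes p q → s'.reg q = s.reg q) →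
      Inv k s' r' → WP m p tb (Inv (k + 1)) s' r') :
    WP m (.loop d p) (n * (tb + 1) + 1) (Inv n) s r := fun ok K u hs hK => by
  have key : ∀ j k, k + j = n → ∀ s' r', s'.Fits m → (∀ q, ¬ writes p q → s'.reg q = s.reg q) →
      Inv k s' r' → Good m ok (j * (tb + 1) + 1 + u) (.loop d p :: K, s') r' := by
    intro j
    induction j with
    | zero =>
      intro k hkn s' r' h1 h2 h3
      obtain rfl : k = n := by omega
      rw [show 0 * (tb + 1) + 1 + u = u + 1 by omega]
      refine Good.step_det h1 rfl ?_
      simp only [next, hn s' r' h3, if_true]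
      exact hK s' r' h1 h2 h3
    | succ j ih =>
      intro k hkn s' r' h1 h2 h3
      rw [show (j + 1) * (tb + 1) + 1 + u = (tb + (j * (tb + 1) + 1 + u)) + 1 by ring]
      refine Good.step_det h1 rfl ?_
      simp only [next, hk k (by omega) s' r' h3, if_false]
      refine hstep k (by omega) s' r' h1 h2 h3 ok _ _ h1 fun s'' r'' h4 h5 h6 => ?_
      exact ih (k + 1) (by omega) s'' r'' h4 (fun q hq => by rw [h5 q hq, h2 q hq]) h6
  exact key n 0 (by omega) s r hs (fun _ _ => rfl) h0

end WP

/-! ### Straight-line code and counting loops. -/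

/-- The effect of a single deterministic instruction. -/
def exec1 : Program → Store → Store
  | .const d k, s => s.setReg d k
  | .op o d a b, s => s.setReg d (o.eval (s.reg a) (s.reg b))
  | .load d a, s => s.setReg d (s.mem (s.reg a))
  | .store a b, s => s.setMem (s.reg a) (s.reg b)
  | _, s => s

/-- A deterministic instruction does not produce a number greater than `m`. -/
def Fine1 (m : ℕ) : Program → Store → Prop
  | .const _ k, _ => k ≤ m
  | .op .add _ a b, s => s.reg a + s.reg b ≤ m
  | .op .mul _ a b, s => s.reg a * s.reg b ≤ m
  | .op .or _ a b, s => s.reg a ||| s.reg b ≤ m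
  | .op .xor _ a b, s => s.reg a ^^^ s.reg b ≤ m
  | .op .shl _ a b, s => s.reg a <<< s.reg b ≤ m
  | .op _ _ _ _, _ => True
  | .load _ _, _ => True
  | .store _ _, _ => True
  | _, _ => False

/-- The effect of a list of deterministic instructions. -/
def exec : List Program → Store → Store
  | [], s => s
  | p :: l, s => exec l (exec1 p s)

/-- A list of deterministic instructions does not produce a number greater than `m`. -/
def Fine (m : ℕ) : List Program → Store → Prop
  | [], _ => True
  | p :: l, s => Fine1 m p s ∧ Fine m l (exec1 p s)

/-- Straight-line code. -/
def block : List Program → Program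
  | [] => .const 63 0
  | [p] => p
  | p :: p' :: l => .seq p (block (p' :: l))

/-- Difference, quotient, remainder, conjunction and right shift do not exceed their first operand,
and comparisons give at most 1; only the operations that can grow leave an obligation in `Fine1`. -/
theorem WP.of_fine1 (hm : 1 ≤ m) (hf : Fine1 m p s) (h : Post (exec1 p s) r) :
    WP m p 1 Post s r := by
  refine WP.of_fits fun hs => ?_
  have ha := hs.1
  cases p with
  | const d k => exact WP.const hf h
  | op o d a b =>
    refine WP.op ?_ h
    cases o
    · exact hf
    · exact (Nat.sub_le _ _).trans (ha a)
    · exact hf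
    · exact (Nat.div_le_self _ _).trans (ha a)
    · exact (Nat.mod_le _ _).trans (ha a)
    · simp only [BinOp.eval]; split <;> omega
    · simp only [BinOp.eval]; split <;> omega
    · exact Nat.and_le_left.trans (ha a)
    · exact hf
    · exact hf
    · exact hf
    · exact (Nat.shiftRight_le _ _).trans (ha a)
  | load d a => exact WP.load h
  | store a b => exact WP.store h
  | rand d a => exact hf.elim
  | seq p q => exact hf.elim
  | cond d p q => exact hf.elim
  | loop d p => exact hf.elim

theorem WP.block (hm : 1 ≤ m) {l : List Program} (hl : l ≠ []) (hf : Fine m l s)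
    (h : Post (exec l s) r) : WP m (block l) (2 * l.length) Post s r := by
  induction l generalizing s with
  | nil => exact absurd rfl hl
  | cons p l ih =>
    cases l with
    | nil => exact (WP.of_fine1 hm hf.1 h).mono_time (by simp)
    | cons p' l =>
      refine WP.mono_time (WP.seq (WP.of_fine1 hm hf.1 (ih (by simp) hf.2 h)))
        (by simp only [List.length_cons]; omega)

theorem WP.seq_le {t' T : ℕ} (h : WP m p t (fun s' r' => WP m p' t' Post s' r') s r)
    (hT : 1 + t + t' ≤ T) : WP m (.seq p p') T Post s r := (WP.seq h).mono_time hT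

theorem WP.block_le (hm : 1 ≤ m) {l : List Program} {T : ℕ} (hl : l ≠ []) (hf : Fine m l s)
    (h : Post (exec l s) r) (hT : 2 * l.length ≤ T) : WP m (RAM.block l) T Post s r :=
  (WP.block hm hl hf h).mono_time hT

theorem WP.block_seq (hm : 1 ≤ m) {l : List Program} {t' T : ℕ} (hl : l ≠ []) (hf : Fine m l s)
    (h : WP m p' t' Post (exec l s) r) (hT : 2 * l.length + 1 + t' ≤ T) :
    WP m (.seq (RAM.block l) p') T Post s r :=
  WP.seq_le (WP.block (Post := fun s' r' => WP m p' t' Post s' r') hm hl hf h) (by omega)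

/-- `for i from 0 to reg lim - 1 do body`; registers `62` and `63` are scratch. -/
def forLoop (i lim : ℕ) (body : Program) : Program :=
  .seq (block [.const i 0, .op .lt 62 i lim])
    (.loop 62 (.seq body (block [.const 63 1, .op .add i i 63, .op .lt 62 i lim])))

theorem WP.forLoop {i lim n tb : ℕ} {body : Program} (Inv : ℕ → Store → ℝ → Prop) (hm : 1 ≤ m)
    (hlim : s.reg lim = n) (hi : i < 62) (hl : lim < 62) (hil : i ≠ lim)
    (hlw : ¬ writes body lim) (hiw : ¬ writes body i)
    (h0 : ∀ v, Inv 0 ((s.setReg i 0).setReg 62 v) r)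
    (hstep : ∀ k < n, ∀ s' r', s'.Fits m →
      (∀ q, ¬ writes (forLoop i lim body) q → s'.reg q = s.reg q) →
      s'.reg i = k → Inv k s' r' →
      WP m body tb (fun s'' r'' =>
        ∀ v, Inv (k + 1) (((s''.setReg 63 1).setReg i (k + 1)).setReg 62 v) r'') s' r') :
    WP m (forLoop i lim body) (n * (tb + 8) + 6) (Inv n) s r := by
  refine WP.of_fits fun hs => ?_
  have hnm : n ≤ m := hlim ▸ hs.1 lim
  have hlw' : ∀ q, ¬ writes (RAM.forLoop i lim body) q → ¬ writes body q ∧ q ≠ i ∧ q ≠ 62 ∧ q ≠ 63 := by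
    intro q hq
    simp only [RAM.forLoop, RAM.block, writes] at hq
    tauto
  refine WP.mono_time (t' := n * (tb + 8) + 6)
    (WP.seq (t := 4) (t' := n * (1 + tb + 6 + 1) + 1) (WP.block hm (by simp)
    (by simp [Fine, Fine1]) ?_)) (by ring_nf; omega)
  · let J : ℕ → Store → ℝ → Prop := fun k s' r' => Inv k s' r' ∧ s'.reg i = k ∧ s'.reg lim = n ∧
      s'.reg 62 = (if k < n then 1 else 0) ∧
      (∀ q, ¬ writes (RAM.forLoop i lim body) q → s'.reg q = s.reg q)
    refine WP.conseq (WP.loop (n := n) J ?_ ?_ ?_ ?_) le_rfl fun s' r' _ _ h => h.1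
    · refine ⟨h0 _, ?_⟩
      simp [exec, exec1, BinOp.eval, hlim, hi.ne, hl.ne, hil.symm]
      intro q hq
      have := hlw' q hq
      simp [this]
    · intro s' r' h; simpa using h.2.2.2.1
    · intro k hk s' r' h; rw [h.2.2.2.1, if_pos hk]; simp
    · intro k hk s' r' hs' hfr h
      obtain ⟨h1, h2, h3, h4, h5⟩ := h
      refine WP.seq (WP.conseq (hstep k hk s' r' hs' h5 h2 h1) le_rfl ?_)
      intro s'' r'' hs'' hw h6
      have e1 : s''.reg i = k := by rw [hw i hiw, h2]
      have e2 : s''.reg lim = n := by rw [hw lim hlw, h3]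
      refine WP.block hm (by simp) ?_ ?_
      · simp [Fine, Fine1, exec1, e1, show i ≠ 63 by omega, hm]; omega
      · simp only [exec, exec1, BinOp.eval]
        refine ⟨?_, ?_⟩
        · simp [e1, e2, show i ≠ 63 by omega, show lim ≠ 63 by omega, hil.symm]
          exact h6 _
        · simp [e1, e2, show i ≠ 63 by omega, show lim ≠ 63 by omega, hil.symm, hi.ne, hl.ne]
          intro q hq
          obtain ⟨q1, q2, q3, q4⟩ := hlw' q hq
          simp [q2, q3, q4, hw q q1, h5 q hq]

end RAM

/-! ### The decision program as a subroutine. -/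

namespace RAM

/-- All registers of the program are smaller than `b`. -/
def RegsBelow (b : ℕ) : Program → Prop
  | .const d _ => d < b
  | .op _ d a a' => d < b ∧ a < b ∧ a' < b
  | .load d a => d < b ∧ a < b
  | .store a a' => a < b ∧ a' < b
  | .rand d a => d < b ∧ a < b
  | .seq p q => RegsBelow b p ∧ RegsBelow b q
  | .cond d p q => d < b ∧ RegsBelow b p ∧ RegsBelow b q
  | .loop d p => d < b ∧ RegsBelow b p

theorem RegsBelow.mono {b b' : ℕ} (hb : b ≤ b') {P : Program} (h : RegsBelow b P) :
    RegsBelow b' P := by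
  induction P <;> simp only [RegsBelow] at * <;> grind

theorem exists_regsBelow (P : Program) : ∃ b, RegsBelow b P := by
  induction P with
  | const d k => exact ⟨d + 1, by simp [RegsBelow]⟩
  | op o d a a' => exact ⟨d + a + a' + 1, by simp only [RegsBelow]; omega⟩
  | load d a => exact ⟨d + a + 1, by simp only [RegsBelow]; omega⟩
  | store d a => exact ⟨d + a + 1, by simp only [RegsBelow]; omega⟩
  | rand d a => exact ⟨d + a + 1, by simp only [RegsBelow]; omega⟩
  | seq p q hp hq =>
    obtain ⟨b, hb⟩ := hp
    obtain ⟨b', hb'⟩ := hq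
    exact ⟨b + b', hb.mono (by omega), hb'.mono (by omega)⟩
  | cond d p q hp hq =>
    obtain ⟨b, hb⟩ := hp
    obtain ⟨b', hb'⟩ := hq
    exact ⟨b + b' + d + 1, by omega, hb.mono (by omega), hb'.mono (by omega)⟩
  | loop d p hp =>
    obtain ⟨b, hb⟩ := hp
    exact ⟨b + d + 1, by omega, hb.mono (by omega)⟩

/-- The program `P` with its registers moved up by `64` and its memory moved to the address in
register `14`; register `61` is scratch. -/
def relocate : Program → Program
  | .const d k => .const (d + 64) k
  | .op o d a b => .op o (d + 64) (a + 64) (b + 64)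
  | .load d a => .seq (.op .add 61 14 (a + 64)) (.load (d + 64) 61)
  | .store a b => .seq (.op .add 61 14 (a + 64)) (.store 61 (b + 64))
  | .rand d a => .rand (d + 64) (a + 64)
  | .seq p q => .seq (relocate p) (relocate q)
  | .cond d p q => .cond (d + 64) (relocate p) (relocate q)
  | .loop d p => .loop (d + 64) (relocate p)

/-- What the caller needs after a call is kept below register `61`, so a simulated run cannot
destroy it. -/
theorem writes_relocate {P : Program} {q : ℕ} (h : writes (relocate P) q) : 61 ≤ q ∧ q ≠ 62 ∧ q ≠ 63 := by
  induction P <;> simp only [relocate, writes] at h <;> grind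

/-- The store `s₁` contains the store `s₀` of a machine with `b` registers and `m₀ + 1` memory
cells at the address `base`. -/
structure Sim (b base m₀ : ℕ) (s₀ s₁ : Store) : Prop where
  reg : ∀ q < b, s₁.reg (q + 64) = s₀.reg q
  mem : ∀ a ≤ m₀, s₁.mem (base + a) = s₀.mem a
  base : s₁.reg 14 = base

theorem Sim.setReg {b base m₀ d v : ℕ} {s₀ s₁ : Store} (h : Sim b base m₀ s₀ s₁) :
    Sim b base m₀ (s₀.setReg d v) (s₁.setReg (d + 64) v) :=
  ⟨fun q hq => by simp [h.reg q hq], fun a ha => by simp [h.mem a ha], by simp [h.base]⟩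

theorem Sim.scratch {b base m₀ v : ℕ} {s₀ s₁ : Store} (h : Sim b base m₀ s₀ s₁) :
    Sim b base m₀ s₀ (s₁.setReg 61 v) :=
  ⟨fun q hq => by simp [h.reg q hq], fun a ha => by simp [h.mem a ha],
    by simp [h.base]⟩

theorem Sim.setMem {b base m₀ d v : ℕ} {s₀ s₁ : Store} (h : Sim b base m₀ s₀ s₁) :
    Sim b base m₀ (s₀.setMem d v) (s₁.setMem (base + d) v) :=
  ⟨fun q hq => by simp [h.reg q hq], fun a ha => by simp [h.mem a ha], by simp [h.base]⟩

/-- The relocated program simulates the original one. -/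
theorem good_relocate {b base m₀ m t' : ℕ} {ok : Store → Prop} {h : Store → ℝ}
    {K : List Program} {s : Store} {W : ℕ → Prop} (hm : base + m₀ ≤ m)
    (hK : ∀ s₀ s₁, Sim b base m₀ s₀ s₁ → s₁.Fits m → (∀ q, ¬ W q → s₁.reg q = s.reg q) →
      (∀ a, a < base ∨ base + m₀ < a → s₁.mem a = s.mem a) → Good m ok t' (K, s₁) (h s₀)) :
    ∀ (T : ℕ) (L : List Program) (s₀ s₁ : Store), Safe m₀ T (L, s₀) →
      (∀ p ∈ L, RegsBelow b p) → (∀ p ∈ L, ∀ q, writes (relocate p) q → W q) →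
      Sim b base m₀ s₀ s₁ → s₁.Fits m → (∀ q, ¬ W q → s₁.reg q = s.reg q) →
      (∀ a, a < base ∨ base + m₀ < a → s₁.mem a = s.mem a) →
      Good m ok (3 * T + t') (L.map relocate ++ K, s₁) (expect h T (L, s₀)) := by
  intro T
  induction T with
  | zero =>
    intro L s₀ s₁ hs hb hW hsim hfit hreg hmem
    obtain ⟨_, rfl : L = []⟩ := hs
    simpa [expect] using hK s₀ s₁ hsim hfit hreg hmem
  | succ T ih =>
    intro L s₀ s₁ hs hb hW hsim hfit hreg hmem
    rcases L with _ | ⟨p, L⟩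
    · have h1 : Safe m₀ T ([], s₀) := hs.2 0 (by simp [width])
      rw [expect_succ h1]
      exact (ih [] s₀ s₁ h1 hb hW hsim hfit hreg hmem).mono (by omega) le_rfl
    · have hb' : ∀ p ∈ L, RegsBelow b p := fun p hp => hb p (List.mem_cons_of_mem _ hp)
      have hW' : ∀ p ∈ L, ∀ q, writes (relocate p) q → W q :=
        fun p hp => hW p (List.mem_cons_of_mem _ hp)
      have hbp := hb p List.mem_cons_self
      have hWp := hW p List.mem_cons_self
      have hsafe := hs.2
      have hf0 := hs.1
      have regW : ∀ d v, W d → ∀ s₂ : Store, (∀ q, ¬ W q → s₂.reg q = s.reg q) →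
          ∀ q, ¬ W q → (s₂.setReg d v).reg q = s.reg q := by
        intro d v hd s₂ h2 q hq
        rw [Store.setReg_reg, if_neg (by rintro rfl; exact hq hd), h2 q hq]
      -- A memory access costs three steps: unfolding `seq`, computing the address, and the access
      -- itself. All other instructions cost one.
      rw [show 3 * (T + 1) + t' = (3 * T + t' + 2) + 1 by ring]
      cases p with
      | const d k =>
        have h1 := hsafe 0 (by simp [width])
        have hv : k ≤ m₀ := by simpa [next] using h1.fits.1 d
        simp only [next] at h1
        refine Good.step_det hfit rfl (Good.mono (ih L _ _ h1 hb' hW' hsim.setReg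
          (hfit.setReg (by omega)) (regW _ _ (hWp _ rfl) _ hreg) hmem) (by omega) ?_)
        simp [expect, width, next]
      | op o d a a' =>
        have h1 := hsafe 0 (by simp [width])
        have hv : o.eval (s₀.reg a) (s₀.reg a') ≤ m₀ := by simpa [next] using h1.fits.1 d
        simp only [next] at h1
        refine Good.step_det hfit rfl ?_
        simp only [next, List.map_cons, relocate, List.cons_append]
        rw [hsim.reg a hbp.2.1, hsim.reg a' hbp.2.2]
        refine Good.mono (ih L _ _ h1 hb' hW' hsim.setReg
          (hfit.setReg (by omega)) (regW _ _ (hWp _ rfl) _ hreg) hmem) (by omega) ?_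
        simp [expect, width, next]
      | load d a =>
        have h1 := hsafe 0 (by simp [width])
        -- Addresses are words of the simulated machine, hence at most `m₀`: the access stays inside
        -- the block of `m₀ + 1` cells, and the rest of the memory is untouched.
        have ha : s₀.reg a ≤ m₀ := hf0.1 a
        have hv : s₀.mem (s₀.reg a) ≤ m₀ := hf0.2 _
        simp only [next] at h1
        simp only [List.map_cons, relocate, List.cons_append]
        refine Good.step_det hfit rfl (Good.step_det hfit rfl ?_)
        simp only [next, BinOp.eval]
        rw [hsim.reg a hbp.2, hsim.base]
        refine Good.step_det (hfit.setReg (by omega)) rfl ?_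
        simp only [next, Store.setReg_reg, if_true, Store.setReg_mem, hsim.mem _ ha]
        refine Good.mono (ih L _ _ h1 hb' hW' hsim.scratch.setReg
          ((hfit.setReg (by omega)).setReg (by omega))
          (regW _ _ (hWp _ (Or.inr rfl)) _ (regW _ _ (hWp _ (Or.inl rfl)) _ hreg)) hmem)
          (by omega) ?_
        simp [expect, width, next]
      | store a a' =>
        have h1 := hsafe 0 (by simp [width])
        have ha : s₀.reg a ≤ m₀ := hf0.1 a
        have hv : s₀.reg a' ≤ m₀ := hf0.1 a'
        simp only [next] at h1
        simp only [List.map_cons, relocate, List.cons_append]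
        refine Good.step_det hfit rfl (Good.step_det hfit rfl ?_)
        simp only [next, BinOp.eval]
        rw [hsim.reg a hbp.1, hsim.base]
        refine Good.step_det (hfit.setReg (by omega)) rfl ?_
        simp only [next, Store.setReg_reg, if_true]
        rw [if_neg (by omega), hsim.reg a' hbp.2]
        refine Good.mono (ih L _ _ h1 hb' hW' hsim.scratch.setMem
          ((hfit.setReg (by omega)).setMem (by omega))
          (regW _ _ (hWp _ (Or.inl rfl)) _ hreg) ?_) (by omega) ?_
        · intro c hc
          rw [Store.setMem_mem, if_neg (by omega)]
          exact hmem c hc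
        · simp [expect, width, next]
      | rand d a =>
        have hw : width (.rand (d + 64) (a + 64) :: (L.map relocate ++ K), s₁) =
            width (.rand d a :: L, s₀) := by
          simp only [width, hsim.reg a hbp.2]
        refine Good.step (fun v => expect h T (next (.rand d a :: L, s₀) v)) hfit
          (fun v hv => ?_) ?_
        · have hv' : v < width (.rand d a :: L, s₀) := by rw [← hw]; exact hv
          have h1 := hsafe v hv'
          have hv2 : v ≤ m₀ := by simpa [next] using h1.fits.1 d
          simp only [next] at h1
          exact (ih L _ _ h1 hb' hW' hsim.setReg
            (hfit.setReg (by omega)) (regW _ _ (hWp _ rfl) _ hreg) hmem).mono (by omega) le_rfl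
        · have : (0 : ℝ) < width (.rand d a :: L, s₀) := by exact_mod_cast width_pos _
          simp only [List.map_cons, relocate, List.cons_append]
          rw [hw, expect, mul_div_cancel₀ _ this.ne']
      | seq p q =>
        have h1 := hsafe 0 (by simp [width])
        simp only [next] at h1
        refine Good.step_det hfit rfl (Good.mono (ih (p :: q :: L) _ _ h1 ?_ ?_ hsim
          hfit hreg hmem) (by omega) ?_)
        · simp only [List.mem_cons]
          rintro x (rfl | rfl | hx)
          exacts [hbp.1, hbp.2, hb' x hx]
        · simp only [List.mem_cons]
          rintro x (rfl | rfl | hx) y hy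
          exacts [hWp y (Or.inl hy), hWp y (Or.inr hy), hW' x hx y hy]
        · simp [expect, width, next]
      | cond d p q =>
        have h1 := hsafe 0 (by simp [width])
        simp only [next] at h1
        refine Good.step_det hfit rfl ?_
        simp only [next, List.map_cons, relocate, List.cons_append]
        rw [hsim.reg d hbp.1]
        by_cases hd : s₀.reg d = 0
        · simp only [hd, if_true] at h1 ⊢
          refine Good.mono (ih (q :: L) _ _ h1 ?_ ?_ hsim hfit hreg hmem) (by omega) ?_
          · simp only [List.mem_cons]
            rintro x (rfl | hx)
            exacts [hbp.2.2, hb' x hx]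
          · simp only [List.mem_cons]
            rintro x (rfl | hx) y hy
            exacts [hWp y (Or.inr hy), hW' x hx y hy]
          · simp [expect, width, next, hd]
        · simp only [hd, if_false] at h1 ⊢
          refine Good.mono (ih (p :: L) _ _ h1 ?_ ?_ hsim hfit hreg hmem) (by omega) ?_
          · simp only [List.mem_cons]
            rintro x (rfl | hx)
            exacts [hbp.2.1, hb' x hx]
          · simp only [List.mem_cons]
            rintro x (rfl | hx) y hy
            exacts [hWp y (Or.inl hy), hW' x hx y hy]
          · simp [expect, width, next, hd]
      | loop d p =>
        have h1 := hsafe 0 (by simp [width])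
        simp only [next] at h1
        refine Good.step_det hfit rfl ?_
        simp only [next, List.map_cons, relocate, List.cons_append]
        rw [hsim.reg d hbp.1]
        by_cases hd : s₀.reg d = 0
        · simp only [hd, if_true] at h1 ⊢
          refine Good.mono (ih L _ _ h1 hb' hW' hsim hfit hreg hmem) (by omega) ?_
          simp [expect, width, next, hd]
        · simp only [hd, if_false] at h1 ⊢
          refine Good.mono (ih (p :: .loop d p :: L) _ _ h1 ?_ ?_ hsim hfit hreg hmem)
            (by omega) ?_
          · simp only [List.mem_cons]
            rintro x (rfl | rfl | hx)
            exacts [hbp.2, hbp, hb' x hx]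
          · simp only [List.mem_cons]
            rintro x (rfl | rfl | hx) y hy
            exacts [hWp y hy, hWp y hy, hW' x hx y hy]
          · simp [expect, width, next, hd]

/-- The call may continue with credit `r₁` after a success and with `r₂` after a failure. As failure
has probability at most `δ` and `r₁ ≤ r₂`, the average is at most `r₁ + δ * (r₂ - r₁)`. -/
theorem WP.relocate {b base m₀ m T : ℕ} {P : Program} {ok₀ : Store → Prop} {s₀ s : Store}
    {r r₁ r₂ δ : ℝ} (hm : base + m₀ ≤ m) (hP : Good m₀ ok₀ T ([P], s₀) δ)
    (hb : RegsBelow b P) (hsim : Sim b base m₀ s₀ s) (h12 : r₁ ≤ r₂)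
    (hr : r₁ + δ * (r₂ - r₁) ≤ r) :
    WP m (relocate P) (3 * T) (fun s' r' => ∃ s₀', Sim b base m₀ s₀' s' ∧
      (∀ a, a < base ∨ base + m₀ < a → s'.mem a = s.mem a) ∧
      (ok₀ s₀' ∧ r' = r₁ ∨ r' = r₂)) s r := by
  intro ok K t' hfit hK
  have := good_relocate (h := fun s' => r₁ + (r₂ - r₁) * failure ok₀ s') (K := K) (s := s)
    (W := writes (RAM.relocate P)) (ok := ok) (t' := t') hm ?_ T [P] s₀ s hP.1 (by simpa using hb)
    (by simp) hsim hfit (fun _ _ => rfl) (fun _ _ => rfl)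
  · refine this.mono le_rfl ?_
    rw [expect_add, expect_const, expect_mul]
    nlinarith [hP.2]
  · intro s₀' s₁ h1 h2 h3 h4
    refine hK s₁ _ h2 h3 ⟨s₀', h1, h4, ?_⟩
    by_cases hok : ok₀ s₀' <;> simp [failure, hok]

end RAM

/-! ### Random access to the encoding of an instance. -/

theorem List.length_flatMap_finRange {n k : ℕ} (f : Fin n → List ℕ) (hf : ∀ u, (f u).length = k) :
    ((List.finRange n).flatMap f).length = n * k := by
  rw [List.length_flatMap]
  simp [hf]

theorem List.getD_flatMap_finRange {n k : ℕ} (f : Fin n → List ℕ) (hf : ∀ u, (f u).length = k)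
    (u : ℕ) (hu : u < n) (v : ℕ) (hv : v < k) :
    ((List.finRange n).flatMap f).getD (u * k + v) 0 = (f ⟨u, hu⟩).getD v 0 := by
  induction n generalizing u with
  | zero => omega
  | succ n ih =>
    rw [List.finRange_succ, List.flatMap_cons]
    rcases u with _ | u
    · rw [List.getD_append _ _ _ _ (by rw [hf]; omega)]
      simp
    · rw [List.getD_append_right _ _ _ _ (by rw [hf]; nlinarith), hf, List.flatMap_map,
        show (u + 1) * k + v - k = u * k + v by rw [add_mul, one_mul]; omega]
      exact ih (fun u => f u.succ) (fun u => hf _) u (by omega)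

theorem List.getD_map_finRange {n : ℕ} (f : Fin n → ℕ) (u : ℕ) (hu : u < n) :
    ((List.finRange n).map f).getD u 0 = f ⟨u, hu⟩ := by
  rw [List.getD_eq_getElem _ _ (by simpa using hu)]
  simp

namespace NWTInstance

variable (I : NWTInstance)

/-- The word at position `t` of the encoding. -/
noncomputable def word (t : ℕ) : ℕ := I.encode.getD t 0

/-- The length of the encoding. -/
def encLen : ℕ := 3 + I.n + I.n * I.n + I.n * I.n * (I.numWords + 1)

theorem length_encodeWeight (z : ℤ) : (I.encodeWeight z).length = I.numWords + 1 := by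
  simp [encodeWeight]

open Classical in
theorem encode_eq : I.encode = [I.n, I.wordLen, I.numWords] ++
    (((List.finRange I.n).map fun u => (I.cls u : ℕ)) ++
    (((List.finRange I.n).flatMap fun u => (List.finRange I.n).map fun v =>
      if I.graph.Adj u v then 1 else 0) ++
    ((List.finRange I.n).flatMap fun u => (List.finRange I.n).flatMap fun v =>
      I.encodeWeight (I.weight u v)))) := by
  simp only [encode, List.append_assoc]

theorem length_encode : I.encode.length = I.encLen := by
  classical
  rw [encode_eq, List.length_append, List.length_append, List.length_append,
    List.length_flatMap_finRange (k := I.n) _ (by simp),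
    List.length_flatMap_finRange (k := I.n * (I.numWords + 1)) _
      (fun u => List.length_flatMap_finRange _ (fun v => I.length_encodeWeight _))]
  simp [encLen]; ring

theorem word_zero : I.word 0 = I.n := rfl
theorem word_one : I.word 1 = I.wordLen := rfl
theorem word_two : I.word 2 = I.numWords := rfl

theorem word_cls {u : ℕ} (hu : u < I.n) : I.word (3 + u) = (I.cls ⟨u, hu⟩ : ℕ) := by
  rw [word, encode_eq, List.getD_append_right _ _ _ _ (by simp), List.getD_append]
  · simpa using List.getD_map_finRange (fun u => (I.cls u : ℕ)) u hu
  · simpa using hu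

open Classical in
theorem word_adj {u v : ℕ} (hu : u < I.n) (hv : v < I.n) :
    I.word (3 + I.n + (u * I.n + v)) = if I.graph.Adj ⟨u, hu⟩ ⟨v, hv⟩ then 1 else 0 := by
  have h : u * I.n + v < I.n * I.n := by nlinarith
  rw [word, encode_eq, List.getD_append_right _ _ _ _ (by simp; omega),
    List.getD_append_right _ _ _ _ (by simp; omega), List.getD_append]
  · rw [show 3 + I.n + (u * I.n + v) - [I.n, I.wordLen, I.numWords].length -
        ((List.finRange I.n).map fun u => (I.cls u : ℕ)).length = u * I.n + v by simp; omega,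
      List.getD_flatMap_finRange (k := I.n) _ (by simp) u hu v hv, List.getD_map_finRange _ v hv]
  · rw [List.length_flatMap_finRange (k := I.n) _ (by simp)]
    simp; omega

theorem word_weight {u v j : ℕ} (hu : u < I.n) (hv : v < I.n) (hj : j < I.numWords + 1) :
    I.word (3 + I.n + I.n * I.n + (u * I.n + v) * (I.numWords + 1) + j) =
      (I.encodeWeight (I.weight ⟨u, hu⟩ ⟨v, hv⟩)).getD j 0 := by
  classical
  have hl : ∀ u : Fin I.n, ((List.finRange I.n).flatMap fun v =>
      I.encodeWeight (I.weight u v)).length = I.n * (I.numWords + 1) :=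
    fun u => List.length_flatMap_finRange _ (fun v => I.length_encodeWeight _)
  have hl2 := List.length_flatMap_finRange (k := I.n) (fun u : Fin I.n =>
    (List.finRange I.n).map fun v => if I.graph.Adj u v then 1 else 0) (by simp)
  rw [word, encode_eq, List.getD_append_right _ _ _ _ (by simp; omega),
    List.getD_append_right _ _ _ _ (by simp; omega),
    List.getD_append_right _ _ _ _ (by rw [hl2]; simp; omega), hl2]
  rw [show 3 + I.n + I.n * I.n + (u * I.n + v) * (I.numWords + 1) + j -
      [I.n, I.wordLen, I.numWords].length -
      ((List.finRange I.n).map fun u => (I.cls u : ℕ)).length - I.n * I.n =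
      u * (I.n * (I.numWords + 1)) + (v * (I.numWords + 1) + j) by
    simp only [List.length_cons, List.length_nil, List.length_map, List.length_finRange]
    have : (u * I.n + v) * (I.numWords + 1) =
      u * (I.n * (I.numWords + 1)) + v * (I.numWords + 1) := by ring
    omega]
  rw [List.getD_flatMap_finRange _ hl u hu _ (by nlinarith),
    List.getD_flatMap_finRange _ (fun v => I.length_encodeWeight _) v hv j hj]

theorem word_sign {u v : ℕ} (hu : u < I.n) (hv : v < I.n) :
    I.word (3 + I.n + I.n * I.n + (u * I.n + v) * (I.numWords + 1)) =
      if I.weight ⟨u, hu⟩ ⟨v, hv⟩ < 0 then 1 else 0 := by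
  have := I.word_weight hu hv (j := 0) (by omega)
  simpa [encodeWeight] using this

theorem word_limb {u v j : ℕ} (hu : u < I.n) (hv : v < I.n) (hj : j < I.numWords) :
    I.word (3 + I.n + I.n * I.n + (u * I.n + v) * (I.numWords + 1) + (1 + j)) =
      (I.weight ⟨u, hu⟩ ⟨v, hv⟩).natAbs / 2 ^ (I.wordLen * j) % 2 ^ I.wordLen := by
  rw [I.word_weight hu hv (by omega), encodeWeight, add_comm 1 j, List.getD_cons_succ,
    List.getD_eq_getElem _ _ (by simpa using hj)]
  simp

theorem natAbs_weight_lt (u v : Fin I.n) :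
    (I.weight u v).natAbs < 2 ^ (I.wordLen * I.numWords) := by
  have h1 : (I.weight u v).natAbs.size ≤ I.bitLen :=
    Finset.le_sup (f := fun p : Fin I.n × Fin I.n => (I.weight p.1 p.2).natAbs.size)
      (Finset.mem_univ (u, v))
  have h2 : I.bitLen < I.wordLen * I.numWords := by
    unfold numWords
    exact Nat.lt_mul_div_succ _ (by simp [wordLen])
  calc _ < 2 ^ (I.weight u v).natAbs.size := Nat.lt_size_self _
    _ ≤ _ := Nat.pow_le_pow_right (by norm_num) (by omega)

/-- The instance in which the edges `uv` with `kill u v` or `kill v u` are removed. -/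
def restrict (kill : ℕ → ℕ → Prop) : NWTInstance where
  n := I.n
  graph :=
    { Adj := fun u v => I.graph.Adj u v ∧ ¬ kill u v ∧ ¬ kill v u
      symm := ⟨fun _ _ h => ⟨h.1.symm, h.2.2, h.2.1⟩⟩
      loopless := ⟨fun _ h => h.1.ne rfl⟩ }
  cls := ⟨I.cls, fun {_ _} h => I.cls.map_rel h.1⟩
  weight := I.weight
  weight_symm := I.weight_symm

open Classical in
-- A query arises from a copy of the input by setting single words of the adjacency matrix to 0; the
-- length, the header, the classes and the weights are those of the given instance.
theorem word_restrict (kill : ℕ → ℕ → Prop) (t : ℕ) :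
    (I.restrict kill).word t =
      if 3 + I.n ≤ t ∧ t < 3 + I.n + I.n * I.n ∧
        (kill ((t - (3 + I.n)) / I.n) ((t - (3 + I.n)) % I.n) ∨
          kill ((t - (3 + I.n)) % I.n) ((t - (3 + I.n)) / I.n)) then 0 else I.word t := by
  by_cases h : 3 + I.n ≤ t ∧ t < 3 + I.n + I.n * I.n
  · have h1 := h.1
    have h2 := h.2
    set x := t - (3 + I.n) with hx
    have ht : t = 3 + I.n + x := by omega
    have hxn : x < I.n * I.n := by omega
    have hn : 0 < I.n := by
      by_contra h0
      rw [show I.n = 0 by omega] at hxn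
      omega
    have hu : x / I.n < I.n := Nat.div_lt_of_lt_mul hxn
    have hv : x % I.n < I.n := Nat.mod_lt _ hn
    have e : x = x / I.n * I.n + x % I.n := (Nat.div_add_mod' x I.n).symm
    have w1 := I.word_adj hu hv
    have w2 := (I.restrict kill).word_adj (u := x / I.n) (v := x % I.n) hu hv
    rw [← e, ← ht] at w1
    change (I.restrict kill).word (3 + I.n + (x / I.n * I.n + x % I.n)) = _ at w2
    rw [← e, ← ht] at w2
    have w3 : (I.restrict kill).graph.Adj ⟨x / I.n, hu⟩ ⟨x % I.n, hv⟩ ↔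
        I.graph.Adj ⟨x / I.n, hu⟩ ⟨x % I.n, hv⟩ ∧ ¬ kill (x / I.n) (x % I.n) ∧
          ¬ kill (x % I.n) (x / I.n) := Iff.rfl
    rw [w1, w2, w3]
    by_cases k1 : kill (x / I.n) (x % I.n) <;> by_cases k2 : kill (x % I.n) (x / I.n) <;>
      simp [h1, h2, k1, k2]
  · rw [if_neg (by tauto)]
    classical
    rw [word, word, encode_eq, encode_eq]
    -- Outside of the adjacency matrix the two encodings agree segment by segment.
    change (List.append _ (List.append _ (List.append _ _))).getD t 0 =
      (List.append _ (List.append _ (List.append _ _))).getD t 0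
    by_cases h1 : t < 3 + I.n
    · by_cases h3 : t < 3
      · refine (List.getD_append _ _ _ _ (by simpa using h3)).trans
          (List.getD_append _ _ _ _ (by simpa using h3)).symm
      · refine (List.getD_append_right _ _ _ _ (by simpa using h3)).trans
          (Eq.trans ?_ (List.getD_append_right _ _ _ _ (by simpa using h3)).symm)
        refine (List.getD_append _ _ _ _ ?_).trans
          (Eq.trans ?_ (List.getD_append _ _ _ _ ?_).symm)
        · simp [restrict]; omega
        · rfl
        · simp; omega
    · have h3 : 3 ≤ t := by omega
      have hl := fun K : NWTInstance => List.length_flatMap_finRange (k := K.n) (fun u : Fin K.n =>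
        (List.finRange K.n).map fun v => if K.graph.Adj u v then 1 else 0) (by simp)
      refine (List.getD_append_right _ _ _ _ (by simpa using h3)).trans
        (Eq.trans ?_ (List.getD_append_right _ _ _ _ (by simpa using h3)).symm)
      refine (List.getD_append_right _ _ _ _ ?_).trans
        (Eq.trans ?_ (List.getD_append_right _ _ _ _ ?_).symm)
      · simp [restrict]; omega
      · refine (List.getD_append_right _ _ _ _ ?_).trans
          (Eq.trans ?_ (List.getD_append_right _ _ _ _ ?_).symm)
        · rw [hl]; simp [restrict]; omega
        · rw [hl, hl]; rfl
        · rw [hl]; simp; omega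
      · simp; omega

/-! #### Counting triangles by their vertex in the first class -/

/-- `a`, `b`, `c` is a triangle of negative weight, with vertices in the three classes in order. -/
def Tri (a b c : ℕ) : Prop :=
  ∃ (ha : a < I.n) (hb : b < I.n) (hc : c < I.n), I.cls ⟨a, ha⟩ = 0 ∧ I.cls ⟨b, hb⟩ = 1 ∧
    I.cls ⟨c, hc⟩ = 2 ∧ I.IsNegTriangle ⟨a, ha⟩ ⟨b, hb⟩ ⟨c, hc⟩

open Classical in
/-- The pairs `(b, c)`, encoded as `b * n + c`, that form a negative triangle with `a`. -/
noncomputable def nbr (a : ℕ) : Finset ℕ :=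
  (Finset.range (I.n * I.n)).filter fun t => I.Tri a (t / I.n) (t % I.n)

/-- The number of negative triangles with vertex `a` in the first class. -/
noncomputable def deg (a : ℕ) : ℕ := (I.nbr a).card

theorem IsNegTriangle.swap {a b c : Fin I.n} (h : I.IsNegTriangle a b c) :
    I.IsNegTriangle b a c := by
  obtain ⟨h1, h2, h3, h4⟩ := h
  refine ⟨h1.symm, h3.symm, h2.symm, ?_⟩
  rw [I.weight_symm b a, I.weight_symm a c, I.weight_symm c b]; linarith

theorem IsNegTriangle.rot {a b c : Fin I.n} (h : I.IsNegTriangle a b c) :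
    I.IsNegTriangle b c a := by
  obtain ⟨h1, h2, h3, h4⟩ := h
  exact ⟨h2, h3, h1, by linarith⟩

/-- In a proper colouring the three vertices of a triangle have different colours; `swap` and `rot`
reach all six orders. -/
theorem IsNegTriangle.exists_sorted {a b c : Fin I.n} (h : I.IsNegTriangle a b c) :
    ∃ a' b' c' : Fin I.n, ({a, b, c} : Finset (Fin I.n)) = {a', b', c'} ∧ I.cls a' = 0 ∧
      I.cls b' = 1 ∧ I.cls c' = 2 ∧ I.IsNegTriangle a' b' c' := by
  have h1 := I.cls.valid h.1
  have h2 := I.cls.valid h.2.1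
  have h3 := I.cls.valid h.2.2.1
  have key : ∀ x y z : Fin 3, x ≠ y → y ≠ z → z ≠ x →
      (x = 0 ∧ y = 1 ∧ z = 2) ∨ (x = 0 ∧ z = 1 ∧ y = 2) ∨ (y = 0 ∧ x = 1 ∧ z = 2) ∨
      (y = 0 ∧ z = 1 ∧ x = 2) ∨ (z = 0 ∧ x = 1 ∧ y = 2) ∨ (z = 0 ∧ y = 1 ∧ x = 2) := by decide
  rcases key _ _ _ h1 h2 h3 with h' | h' | h' | h' | h' | h'
  · exact ⟨a, b, c, rfl, h'.1, h'.2.1, h'.2.2, h⟩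
  · exact ⟨a, c, b, by ext; simp; tauto, h'.1, h'.2.1, h'.2.2, h.rot.rot.swap⟩
  · exact ⟨b, a, c, by ext; simp; tauto, h'.1, h'.2.1, h'.2.2, h.swap⟩
  · exact ⟨b, c, a, by ext; simp; tauto, h'.1, h'.2.1, h'.2.2, h.rot⟩
  · exact ⟨c, a, b, by ext; simp; tauto, h'.1, h'.2.1, h'.2.2, h.rot.rot⟩
  · exact ⟨c, b, a, by ext; simp; tauto, h'.1, h'.2.1, h'.2.2, h.rot.swap⟩

/-- Sorting by colour gives each triangle a unique representation by its vertex `a` in the first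
class and a pair `b * n + c` from the other two. -/
theorem numNegTriangles_eq : I.numNegTriangles = ∑ a ∈ Finset.range I.n, I.deg a := by
  classical
  set S : Set (Finset (Fin I.n)) := {s | ∃ a b c, s = {a, b, c} ∧ I.IsNegTriangle a b c} with hS
  have hfin : S.Finite := Set.toFinite S
  change S.ncard = _
  rw [Set.ncard_eq_toFinset_card S hfin]
  unfold deg
  rw [← Finset.card_sigma]
  symm
  have mem : ∀ x ∈ (Finset.range I.n).sigma I.nbr, I.Tri x.1 (x.2 / I.n) (x.2 % I.n) := by
    intro x hx
    simp only [Finset.mem_sigma, nbr, Finset.mem_filter] at hx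
    exact hx.2.2
  refine Finset.card_bij (fun x hx => {⟨x.1, (mem x hx).choose⟩,
    ⟨x.2 / I.n, (mem x hx).choose_spec.choose⟩,
    ⟨x.2 % I.n, (mem x hx).choose_spec.choose_spec.choose⟩}) ?_ ?_ ?_
  · intro x hx
    obtain ⟨ha, hb, hc, -, -, -, h⟩ := mem x hx
    simp only [Set.Finite.mem_toFinset, hS, Set.mem_ofPred_eq]
    exact ⟨_, _, _, rfl, h⟩
  · rintro ⟨a, t⟩ hx ⟨a', t'⟩ hx' heq
    obtain ⟨ha, hb, hc, c0, c1, c2, h⟩ := mem _ hx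
    obtain ⟨ha', hb', hc', c0', c1', c2', h'⟩ := mem _ hx'
    dsimp only at *
    -- Equal sets have the same vertex of each colour; the other two candidates have the wrong
    -- colour.
    have e0 : (⟨a, ha⟩ : Fin I.n) = ⟨a', ha'⟩ := by
      have : (⟨a, ha⟩ : Fin I.n) ∈ ({⟨a', ha'⟩, ⟨t' / I.n, hb'⟩, ⟨t' % I.n, hc'⟩} : Finset _) := by
        rw [← heq]; simp
      simp only [Finset.mem_insert, Finset.mem_singleton] at this
      rcases this with h | h | h
      · exact h
      · rw [h, c1'] at c0; exact absurd c0 (by decide)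
      · rw [h, c2'] at c0; exact absurd c0 (by decide)
    have e1 : (⟨t / I.n, hb⟩ : Fin I.n) = ⟨t' / I.n, hb'⟩ := by
      have : (⟨t / I.n, hb⟩ : Fin I.n) ∈ ({⟨a', ha'⟩, ⟨t' / I.n, hb'⟩, ⟨t' % I.n, hc'⟩} : Finset _) := by
        rw [← heq]; simp
      simp only [Finset.mem_insert, Finset.mem_singleton] at this
      rcases this with h | h | h
      · rw [h, c0'] at c1; exact absurd c1 (by decide)
      · exact h
      · rw [h, c2'] at c1; exact absurd c1 (by decide)
    have e2 : (⟨t % I.n, hc⟩ : Fin I.n) = ⟨t' % I.n, hc'⟩ := by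
      have : (⟨t % I.n, hc⟩ : Fin I.n) ∈ ({⟨a', ha'⟩, ⟨t' / I.n, hb'⟩, ⟨t' % I.n, hc'⟩} : Finset _) := by
        rw [← heq]; simp
      simp only [Finset.mem_insert, Finset.mem_singleton] at this
      rcases this with h | h | h
      · rw [h, c0'] at c2; exact absurd c2 (by decide)
      · rw [h, c1'] at c2; exact absurd c2 (by decide)
      · exact h
    simp only [Fin.mk.injEq] at e0 e1 e2
    have : t = t' := by rw [← Nat.div_add_mod t I.n, e1, e2, Nat.div_add_mod]
    subst e0 this; rfl
  · intro s hs
    simp only [Set.Finite.mem_toFinset, hS, Set.mem_ofPred_eq] at hs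
    obtain ⟨a₀, b₀, c₀, rfl, h₀⟩ := hs
    obtain ⟨a, b, c, hs, ca, cb, cc, h⟩ := h₀.exists_sorted
    have hn : 0 < I.n := a.pos
    have e1 : (b.1 * I.n + c.1) / I.n = b := by
      rw [mul_comm, Nat.mul_add_div hn, Nat.div_eq_of_lt c.2, add_zero]
    have e2 : (b.1 * I.n + c.1) % I.n = c := by
      rw [mul_comm, Nat.mul_add_mod, Nat.mod_eq_of_lt c.2]
    refine ⟨⟨a, b * I.n + c⟩, ?_, ?_⟩
    · simp only [Finset.mem_sigma, nbr, Finset.mem_filter, Finset.mem_range]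
      refine ⟨a.2, by nlinarith [b.2, c.2], ?_⟩
      rw [e1, e2]
      exact ⟨a.2, b.2, c.2, ca, cb, cc, h⟩
    · simp only [e1, e2, Fin.eta, hs]

theorem deg_le (a : ℕ) : I.deg a ≤ I.n * I.n := by
  classical
  exact (Finset.card_filter_le _ _).trans (by simp)

end NWTInstance

/-! ### The sign of a sum of three multiword integers -/

/-- The sign bit of an integer. -/
def signBit (z : ℤ) : ℕ := if z < 0 then 1 else 0

/-- The digit number `j` of the absolute value, in base `B`. -/
def digit (B : ℕ) (z : ℤ) (j : ℕ) : ℕ := z.natAbs / B ^ j % B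

/-- The integer with the same sign whose absolute value is reduced modulo `B ^ j`. -/
def lowPart (B : ℕ) (z : ℤ) (j : ℕ) : ℤ :=
  if z < 0 then -((z.natAbs % B ^ j : ℕ) : ℤ) else ((z.natAbs % B ^ j : ℕ) : ℤ)

theorem lowPart_zero (B : ℕ) (z : ℤ) : lowPart B z 0 = 0 := by
  simp [lowPart, Nat.mod_one]

/-- A signed digit is `d - 2 * (d * sign)`, which the machine computes without a case distinction.
-/
theorem lowPart_succ (B : ℕ) (z : ℤ) (j : ℕ) : lowPart B z (j + 1) =
    lowPart B z j + B ^ j * (digit B z j - 2 * (digit B z j * signBit z : ℕ)) := by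
  unfold lowPart digit signBit
  rw [pow_succ, Nat.mod_mul]
  split <;> push_cast <;> ring

theorem lowPart_eq_self {B : ℕ} {z : ℤ} {j : ℕ} (h : z.natAbs < B ^ j) : lowPart B z j = z := by
  unfold lowPart
  rw [Nat.mod_eq_of_lt h]
  split <;> omega

theorem abs_lowPart_lt {B : ℕ} (hB : 0 < B) (z : ℤ) (j : ℕ) :
    -(B ^ j : ℤ) < lowPart B z j ∧ lowPart B z j < B ^ j := by
  have h : ((z.natAbs % B ^ j : ℕ) : ℤ) < B ^ j := by
    exact_mod_cast Nat.mod_lt _ (pow_pos hB j)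
  have h0 : (0 : ℤ) ≤ ((z.natAbs % B ^ j : ℕ) : ℤ) := Int.natCast_nonneg _
  unfold lowPart
  generalize ((z.natAbs % B ^ j : ℕ) : ℤ) = x at *
  split <;> constructor <;> omega

/-- The carry is the floor of the partial sum divided by `B ^ j`. It lies between -3 and 2 and is
stored increased by 3, as a natural number. The summand `3 * B` makes the truncated subtractions
exact, since the negative digits sum up to at most `3 * (B - 1)`, and it contributes exactly 3 to
the quotient. After the last digit the stored carry is below 3 exactly if the sum is negative
(`sum_neg_iff`). -/
theorem carry_step {B : ℕ} (hB : 0 < B) (x y z : ℤ) (j c : ℕ)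
    (hc : (c : ℤ) = (lowPart B x j + lowPart B y j + lowPart B z j) / B ^ j + 3) :
    (((3 * B + c + (digit B x j + digit B y j + digit B z j - (digit B x j * signBit x +
      digit B y j * signBit y + digit B z j * signBit z)) - (digit B x j * signBit x +
      digit B y j * signBit y + digit B z j * signBit z) - 3) / B : ℕ) : ℤ) =
      (lowPart B x (j + 1) + lowPart B y (j + 1) + lowPart B z (j + 1)) / B ^ (j + 1) + 3 := by
  have hs : ∀ w, digit B w j * signBit w ≤ digit B w j := fun w => by
    unfold signBit; split <;> simp
  have hd : ∀ w, digit B w j < B := fun w => Nat.mod_lt _ hB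
  have h1 := hs x; have h2 := hs y; have h3 := hs z
  have k1 := hd x; have k2 := hd y; have k3 := hd z
  have hB' : (B : ℤ) ≠ 0 := by exact_mod_cast hB.ne'
  rw [lowPart_succ, lowPart_succ, lowPart_succ]
  generalize digit B x j * signBit x = p1 at *
  generalize digit B y j * signBit y = p2 at *
  generalize digit B z j * signBit z = p3 at *
  generalize digit B x j = d1 at *
  generalize digit B y j = d2 at *
  generalize digit B z j = d3 at *
  generalize hX : lowPart B x j + lowPart B y j + lowPart B z j = X at *
  have e : lowPart B x j + B ^ j * (d1 - 2 * p1) + (lowPart B y j + B ^ j * (d2 - 2 * p2)) +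
      (lowPart B z j + B ^ j * (d3 - 2 * p3)) =
      X + B ^ j * (d1 + d2 + d3 - 2 * (p1 + p2 + p3) : ℤ) := by rw [← hX]; ring
  rw [e, pow_succ, ← Int.ediv_ediv_of_nonneg (by positivity), Int.add_mul_ediv_left _ _ (by positivity)]
  have : ((3 * B + c + (d1 + d2 + d3 - (p1 + p2 + p3)) - (p1 + p2 + p3) - 3 : ℕ) : ℤ) =
      X / B ^ j + (d1 + d2 + d3 - 2 * (p1 + p2 + p3)) + B * 3 := by omega
  rw [Int.natCast_div, this, Int.add_mul_ediv_left _ _ hB']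

theorem carry_lt {B : ℕ} (hB : 0 < B) (x y z : ℤ) (j c : ℕ)
    (hc : (c : ℤ) = (lowPart B x j + lowPart B y j + lowPart B z j) / B ^ j + 3) : c < 6 := by
  have h1 := abs_lowPart_lt hB x j
  have h2 := abs_lowPart_lt hB y j
  have h3 := abs_lowPart_lt hB z j
  have : (lowPart B x j + lowPart B y j + lowPart B z j) / B ^ j < 3 :=
    Int.ediv_lt_of_lt_mul (by positivity) (by omega)
  omega

theorem sum_neg_iff {B : ℕ} (hB : 0 < B) {x y z : ℤ} {j c : ℕ}
    (hc : (c : ℤ) = (lowPart B x j + lowPart B y j + lowPart B z j) / B ^ j + 3)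
    (hx : x.natAbs < B ^ j) (hy : y.natAbs < B ^ j) (hz : z.natAbs < B ^ j) :
    c < 3 ↔ x + y + z < 0 := by
  rw [lowPart_eq_self hx, lowPart_eq_self hy, lowPart_eq_self hz] at hc
  have := Int.ediv_lt_iff_lt_mul (a := x + y + z) (b := 0) (c := (B : ℤ) ^ j) (by positivity)
  rw [zero_mul] at this
  omega

namespace RAM

/-- The constants of the algorithm that depend only on the instance are in registers `3` to `10`,
and the encoding of the instance is in the memory. -/
structure Env (I : NWTInstance) (s : Store) : Prop where
  n : s.reg 3 = I.n
  nw : s.reg 4 = I.numWords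
  B : s.reg 5 = 2 ^ I.wordLen
  nn : s.reg 6 = I.n * I.n
  adj : s.reg 7 = 3 + I.n
  wt : s.reg 8 = 3 + I.n + I.n * I.n
  len : s.reg 9 = I.encLen
  w1 : s.reg 10 = I.numWords + 1
  mem : ∀ t < I.encLen, s.mem t = I.word t

theorem Env.of_eq {I : NWTInstance} {s s' : Store} (h : Env I s)
    (hr : ∀ q, 3 ≤ q → q ≤ 10 → s'.reg q = s.reg q) (hm : ∀ t < I.encLen, s'.mem t = s.mem t) :
    Env I s' where
  n := by rw [hr _ (by omega) (by omega), h.n]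
  nw := by rw [hr _ (by omega) (by omega), h.nw]
  B := by rw [hr _ (by omega) (by omega), h.B]
  nn := by rw [hr _ (by omega) (by omega), h.nn]
  adj := by rw [hr _ (by omega) (by omega), h.adj]
  wt := by rw [hr _ (by omega) (by omega), h.wt]
  len := by rw [hr _ (by omega) (by omega), h.len]
  w1 := by rw [hr _ (by omega) (by omega), h.w1]
  mem := fun t ht => by rw [hm t ht, h.mem t ht]

/-- One digit of the sum of the weights at the addresses in registers `36`, `37`, `38`, with sign
bits in registers `41`, `42`, `43`; register `40` contains the carry, increased by `3`. -/
def limbBody : Program := block [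
  .const 44 1, .op .add 44 44 39,
  .op .add 45 36 44, .load 45 45, .op .add 46 37 44, .load 46 46, .op .add 47 38 44, .load 47 47,
  .op .mul 48 45 41, .op .mul 49 46 42, .op .mul 50 47 43,
  .op .add 48 48 49, .op .add 48 48 50,
  .op .add 45 45 46, .op .add 45 45 47, .op .sub 45 45 48,
  .const 46 3, .op .mul 46 46 5, .op .add 46 46 40, .op .add 46 46 45, .op .sub 46 46 48,
  .const 47 3, .op .sub 46 46 47, .op .div 40 46 5]

theorem wp_limbBody {m : ℕ} {s : Store} {r : ℝ} {B c d1 d2 d3 g1 g2 g3 l pa pb pc : ℕ}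
    (hm : 10 * B + 10 ≤ m) (hc : c < 6) (hB : s.reg 5 = B) (h39 : s.reg 39 = l)
    (h36 : s.reg 36 = pa) (h37 : s.reg 37 = pb) (h38 : s.reg 38 = pc) (h40 : s.reg 40 = c)
    (h41 : s.reg 41 = g1) (h42 : s.reg 42 = g2) (h43 : s.reg 43 = g3)
    (hd1 : s.mem (pa + (1 + l)) = d1) (hd2 : s.mem (pb + (1 + l)) = d2)
    (hd3 : s.mem (pc + (1 + l)) = d3)
    (hg1 : d1 * g1 ≤ d1) (hg2 : d2 * g2 ≤ d2) (hg3 : d3 * g3 ≤ d3)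
    (k1 : d1 < B) (k2 : d2 < B) (k3 : d3 < B)
    (ha : pa + (1 + l) ≤ m) (hb : pb + (1 + l) ≤ m) (hcc : pc + (1 + l) ≤ m) :
    WP m limbBody 48 (fun s' r' => s'.reg 40 = (3 * B + c + (d1 + d2 + d3 - (d1 * g1 + d2 * g2 +
      d3 * g3)) - (d1 * g1 + d2 * g2 + d3 * g3) - 3) / B ∧ s'.mem = s.mem ∧ r' = r) s r := by
  refine WP.block (by omega) (by simp) ?_ ?_
  · simp [Fine, Fine1, exec1, BinOp.eval, *]
    omega
  · simp [exec, exec1, BinOp.eval, *]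

end RAM

namespace NWTInstance

variable (I : NWTInstance)

theorem pair_lt {n u v : ℕ} (hu : u < n) (hv : v < n) : u * n + v < n * n := by nlinarith

theorem weight_addr_lt {u v l : ℕ} (hu : u < I.n) (hv : v < I.n) (hl : l ≤ I.numWords) :
    3 + I.n + I.n * I.n + (u * I.n + v) * (I.numWords + 1) + l < I.encLen := by
  have h := pair_lt hu hv
  have : (u * I.n + v + 1) * (I.numWords + 1) ≤ I.n * I.n * (I.numWords + 1) :=
    Nat.mul_le_mul_right _ h
  rw [encLen]
  nlinarith

open Classical in
theorem deg_eq_sum (a : ℕ) : I.deg a =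
    ∑ t ∈ Finset.range (I.n * I.n), if I.Tri a (t / I.n) (t % I.n) then 1 else 0 := by
  rw [deg, nbr, Finset.card_filter]

end NWTInstance

/-! ### Exact computation of a degree. -/

namespace RAM

/-- The carry of the sum of three weights, increased by `3`, in register `40`. -/
def limbLoop : Program := forLoop 39 4 limbBody

theorem writes_limbLoop {q : ℕ} (h : writes limbLoop q) : 39 ≤ q := by
  simp [limbLoop, forLoop, limbBody, block, writes] at h; omega

theorem wp_limbLoop {m : ℕ} {I : NWTInstance} {s : Store} {r : ℝ} {a b c : ℕ}
    (ha : a < I.n) (hb : b < I.n) (hc : c < I.n) (hm1 : I.encLen ≤ m)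
    (hm2 : 10 * 2 ^ I.wordLen + 10 ≤ m) (E : Env I s)
    (h36 : s.reg 36 = 3 + I.n + I.n * I.n + (a * I.n + b) * (I.numWords + 1))
    (h37 : s.reg 37 = 3 + I.n + I.n * I.n + (b * I.n + c) * (I.numWords + 1))
    (h38 : s.reg 38 = 3 + I.n + I.n * I.n + (c * I.n + a) * (I.numWords + 1))
    (h40 : s.reg 40 = 3)
    (h41 : s.reg 41 = signBit (I.weight ⟨a, ha⟩ ⟨b, hb⟩))
    (h42 : s.reg 42 = signBit (I.weight ⟨b, hb⟩ ⟨c, hc⟩))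
    (h43 : s.reg 43 = signBit (I.weight ⟨c, hc⟩ ⟨a, ha⟩)) :
    WP m limbLoop (I.numWords * 56 + 6) (fun s' r' => (s'.reg 40 < 3 ↔
      I.weight ⟨a, ha⟩ ⟨b, hb⟩ + I.weight ⟨b, hb⟩ ⟨c, hc⟩ + I.weight ⟨c, hc⟩ ⟨a, ha⟩ < 0) ∧
      s'.mem = s.mem ∧ r' = r) s r := by
  set x := I.weight ⟨a, ha⟩ ⟨b, hb⟩ with hx
  set y := I.weight ⟨b, hb⟩ ⟨c, hc⟩ with hy
  set z := I.weight ⟨c, hc⟩ ⟨a, ha⟩ with hz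
  set B := 2 ^ I.wordLen with hB
  have hB0 : 0 < B := by positivity
  have hBj : ∀ j, 2 ^ (I.wordLen * j) = B ^ j := fun j => by rw [hB, pow_mul]
  have hs : ∀ (d : ℕ) (w : ℤ), d * signBit w ≤ d := fun d w => by
    unfold signBit; split <;> simp
  refine WP.conseq (WP.forLoop (n := I.numWords) (tb := 48) (fun j s' r' =>
    ((s'.reg 40 : ℕ) : ℤ) = (lowPart B x j + lowPart B y j + lowPart B z j) / B ^ j + 3 ∧
      s'.mem = s.mem ∧ r' = r) (by omega) E.nw (by omega) (by omega) (by omega)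
      (by simp [limbBody, block, writes]) (by simp [limbBody, block, writes]) ?_ ?_) (by omega) ?_
  · intro v
    simp [h40, lowPart_zero]
  · rintro j hj s' r' hs' hfr hi ⟨h1, h2, rfl⟩
    have hfr' : ∀ q, q < 39 → s'.reg q = s.reg q :=
      fun q hq => hfr q fun h => by have := writes_limbLoop h; omega
    have hw : ∀ q, 40 < q → q < 44 → s'.reg q = s.reg q := fun q hq hq' => hfr q fun h => by
      simp [forLoop, limbBody, block, writes] at h; omega
    have E' : Env I s' := E.of_eq (fun q _ _ => hfr' q (by omega)) (by simp [h2])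
    have w1 := I.word_limb ha hb hj
    have w2 := I.word_limb hb hc hj
    have w3 := I.word_limb hc ha hj
    have l1 := I.weight_addr_lt ha hb (l := 1 + j) (by omega)
    have l2 := I.weight_addr_lt hb hc (l := 1 + j) (by omega)
    have l3 := I.weight_addr_lt hc ha (l := 1 + j) (by omega)
    rw [hBj, ← E'.mem _ l1] at w1
    rw [hBj, ← E'.mem _ l2] at w2
    rw [hBj, ← E'.mem _ l3] at w3
    refine WP.conseq (wp_limbBody (B := B) (by omega) (carry_lt hB0 x y z j _ h1) E'.B hi
      ((hfr' 36 (by omega)).trans h36) ((hfr' 37 (by omega)).trans h37)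
      ((hfr' 38 (by omega)).trans h38) rfl ((hw 41 (by omega) (by omega)).trans h41)
      ((hw 42 (by omega) (by omega)).trans h42) ((hw 43 (by omega) (by omega)).trans h43)
      w1 w2 w3 (hs _ _) (hs _ _) (hs _ _) (Nat.mod_lt _ hB0) (Nat.mod_lt _ hB0)
      (Nat.mod_lt _ hB0) (by omega) (by omega) (by omega)) le_rfl ?_
    rintro s'' r'' _ _ ⟨e1, e2, e3⟩ v
    refine ⟨?_, by simp [e2, h2], e3⟩
    simp only [Store.setReg_reg, Nat.reduceEqDiff, if_false, e1]
    exact carry_step hB0 x y z j _ h1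
  · rintro s' r' _ _ ⟨h1, h2, h3⟩
    refine ⟨?_, h2, h3⟩
    have hlt : ∀ u v : Fin I.n, (I.weight u v).natAbs < B ^ I.numWords := fun u v => by
      rw [← hBj]; exact I.natAbs_weight_lt u v
    exact sum_neg_iff hB0 h1 (hlt _ _) (hlt _ _) (hlt _ _)

/-- The addresses of the weights of a potential triangle, and a bit that says whether it is a
triangle with vertices in the three classes in order. The first vertex is in register `31`, the
other two are encoded in register `33`. -/
def triHead : Program := block [
  .op .div 34 33 3, .op .mod 35 33 3, .op .mul 36 31 3, .op .add 36 36 34,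
  .op .mul 38 35 3, .op .add 38 38 31,
  .op .add 44 7 36, .load 44 44, .op .add 45 7 33, .load 45 45, .op .add 46 7 38, .load 46 46,
  .op .mul 51 44 45, .op .mul 51 51 46,
  .const 45 3, .op .add 46 45 31, .load 46 46, .const 47 0, .op .eq 46 46 47, .op .mul 51 51 46,
  .op .add 46 45 34, .load 46 46, .const 47 1, .op .eq 46 46 47, .op .mul 51 51 46,
  .op .add 46 45 35, .load 46 46, .const 47 2, .op .eq 46 46 47, .op .mul 51 51 46]

def triAddr : Program := block [
  .op .mul 36 36 10, .op .add 36 36 8, .op .mul 37 33 10, .op .add 37 37 8,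
  .op .mul 38 38 10, .op .add 38 38 8, .load 41 36, .load 42 37, .load 43 38, .const 40 3]

def triTail : Program := block [
  .const 44 3, .op .lt 44 40 44, .op .mul 44 44 51, .op .add 32 32 44]

def triBody : Program := .seq triHead (.seq triAddr (.seq limbLoop triTail))

/-- Register `32` becomes the number of negative triangles with the vertex in register `31` in the
first class. -/
def degProg : Program := .seq (.const 32 0) (forLoop 33 6 triBody)

theorem ite_mul_ite (p q : Prop) [Decidable p] [Decidable q] :
    (if p then 1 else 0) * (if q then 1 else 0) = if p ∧ q then 1 else (0 : ℕ) := by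
  by_cases p <;> by_cases q <;> simp [*]

open Classical in
-- Adjacency entries and colour tests are bits, and their product is the bit for a sorted triangle.
-- Hence the code is branch-free and its correctness is an evaluation.
theorem wp_triHead {m : ℕ} {I : NWTInstance} {s : Store} {r : ℝ} {a b c : ℕ}
    (ha : a < I.n) (hb : b < I.n) (hc : c < I.n) (hm1 : I.encLen ≤ m) (hm : 10 ≤ m) (E : Env I s)
    (h31 : s.reg 31 = a) (h33 : s.reg 33 = b * I.n + c) :
    WP m triHead 60 (fun s' r' => s'.reg 36 = a * I.n + b ∧ s'.reg 38 = c * I.n + a ∧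
      s'.reg 51 = (if I.cls ⟨a, ha⟩ = 0 ∧ I.cls ⟨b, hb⟩ = 1 ∧ I.cls ⟨c, hc⟩ = 2 ∧
        I.graph.Adj ⟨a, ha⟩ ⟨b, hb⟩ ∧ I.graph.Adj ⟨b, hb⟩ ⟨c, hc⟩ ∧ I.graph.Adj ⟨c, hc⟩ ⟨a, ha⟩
        then 1 else 0) ∧ s'.mem = s.mem ∧ r' = r) s r := by
  have hn : 0 < I.n := by omega
  have e1 : (b * I.n + c) / I.n = b := by
    rw [mul_comm, Nat.mul_add_div hn, Nat.div_eq_of_lt hc, add_zero]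
  have e2 : (b * I.n + c) % I.n = c := by
    rw [mul_comm, Nat.mul_add_mod, Nat.mod_eq_of_lt hc]
  have p1 := NWTInstance.pair_lt ha hb
  have p2 := NWTInstance.pair_lt hb hc
  have p3 := NWTInstance.pair_lt hc ha
  have hlen : 3 + I.n + I.n * I.n ≤ I.encLen := by rw [NWTInstance.encLen]; omega
  have m1 := E.mem _ (show 3 + I.n + (a * I.n + b) < _ by omega)
  have m2 := E.mem _ (show 3 + I.n + (b * I.n + c) < _ by omega)
  have m3 := E.mem _ (show 3 + I.n + (c * I.n + a) < _ by omega)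
  have m4 := E.mem _ (show 3 + a < _ by omega)
  have m5 := E.mem _ (show 3 + b < _ by omega)
  have m6 := E.mem _ (show 3 + c < _ by omega)
  rw [I.word_adj ha hb] at m1
  rw [I.word_adj hb hc] at m2
  rw [I.word_adj hc ha] at m3
  rw [I.word_cls ha] at m4
  rw [I.word_cls hb] at m5
  rw [I.word_cls hc] at m6
  refine WP.block (by omega) (by simp) ?_ ?_
  · simp only [Fine, Fine1, exec1, BinOp.eval, Store.setReg_reg, Store.setReg_mem, Nat.reduceEqDiff,
      if_false, if_true, h31, h33, E.n, E.adj, e1, e2, m1, m2, m3, m4, m5, m6,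
      ite_mul_ite, true_and, and_true]
    refine ⟨?_, ?_, ?_, ?_, ?_, ?_, ?_, ?_, ?_, ?_, ?_, ?_, ?_, ?_, ?_, ?_, ?_, ?_, ?_⟩ <;>
      first
      | omega
      | (split <;> omega)
  · simp only [exec, exec1, BinOp.eval, Store.setReg_reg, Store.setReg_mem, Nat.reduceEqDiff,
      if_false, if_true, h31, h33, E.n, E.adj, e1, e2, m1, m2, m3, m4, m5, m6,
      ite_mul_ite, true_and, and_true]
    have q0 : ((I.cls ⟨a, ha⟩ : ℕ) = 0) ↔ I.cls ⟨a, ha⟩ = 0 := by rw [Fin.ext_iff]; rfl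
    have q1 : ((I.cls ⟨b, hb⟩ : ℕ) = 1) ↔ I.cls ⟨b, hb⟩ = 1 := by rw [Fin.ext_iff]; rfl
    have q2 : ((I.cls ⟨c, hc⟩ : ℕ) = 2) ↔ I.cls ⟨c, hc⟩ = 2 := by rw [Fin.ext_iff]; rfl
    simp only [q0, q1, q2]
    exact if_congr (by tauto) rfl rfl

theorem writes_triBody {q : ℕ} (h : writes triBody q) : 32 ≤ q ∧ q ≠ 33 := by
  simp [triBody, triHead, triAddr, triTail, limbLoop, forLoop, limbBody, block, writes] at h; omega

theorem writes_degProg {q : ℕ} (h : writes degProg q) : 32 ≤ q := by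
  simp only [degProg, forLoop, block, writes] at h
  have := fun h => (writes_triBody (q := q) h).1
  rcases h with h | (h | h) | h | h | h | h <;> first | omega | exact this h

open Classical in
theorem wp_triBody {m : ℕ} {I : NWTInstance} {s : Store} {r : ℝ} {a t : ℕ}
    (ha : a < I.n) (ht : t < I.n * I.n) (hm1 : I.encLen ≤ m)
    (hm2 : 10 * 2 ^ I.wordLen + 10 ≤ m) (E : Env I s)
    (h31 : s.reg 31 = a) (h33 : s.reg 33 = t) (h32 : s.reg 32 + 1 ≤ m) :
    WP m triBody (I.numWords * 56 + 97) (fun s' r' => s'.reg 32 = s.reg 32 +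
      (if I.Tri a (t / I.n) (t % I.n) then 1 else 0) ∧ s'.mem = s.mem ∧ r' = r) s r := by
  have hn : 0 < I.n := by omega
  have hb : t / I.n < I.n := Nat.div_lt_of_lt_mul ht
  have hc : t % I.n < I.n := Nat.mod_lt _ hn
  set b := t / I.n with hb'
  set c := t % I.n with hc'
  have ht' : t = b * I.n + c := (Nat.div_add_mod' t I.n).symm
  have l1 := I.weight_addr_lt ha hb (l := 0) (by omega)
  have l2 := I.weight_addr_lt hb hc (l := 0) (by omega)
  have l3 := I.weight_addr_lt hc ha (l := 0) (by omega)
  refine WP.seq_le (t' := 22 + (I.numWords * 56 + 14)) (WP.conseq (wp_triHead ha hb hc hm1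
    (by omega) E h31 (h33.trans ht')) le_rfl ?_) (by omega)
  rintro s₁ r₁ _ f1 ⟨e36, e38, e51, em1, rfl⟩
  have g1 : ∀ q, q < 34 → s₁.reg q = s.reg q := fun q hq => f1 q fun h => by
    simp [triHead, block, writes] at h; omega
  have E1 : Env I s₁ := E.of_eq (fun q _ _ => g1 q (by omega)) (by simp [em1])
  have m1 := E1.mem _ l1
  have m2 := E1.mem _ l2
  have m3 := E1.mem _ l3
  simp only [add_zero] at l1 l2 l3 m1 m2 m3
  rw [I.word_sign ha hb] at m1
  rw [I.word_sign hb hc] at m2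
  rw [I.word_sign hc ha] at m3
  have e33 : s₁.reg 33 = b * I.n + c := by rw [g1 33 (by omega), h33, ht']
  refine WP.block_seq (t' := I.numWords * 56 + 15) (by omega) (by simp) ?_ ?_
    (by simp only [List.length_cons, List.length_nil]; omega)
  · simp only [Fine, Fine1, exec1, BinOp.eval, Store.setReg_reg, Nat.reduceEqDiff,
      if_false, if_true, e36, e38, e33, E1.w1, E1.wt, true_and, and_true]
    refine ⟨?_, ?_, ?_, ?_, ?_, ?_, ?_⟩ <;> omega
  refine WP.seq_le (t' := 8) (WP.conseq (wp_limbLoop ha hb hc hm1 hm2 (s := exec _ s₁) ?_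
    ?_ ?_ ?_ ?_ ?_ ?_ ?_) le_rfl ?_) (by omega)
  · refine E1.of_eq (fun q hq hq' => ?_) (fun t _ => ?_)
    · simp only [exec, exec1, Store.setReg_reg]
      repeat rw [if_neg (by omega)]
    · simp only [exec, exec1, Store.setReg_mem]
  · simp only [exec, exec1, BinOp.eval, Store.setReg_reg, Store.setReg_mem, Nat.reduceEqDiff,
      if_false, if_true, e36, E1.w1, E1.wt, add_comm]
  · simp only [exec, exec1, BinOp.eval, Store.setReg_reg, Store.setReg_mem, Nat.reduceEqDiff,
      if_false, if_true, e33, E1.w1, E1.wt, add_comm]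
  · simp only [exec, exec1, BinOp.eval, Store.setReg_reg, Store.setReg_mem, Nat.reduceEqDiff,
      if_false, if_true, e38, E1.w1, E1.wt, add_comm]
  · simp only [exec, exec1, BinOp.eval, Store.setReg_reg, if_true]
  · simp only [exec, exec1, BinOp.eval, Store.setReg_reg, Store.setReg_mem, Nat.reduceEqDiff,
      if_false, if_true, e36, E1.w1, E1.wt, signBit, ← m1]
    congr 1; ring
  · simp only [exec, exec1, BinOp.eval, Store.setReg_reg, Store.setReg_mem, Nat.reduceEqDiff,
      if_false, if_true, e33, E1.w1, E1.wt, signBit, ← m2]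
    congr 1; ring
  · simp only [exec, exec1, BinOp.eval, Store.setReg_reg, Store.setReg_mem, Nat.reduceEqDiff,
      if_false, if_true, e38, E1.w1, E1.wt, signBit, ← m3]
    congr 1; ring
  rintro s₂ r₂ _ f2 ⟨e40, em2, rfl⟩
  have g2 : ∀ q, q < 34 ∨ q = 51 → s₂.reg q = s₁.reg q := fun q hq => by
    rw [f2 q fun h => by
      simp [limbLoop, forLoop, limbBody, block, writes] at h; omega]
    simp only [exec, exec1, Store.setReg_reg]
    repeat rw [if_neg (by omega)]
  have e32 : s₂.reg 32 = s.reg 32 := by rw [g2 32 (by omega), g1 32 (by omega)]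
  have e51' := (g2 51 (by omega)).trans e51
  have hmem : s₂.mem = s.mem := by
    rw [em2, ← em1]; simp only [exec, exec1, Store.setReg_mem]
  refine WP.block (by omega) (by simp) ?_ ?_
  · simp only [Fine, Fine1, exec1, BinOp.eval, Store.setReg_reg, Nat.reduceEqDiff,
      if_false, if_true, e51', e32, ite_mul_ite, true_and, and_true]
    refine ⟨?_, ?_, ?_⟩
    · omega
    · split <;> omega
    · split <;> omega
  · simp only [exec, exec1, BinOp.eval, Store.setReg_reg, Store.setReg_mem, Nat.reduceEqDiff,
      if_false, if_true, e51', e32, ite_mul_ite, hmem, and_true]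
    congr 1
    refine if_congr ?_ rfl rfl
    rw [e40]
    constructor
    · rintro ⟨h1, h2, h3, h4, h5, h6, h7⟩
      exact ⟨ha, hb, hc, h2, h3, h4, h5, h6, h7, h1⟩
    · rintro ⟨_, _, _, h2, h3, h4, h5, h6, h7, h1⟩
      exact ⟨h1, h2, h3, h4, h5, h6, h7⟩

/-- The running time of `degProg`. -/
def degTime (I : NWTInstance) : ℕ := I.n * I.n * (I.numWords * 56 + 105) + 8

/-- The running sum over the pairs below `t` is at most `t`, so it fits into a word. Nothing is
random here and the credit is passed through; the cost is quadratic in `n` times the number of words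
of a weight. -/
theorem wp_degProg {m : ℕ} {I : NWTInstance} {s : Store} {r : ℝ} {a : ℕ}
    (ha : a < I.n) (hm1 : I.encLen ≤ m) (hm2 : 10 * 2 ^ I.wordLen + 10 ≤ m) (E : Env I s)
    (h31 : s.reg 31 = a) :
    WP m degProg (degTime I) (fun s' r' => s'.reg 32 = I.deg a ∧ s'.mem = s.mem ∧ r' = r) s r := by
  classical
  have hlen : I.n * I.n + 3 ≤ I.encLen := by rw [NWTInstance.encLen]; omega
  refine WP.mono_time (WP.seq (WP.const (by omega) ?_)) (t' := degTime I)
    (t := 1 + 1 + (I.n * I.n * (I.numWords * 56 + 97 + 8) + 6)) (by rw [degTime]; apply le_of_eq; ring)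
  refine WP.conseq (WP.forLoop (n := I.n * I.n) (tb := I.numWords * 56 + 97) (fun t s' r' =>
    s'.reg 32 = (∑ t ∈ Finset.range t, if I.Tri a (t / I.n) (t % I.n) then 1 else 0) ∧
      s'.mem = s.mem ∧ r' = r) (by omega) (by simp [E.nn]) (by omega) (by omega) (by omega)
      (fun h => by have := writes_triBody h; omega) (fun h => by have := writes_triBody h; omega)
      (by simp) ?_) le_rfl ?_
  · rintro t ht s' r' _ hfr hi ⟨h1, h2, rfl⟩
    have hfr' : ∀ q, q < 32 → s'.reg q = s.reg q := fun q hq => by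
      rw [hfr q fun h => by have := writes_degProg (Or.inr h); omega, Store.setReg_reg,
        if_neg (by omega)]
    have E' : Env I s' := E.of_eq (fun q _ _ => hfr' q (by omega)) (by simp [h2])
    have hle : s'.reg 32 ≤ t := by
      rw [h1]
      refine (Finset.sum_le_card_nsmul _ _ 1 fun x _ => ?_).trans (by simp)
      split <;> omega
    refine WP.conseq (wp_triBody ha ht hm1 hm2 E' ((hfr' 31 (by omega)).trans h31) hi
      (by omega)) le_rfl ?_
    rintro s'' r'' _ _ ⟨e1, e2, e3⟩ v
    refine ⟨?_, by simp [e2, h2], e3⟩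
    rw [Finset.sum_range_succ, ← h1]
    simpa using e1
  · rintro s' r' _ _ ⟨h1, h2, h3⟩
    exact ⟨by rw [h1, I.deg_eq_sum], h2, h3⟩

end RAM

/-! ### Queries: restricting the range of vertices and the set of pairs. -/

namespace NWTInstance

variable (I : NWTInstance)

/-- The edges that are removed for a query: those at vertices of the first class that are dead
(`D ≠ 0`) or outside of `[lo, hi)`, and those between the other classes with `R ≠ 0`. -/
def Killed (D R : ℕ → ℕ) (lo hi x y : ℕ) : Prop :=
  (I.word (3 + x) = 0 ∧ ¬ (D x = 0 ∧ lo ≤ x ∧ x < hi)) ∨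
    (I.word (3 + x) = 1 ∧ I.word (3 + y) = 2 ∧ R (x * I.n + y) ≠ 0)

/-- In a sorted triangle `a b c` the edges at `a` survive if `a` is alive and in the range, and the
edge `bc` survives if the pair is chosen. So one bit from the decision program tells whether some
vertex in the range is hit. -/
theorem hasNegTriangle_restrict (D R : ℕ → ℕ) (lo hi : ℕ) :
    (I.restrict (I.Killed D R lo hi)).HasNegTriangle ↔
      ∃ a, lo ≤ a ∧ a < hi ∧ D a = 0 ∧ ∃ t ∈ I.nbr a, R t = 0 := by
  constructor
  · rintro ⟨a₀, b₀, c₀, h₀⟩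
    obtain ⟨a, b, c, -, ca, cb, cc, h1, h2, h3, h4⟩ := h₀.exists_sorted
    have k1 : ¬ I.Killed D R lo hi a b := h1.2.1
    have k2 : ¬ I.Killed D R lo hi b c := h2.2.1
    have wa : I.word (3 + a) = 0 := (I.word_cls a.2).trans (congrArg Fin.val ca)
    have wb : I.word (3 + b) = 1 := (I.word_cls b.2).trans (congrArg Fin.val cb)
    have wc : I.word (3 + c) = 2 := (I.word_cls c.2).trans (congrArg Fin.val cc)
    simp only [Killed, wa, wb, wc] at k1 k2
    have hn : 0 < I.n := a.pos
    have e1 : (b.1 * I.n + c.1) / I.n = b := by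
      rw [mul_comm, Nat.mul_add_div hn]; erw [Nat.div_eq_of_lt c.2]; rw [add_zero]
    have e2 : (b.1 * I.n + c.1) % I.n = c := by
      rw [mul_comm, Nat.mul_add_mod]; exact Nat.mod_eq_of_lt c.2
    refine ⟨a, by tauto, by tauto, by tauto, b * I.n + c, ?_, by tauto⟩
    simp only [nbr, Finset.mem_filter, Finset.mem_range, e1, e2]
    exact ⟨pair_lt b.2 c.2, a.2, b.2, c.2, ca, cb, cc, h1.1, h2.1, h3.1, h4⟩
  · rintro ⟨a, h1, h2, h3, t, ht, h4⟩
    simp only [nbr, Finset.mem_filter, Finset.mem_range] at ht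
    obtain ⟨-, ha, hb, hc, ca, cb, cc, a1, a2, a3, hw⟩ := ht
    have wa : I.word (3 + a) = 0 := (I.word_cls ha).trans (congrArg Fin.val ca)
    have wb : I.word (3 + t / I.n) = 1 := (I.word_cls hb).trans (congrArg Fin.val cb)
    have wc : I.word (3 + t % I.n) = 2 := (I.word_cls hc).trans (congrArg Fin.val cc)
    have ht' : t / I.n * I.n + t % I.n = t := Nat.div_add_mod' t I.n
    refine ⟨⟨a, ha⟩, ⟨t / I.n, hb⟩, ⟨t % I.n, hc⟩, ⟨a1, ?_, ?_⟩, ⟨a2, ?_, ?_⟩, ⟨a3, ?_, ?_⟩, hw⟩ <;>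
      simp [Killed, wa, wb, wc, h1, h2, h3, ht', h4]

end NWTInstance

namespace RAM

/-- Copies the encoding of the instance to the address in register `14`. -/
def copyProg : Program := forLoop 33 9 (block [.load 34 33, .op .add 35 14 33, .store 35 34])

theorem writes_copyProg {q : ℕ} (h : writes copyProg q) : 33 ≤ q := by
  simp [copyProg, forLoop, block, writes] at h; omega

theorem wp_copyProg {m base : ℕ} {I : NWTInstance} {s : Store} {r : ℝ} (hm0 : 1 ≤ m)
    (hm : base + I.encLen ≤ m) (hb : I.encLen ≤ base) (E : Env I s) (h14 : s.reg 14 = base) :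
    WP m copyProg (I.encLen * 14 + 6) (fun s' r' => r' = r ∧
      ∀ a, s'.mem a = if base ≤ a ∧ a < base + I.encLen then I.word (a - base) else s.mem a) s r := by
  refine WP.conseq (WP.forLoop (n := I.encLen) (tb := 6) (fun t s' r' => r' = r ∧
      ∀ a, s'.mem a = if base ≤ a ∧ a < base + t then I.word (a - base) else s.mem a) hm0 E.len
      (by omega) (by omega) (by omega) (by simp [block, writes]) (by simp [block, writes])
      ?_ ?_) le_rfl fun s' r' _ _ h => h
  · intro v
    refine ⟨rfl, fun a => ?_⟩
    rw [if_neg (by omega)]; rfl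
  · rintro t ht s' r' _ hfr hi ⟨rfl, h⟩
    have e14 : s'.reg 14 = base := by
      rw [hfr 14 fun h => by have := writes_copyProg h; omega, h14]
    have hl : s'.mem t = I.word t := by rw [h, if_neg (by omega), E.mem t ht]
    refine WP.block_le hm0 (by simp) ?_ ?_ (by simp)
    · simp [Fine, Fine1, exec1, hi, e14]; omega
    · intro v
      refine ⟨rfl, fun a => ?_⟩
      simp [exec, exec1, BinOp.eval, hi, e14, hl, h]
      by_cases ha : a = base + t
      · subst ha; simp
      · rw [if_neg ha]
        exact if_congr (by omega) rfl rfl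

/-- The layout of the memory: the input, the array of the dead vertices, the array of random
numbers, and free space from the address in register `14` on. -/
structure Layout (I : NWTInstance) (stride dA rA : ℕ) (s : Store) : Prop extends Env I s where
  strideReg : s.reg 11 = stride
  deadReg : s.reg 12 = dA
  randReg : s.reg 13 = rA
  hdA : I.encLen ≤ dA
  hrA : dA + I.n ≤ rA
  hbase : rA + I.n * I.n ≤ s.reg 14

theorem Layout.of_eq {I : NWTInstance} {stride dA rA : ℕ} {s s' : Store}
    (h : Layout I stride dA rA s) (hr : ∀ q, 3 ≤ q → q ≤ 13 → s'.reg q = s.reg q)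
    (hm : ∀ t < I.encLen, s'.mem t = s.mem t) (hb : s.reg 14 ≤ s'.reg 14) :
    Layout I stride dA rA s' where
  toEnv := h.toEnv.of_eq (fun q h1 h2 => hr q h1 (by omega)) hm
  strideReg := by rw [hr _ (by omega) (by omega), h.strideReg]
  deadReg := by rw [hr _ (by omega) (by omega), h.deadReg]
  randReg := by rw [hr _ (by omega) (by omega), h.randReg]
  hdA := h.hdA
  hrA := h.hrA
  hbase := h.hbase.trans hb

/-- Multiplies the entries of the adjacency matrix in both directions by `0` if the edge is to be
removed. The range of vertices is in registers `27` and `29`. -/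
def killBody : Program := block [
  .op .div 34 33 3, .op .mod 35 33 3,
  .const 36 3, .op .add 37 36 34, .load 37 37, .op .add 38 36 35, .load 38 38,
  .const 39 0, .const 40 1, .const 41 2,
  .op .add 42 12 34, .load 42 42, .op .add 43 13 33, .load 43 43,
  .op .eq 44 42 39, .op .lt 45 34 27, .op .eq 45 45 39, .op .lt 46 34 29,
  .op .mul 44 44 45, .op .mul 44 44 46, .op .eq 44 44 39, .op .eq 45 37 39, .op .mul 44 44 45,
  .op .eq 45 37 40, .op .eq 46 38 41, .op .eq 47 43 39, .op .eq 47 47 39,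
  .op .mul 45 45 46, .op .mul 45 45 47, .op .add 44 44 45, .op .eq 44 44 39]

def killStore : Program := block [
  .op .add 46 14 7, .op .add 46 46 33, .load 47 46, .op .mul 47 47 44, .store 46 47,
  .op .mul 48 35 3, .op .add 48 48 34, .op .add 48 48 7, .op .add 48 48 14,
  .load 49 48, .op .mul 49 49 44, .store 48 49]

def killProg : Program := forLoop 33 6 (.seq killBody killStore)

theorem writes_killProg {q : ℕ} (h : writes killProg q) : 33 ≤ q := by
  simp [killProg, killBody, killStore, forLoop, block, writes] at h; omega

theorem ite_eq_zero_ite (p : Prop) [Decidable p] :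
    (if (if p then 1 else 0) = 0 then 1 else 0) = if ¬ p then 1 else (0 : ℕ) := by
  by_cases p <;> simp [*]

open Classical in
-- The condition `Killed` is evaluated with sums and products of bits; the proof is a truth table
-- over the atomic conditions.
theorem wp_killBody {m : ℕ} {I : NWTInstance} {stride dA rA t lo hi : ℕ} {s : Store} {r : ℝ}
    (ht : t < I.n * I.n) (hm0 : 10 ≤ m) (hm : s.reg 14 ≤ m) (L : Layout I stride dA rA s)
    (h33 : s.reg 33 = t) (h27 : s.reg 27 = lo) (h29 : s.reg 29 = hi) :
    WP m killBody 62 (fun s' r' => r' = r ∧ s'.mem = s.mem ∧ s'.reg 34 = t / I.n ∧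
      s'.reg 35 = t % I.n ∧ s'.reg 44 = if I.Killed (fun x => s.mem (dA + x))
        (fun x => s.mem (rA + x)) lo hi (t / I.n) (t % I.n) then 0 else 1) s r := by
  have hn : 0 < I.n := by
    by_contra h0
    rw [show I.n = 0 by omega] at ht
    omega
  have hb : t / I.n < I.n := Nat.div_lt_of_lt_mul ht
  have hc : t % I.n < I.n := Nat.mod_lt _ hn
  have ht' : t / I.n * I.n + t % I.n = t := Nat.div_add_mod' t I.n
  have hlen : 3 + I.n + I.n * I.n ≤ I.encLen := by rw [NWTInstance.encLen]; omega
  have hbase := L.hbase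
  have hrA := L.hrA
  have hdA := L.hdA
  have m1 := L.mem _ (show 3 + t / I.n < _ by omega)
  have m2 := L.mem _ (show 3 + t % I.n < _ by omega)
  refine WP.block_le (by omega) (by simp) ?_ ?_ (by simp)
  · simp only [Fine, Fine1, exec1, BinOp.eval, Store.setReg_reg, Store.setReg_mem, Nat.reduceEqDiff,
      if_false, if_true, h33, h27, h29, L.n, L.deadReg, L.randReg, m1, m2, ite_mul_ite,
      ite_eq_zero_ite, true_and, and_true]
    refine ⟨?_, ?_, ?_, ?_, ?_, ?_, ?_, ?_, ?_, ?_, ?_, ?_, ?_, ?_⟩ <;>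
      first
      | omega
      | (split <;> omega)
      | (split <;> split <;> omega)
  · simp only [exec, exec1, BinOp.eval, Store.setReg_reg, Store.setReg_mem, Nat.reduceEqDiff,
      if_false, if_true, h33, h27, h29, L.n, L.deadReg, L.randReg, m1, m2, ite_mul_ite,
      ite_eq_zero_ite, true_and, NWTInstance.Killed, ht']
    by_cases p1 : I.word (3 + t / I.n) = 0 <;> by_cases p2 : s.mem (dA + t / I.n) = 0 <;>
      by_cases p3 : t / I.n < lo <;> by_cases p4 : t / I.n < hi <;>
      by_cases p5 : s.mem (rA + t) = 0 <;>
      simp [p1, p2, p3, p4, p5, Nat.not_le.2, Nat.not_lt.1] <;>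
      by_cases p6 : I.word (3 + t / I.n) = 1 <;> by_cases p7 : I.word (3 + t % I.n) = 2 <;>
      simp [p6, p7]

theorem wp_killStore {m x y b w1 w2 : ℕ} {I : NWTInstance} {s : Store} {r : ℝ} (hm0 : 1 ≤ m)
    (E : Env I s) (hx : x < I.n) (hy : y < I.n) (h14 : s.reg 14 = b) (hb : b + I.encLen ≤ m)
    (h33 : s.reg 33 = x * I.n + y) (h34 : s.reg 34 = x)
    (h35 : s.reg 35 = y) (h44 : s.reg 44 ≤ 1)
    (hw1 : w1 = b + (3 + I.n) + (x * I.n + y)) (hw2 : w2 = b + (3 + I.n) + (y * I.n + x)) :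
    WP m killStore 24 (fun s' r' => r' = r ∧
      ∀ a, s'.mem a = if (a = w1 ∨ a = w2) ∧ s.reg 44 = 0 then 0 else s.mem a) s r := by
  have hlen : 3 + I.n + I.n * I.n ≤ I.encLen := by rw [NWTInstance.encLen]; omega
  have p1 := NWTInstance.pair_lt hx hy
  have p2 := NWTInstance.pair_lt hy hx
  have e2 : y * I.n + x + (3 + I.n) + b = w2 := by omega
  refine WP.of_fits fun hs => WP.block_le hm0 (by simp) ?_ ?_ (by simp)
  · have hle : ∀ u v, u ≤ m → v ≤ 1 → u * v ≤ m := fun u v h1 h2 => by nlinarith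
    simp only [Fine, Fine1, exec1, BinOp.eval, Store.setReg_reg, Store.setReg_mem, Nat.reduceEqDiff,
      Store.setMem_reg, if_false, if_true, h14, h33, h34, h35, E.n, E.adj, ← hw1, e2, true_and,
      and_true]
    refine ⟨by omega, by omega, hle _ _ (hs.2 _) h44, by omega, by omega, by omega, by omega,
      hle _ _ ?_ h44⟩
    simp only [Store.setMem_mem, Store.setReg_mem]
    -- For `x = y` both addresses coincide, and the second product is formed from the result of the
    -- first.
    split
    · exact hle _ _ (hs.2 _) h44
    · exact hs.2 _
  · refine ⟨rfl, fun a => ?_⟩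
    simp only [exec, exec1, BinOp.eval, Store.setReg_reg, Store.setReg_mem, Nat.reduceEqDiff,
      Store.setMem_reg, Store.setMem_mem, if_false, if_true, h14, h33, h34, h35, E.n, E.adj, ← hw1,
      e2]
    have : s.reg 44 = 0 ∨ s.reg 44 = 1 := by omega
    by_cases a1 : a = w1 <;> by_cases a2 : a = w2 <;> rcases this with h | h <;>
      simp_all

theorem wp_killProg {m : ℕ} {I : NWTInstance} {stride dA rA lo hi base : ℕ} {s : Store} {r : ℝ}
    {kill : ℕ → ℕ → Prop} (hkill : kill = I.Killed (fun x => s.mem (dA + x))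
      (fun x => s.mem (rA + x)) lo hi)
    (hm0 : 10 ≤ m) (hm : base + I.encLen ≤ m) (L : Layout I stride dA rA s)
    (h14 : s.reg 14 = base) (h27 : s.reg 27 = lo) (h29 : s.reg 29 = hi)
    (hmem : ∀ i < I.encLen, s.mem (base + i) = I.word i) :
    WP m killProg (I.n * I.n * 95 + 6) (fun s' r' => r' = r ∧
      ∀ a, s'.mem a = if base ≤ a ∧ a < base + I.encLen then (I.restrict kill).word (a - base)
        else s.mem a) s r := by
  classical
  have hbase := L.hbase
  have hrA := L.hrA
  have hdA := L.hdA
  have hlen : 3 + I.n + I.n * I.n ≤ I.encLen := by rw [NWTInstance.encLen]; omega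
  -- The pass number `t` writes to the entry `t` and to its transpose. Thus the entry `w` has been
  -- erased after `t` passes if `w`, or the index of its transpose, is below `t` and belongs to a
  -- killed pair.
  let C : ℕ → ℕ → Prop := fun t w => (w < t ∧ kill (w / I.n) (w % I.n)) ∨
    (w % I.n * I.n + w / I.n < t ∧ kill (w % I.n) (w / I.n))
  refine WP.conseq (WP.forLoop (n := I.n * I.n) (tb := 87) (fun t s' r' => r' = r ∧
      ∀ a, s'.mem a = if base + (3 + I.n) ≤ a ∧ a < base + (3 + I.n) + I.n * I.n ∧
        C t (a - (base + (3 + I.n))) then 0 else s.mem a) (by omega) L.nn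
      (by omega) (by omega) (by omega) (by simp [killBody, killStore, block, writes])
      (by simp [killBody, killStore, block, writes]) ?_ ?_) (by omega) ?_
  · intro v
    refine ⟨rfl, fun a => ?_⟩
    rw [if_neg (by simp [C])]; rfl
  · rintro t ht s' r' _ hfr hi' ⟨rfl, h⟩
    have hn : 0 < I.n := by
      by_contra h0
      rw [show I.n = 0 by omega] at ht
      omega
    have hfr' : ∀ q, q < 33 → s'.reg q = s.reg q :=
      fun q hq => hfr q fun h => by have := writes_killProg h; omega
    have hlow : ∀ a < base, s'.mem a = s.mem a := fun a ha => by rw [h, if_neg (by omega)]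
    have hu : t / I.n < I.n := Nat.div_lt_of_lt_mul ht
    have hv : t % I.n < I.n := Nat.mod_lt _ hn
    have ht' : t = t / I.n * I.n + t % I.n := (Nat.div_add_mod' t I.n).symm
    have L' : Layout I stride dA rA s' := L.of_eq (fun q _ _ => hfr' q (by omega))
      (fun t _ => hlow t (by omega)) (by rw [hfr' 14 (by omega)])
    have hk' : I.Killed (fun x => s'.mem (dA + x)) (fun x => s'.mem (rA + x)) lo hi
        (t / I.n) (t % I.n) ↔ kill (t / I.n) (t % I.n) := by
      rw [hkill]
      simp only [NWTInstance.Killed]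
      rw [hlow _ (by omega), hlow (rA + _) (by omega)]
    refine WP.seq_le (t' := 24) (WP.conseq (wp_killBody ht hm0 (by rw [hfr' 14 (by omega)]; omega) L' hi'
      ((hfr' 27 (by omega)).trans h27) ((hfr' 29 (by omega)).trans h29)) le_rfl ?_) (by omega)
    rintro s₁ r₁ _ f1 ⟨rfl, e1, e34, e35, e44⟩
    have g1 : ∀ q, q < 34 → s₁.reg q = s'.reg q := fun q hq => f1 q fun h => by
      simp [killBody, block, writes] at h; omega
    have E1 : Env I s₁ := L'.toEnv.of_eq (fun q _ _ => g1 q (by omega)) (by simp [e1])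
    rw [if_congr hk' rfl rfl] at e44
    refine WP.conseq (wp_killStore (by omega) E1 hu hv (b := base)
      (by rw [g1 14 (by omega), hfr' 14 (by omega), h14]) hm
      (by rw [g1 33 (by omega), hi', ← ht']) e34 e35 (by rw [e44]; split <;> omega) rfl rfl)
      le_rfl ?_
    rintro s₂ r₂ _ _ ⟨rfl, e2⟩ v
    refine ⟨rfl, fun a => ?_⟩
    simp only [Store.setReg_mem]
    rw [e2, e1, h, e44]
    by_cases ha : base + (3 + I.n) ≤ a ∧ a < base + (3 + I.n) + I.n * I.n
    · obtain ⟨w, rfl⟩ : ∃ w, a = base + (3 + I.n) + w := ⟨a - (base + (3 + I.n)), by omega⟩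
      have hw : w < I.n * I.n := by omega
      have hw' : w = w / I.n * I.n + w % I.n := (Nat.div_add_mod' w I.n).symm
      have hwu : w / I.n < I.n := Nat.div_lt_of_lt_mul hw
      have hwv : w % I.n < I.n := Nat.mod_lt _ hn
      -- Transposition is an involution on the indices below `n * n`.
      have key : w % I.n * I.n + w / I.n = t ↔ w = t % I.n * I.n + t / I.n := by
        constructor
        · intro e
          have h1 : t / I.n = w % I.n := by
            rw [← e, mul_comm, Nat.mul_add_div hn, Nat.div_eq_of_lt hwu, add_zero]
          have h2 : t % I.n = w / I.n := by
            rw [← e, mul_comm, Nat.mul_add_mod, Nat.mod_eq_of_lt hwu]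
          rw [h1, h2]; exact hw'
        · intro e
          have h1 : w / I.n = t % I.n := by
            rw [e, mul_comm, Nat.mul_add_div hn, Nat.div_eq_of_lt hu, add_zero]
          have h2 : w % I.n = t / I.n := by
            rw [e, mul_comm, Nat.mul_add_mod, Nat.mod_eq_of_lt hu]
          rw [h1, h2]; exact ht'.symm
      have hrange : base + (3 + I.n) ≤ base + (3 + I.n) + w ∧
        base + (3 + I.n) + w < base + (3 + I.n) + I.n * I.n := ha
      simp only [ha, true_and, Nat.add_sub_cancel_left, Nat.add_left_cancel_iff, ← ht', ← key]
      have c1 : C (t + 1) w ↔ C t w ∨ ((w = t ∨ w % I.n * I.n + w / I.n = t) ∧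
          kill (t / I.n) (t % I.n)) := by
        simp only [C]
        constructor
        · rintro (⟨h1, h2⟩ | ⟨h1, h2⟩)
          · rcases Nat.lt_succ_iff_lt_or_eq.1 h1 with h3 | h3
            · exact Or.inl (Or.inl ⟨h3, h2⟩)
            · subst h3; exact Or.inr ⟨Or.inl rfl, h2⟩
          · rcases Nat.lt_succ_iff_lt_or_eq.1 h1 with h3 | h3
            · exact Or.inl (Or.inr ⟨h3, h2⟩)
            · refine Or.inr ⟨Or.inr h3, ?_⟩
              have e := key.1 h3
              have h4 : w / I.n = t % I.n := by
                rw [e, mul_comm, Nat.mul_add_div hn, Nat.div_eq_of_lt hu, add_zero]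
              have h5 : w % I.n = t / I.n := by
                rw [e, mul_comm, Nat.mul_add_mod, Nat.mod_eq_of_lt hu]
              rwa [h4, h5] at h2
        · rintro ((⟨h1, h2⟩ | ⟨h1, h2⟩) | ⟨h3 | h3, h2⟩)
          · exact Or.inl ⟨by omega, h2⟩
          · exact Or.inr ⟨by omega, h2⟩
          · subst h3; exact Or.inl ⟨by omega, h2⟩
          · refine Or.inr ⟨by omega, ?_⟩
            have e := key.1 h3
            have h4 : w / I.n = t % I.n := by
              rw [e, mul_comm, Nat.mul_add_div hn, Nat.div_eq_of_lt hu, add_zero]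
            have h5 : w % I.n = t / I.n := by
              rw [e, mul_comm, Nat.mul_add_mod, Nat.mod_eq_of_lt hu]
            rwa [h4, h5]
      simp only [c1]
      by_cases kk : kill (t / I.n) (t % I.n) <;>
        by_cases ww : (w = t ∨ w % I.n * I.n + w / I.n = t) <;>
        simp [kk, ww]
    · have p1 := NWTInstance.pair_lt hu hv
      have p2 := NWTInstance.pair_lt hv hu
      rw [if_neg (by omega), if_neg (by tauto), if_neg (by tauto)]
  · rintro s' r' _ _ ⟨h1, h2⟩
    refine ⟨h1, fun a => ?_⟩
    rw [h2]
    by_cases ha : base ≤ a ∧ a < base + I.encLen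
    · obtain ⟨i, rfl⟩ : ∃ i, a = base + i := ⟨a - base, by omega⟩
      rw [if_pos ha, Nat.add_sub_cancel_left, I.word_restrict, hmem i (by omega)]
      refine if_congr ?_ rfl rfl
      rw [Nat.add_sub_add_left]
      constructor
      · rintro ⟨q1, q2, q3⟩
        refine ⟨by omega, by omega, ?_⟩
        rcases q3 with q3 | q3
        · exact Or.inl q3.2
        · exact Or.inr q3.2
      · rintro ⟨q1, q2, q3⟩
        have hi' : i - (3 + I.n) < I.n * I.n := by omega
        have hn : 0 < I.n := by
          by_contra h0
          rw [show I.n = 0 by omega] at hi'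
          omega
        refine ⟨by omega, by omega, ?_⟩
        rcases q3 with q3 | q3
        · exact Or.inl ⟨hi', q3⟩
        · exact Or.inr ⟨NWTInstance.pair_lt (Nat.mod_lt _ hn) (Nat.div_lt_of_lt_mul hi'), q3⟩
    · rw [if_neg ha, if_neg (by omega)]

end RAM

namespace NWTInstance

/-- There is a living vertex in `[lo, hi)` that forms a negative triangle with a chosen pair. -/
def Hit (I : NWTInstance) (D R : ℕ → ℕ) (lo hi : ℕ) : Prop :=
  ∃ a, lo ≤ a ∧ a < hi ∧ D a = 0 ∧ ∃ t ∈ I.nbr a, R t = 0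

theorem hit_congr {I : NWTInstance} {D R D' R' : ℕ → ℕ} {lo hi : ℕ} (hhi : hi ≤ I.n)
    (hD : ∀ x < I.n, D x = D' x) (hR : ∀ t < I.n * I.n, R t = R' t) :
    I.Hit D R lo hi ↔ I.Hit D' R' lo hi := by
  have hlt : ∀ a t, t ∈ I.nbr a → t < I.n * I.n := fun a t ht => by
    simp only [nbr, Finset.mem_filter, Finset.mem_range] at ht; exact ht.1
  constructor
  · rintro ⟨a, h1, h2, h3, t, ht, h4⟩
    exact ⟨a, h1, h2, by rw [← hD a (by omega), h3], t, ht, by rw [← hR t (hlt a t ht), h4]⟩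
  · rintro ⟨a, h1, h2, h3, t, ht, h4⟩
    exact ⟨a, h1, h2, by rw [hD a (by omega), h3], t, ht, by rw [hR t (hlt a t ht), h4]⟩

theorem Hit.split {I : NWTInstance} {D R : ℕ → ℕ} {lo hi : ℕ} (h : I.Hit D R lo hi) (mid : ℕ) :
    I.Hit D R lo mid ∨ I.Hit D R mid hi := by
  obtain ⟨a, h1, h2, h3⟩ := h
  by_cases ha : a < mid
  · exact Or.inl ⟨a, h1, ha, h3⟩
  · exact Or.inr ⟨a, by omega, h2, h3⟩

end NWTInstance

/-! ### A call of the decision program. -/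

namespace RAM

/-- The memory contains the array `D` of the dead vertices and the array `R` of random numbers, and
is empty from the address in register `14` on. -/
structure Ready (I : NWTInstance) (stride dA rA : ℕ) (D R : ℕ → ℕ) (s : Store) : Prop
    extends Layout I stride dA rA s where
  dead : ∀ x < I.n, s.mem (dA + x) = D x
  rand : ∀ t < I.n * I.n, s.mem (rA + t) = R t
  free : ∀ a, s.reg 14 ≤ a → s.mem a = 0

variable {m : ℕ} {I : NWTInstance} {stride dA rA : ℕ} {D R : ℕ → ℕ} {s s' : Store} {r : ℝ}

theorem Ready.of_eq (h : Ready I stride dA rA D R s)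
    (hr : ∀ q, 3 ≤ q → q ≤ 13 → s'.reg q = s.reg q) (hb : s.reg 14 ≤ s'.reg 14)
    (hm : ∀ a < s.reg 14, s'.mem a = s.mem a) (hf : ∀ a, s'.reg 14 ≤ a → s'.mem a = 0) :
    Ready I stride dA rA D R s' := by
  have h1 := h.hdA
  have h2 := h.hrA
  have h3 := h.hbase
  refine ⟨h.toLayout.of_eq hr (fun t ht => hm t (by omega)) hb, fun x hx => ?_, fun t ht => ?_, hf⟩
  · rw [hm _ (by omega), h.dead x hx]
  · rw [hm _ (by omega), h.rand t ht]

theorem Ready.of_reg (h : Ready I stride dA rA D R s)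
    (hr : ∀ q, 3 ≤ q → q ≤ 14 → s'.reg q = s.reg q) (hm : s'.mem = s.mem) :
    Ready I stride dA rA D R s' :=
  h.of_eq (fun q h1 h2 => hr q h1 (by omega)) (by rw [hr 14 (by omega) (by omega)])
    (fun a _ => by rw [hm]) (fun a ha => by
      rw [hm]; exact h.free a (by rwa [hr 14 (by omega) (by omega)] at ha))

/-- Sets the registers `64`, …, `64 + b - 1` to `0`. -/
def zeroRegs : ℕ → Program
  | 0 => .const 33 0
  | b + 1 => .seq (zeroRegs b) (.const (b + 64) 0)

theorem writes_zeroRegs {b q : ℕ} (h : writes (zeroRegs b) q) : 33 ≤ q ∧ q ≠ 62 := by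
  induction b with
  | zero => simp only [zeroRegs, writes] at h; omega
  | succ b ih =>
    rcases h with h | h
    · exact ih h
    · simp only [writes] at h; omega

theorem wp_zeroRegs (b : ℕ) : WP m (zeroRegs b) (2 * b + 1) (fun s' r' => r' = r ∧
    s'.mem = s.mem ∧ ∀ q < b, s'.reg (q + 64) = 0) s r := by
  induction b with
  | zero => exact WP.const (Nat.zero_le _) ⟨rfl, rfl, by simp⟩
  | succ b ih =>
    refine WP.seq_le (WP.conseq ih le_rfl ?_) (t' := 1) (by omega)
    rintro s₁ r₁ _ _ ⟨rfl, h1, h2⟩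
    refine WP.const (Nat.zero_le _) ⟨rfl, h1, fun q hq => ?_⟩
    rw [Store.setReg_reg]
    split
    · rfl
    · exact h2 q (by omega)

/-- Runs the decision algorithm `P` on the current query. Register `34` becomes the answer. -/
def callProg (P : Program) (b : ℕ) : Program :=
  .seq copyProg (.seq killProg (.seq (zeroRegs b) (.seq (block [.const 33 0, .op .add 64 9 33])
    (.seq (relocate P) (block [.const 35 0, .op .eq 34 64 35, .op .eq 34 34 35,
      .op .add 14 14 11])))))

theorem writes_callProg {P : Program} {b q : ℕ} (h : writes (callProg P b) q) : q = 14 ∨ 33 ≤ q := by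
  simp only [callProg, block, writes] at h
  rcases h with h | h | h | (h | h) | h | h | h | h | h
  · exact Or.inr (writes_copyProg h)
  · exact Or.inr (writes_killProg h)
  · exact Or.inr (writes_zeroRegs h).1
  · omega
  · omega
  · have := (writes_relocate h).1; omega
  all_goals omega

/-- The program `P` decides all the queries about the instance `I` within `T` steps, with words of
size `(I.encLen + 2) ^ κ` and registers below `b`. -/
structure Oracle (I : NWTInstance) (P : Program) (κ b T : ℕ) : Prop where
  good : ∀ kill, Good ((I.encLen + 2) ^ κ) (fun s => s.reg 0 ≠ 0 ↔ (I.restrict kill).HasNegTriangle)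
    T ([P], Store.init (I.restrict kill).encode) (1 / 3)
  below : RegsBelow b P
  pos : 0 < b

/-- The running time of `callProg`. -/
def callTime (I : NWTInstance) (b T : ℕ) : ℕ :=
  I.encLen * 14 + I.n * I.n * 95 + 2 * b + 3 * T + 40

/-- The decision program expects empty memory behind its input, and clearing its whole block of
`(encLen + 2) ^ κ + 1` cells after a run could take longer than the run. So every call gets a fresh
block and register `14` advances by `stride`. The answer is reliable only in the case of the credit
`r₁`; the remaining claims hold in any case. -/
theorem wp_callProg {P : Program} {κ b T lo hi : ℕ} {r₁ r₂ : ℝ} (O : Oracle I P κ b T)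
    (hm : s.reg 14 + 2 * stride ≤ m) (hm0 : 10 ≤ m) (hst : stride = (I.encLen + 2) ^ κ + 1)
    (h : Ready I stride dA rA D R s) (h27 : s.reg 27 = lo) (h29 : s.reg 29 = hi) (hhi : hi ≤ I.n)
    (h12 : r₁ ≤ r₂) (hr : r₁ + 1 / 3 * (r₂ - r₁) ≤ r) :
    WP m (callProg P b) (callTime I b T) (fun s' r' => Ready I stride dA rA D R s' ∧
      s'.reg 14 = s.reg 14 + stride ∧ s'.reg 34 ≤ 1 ∧
      ((s'.reg 34 = 1 ↔ I.Hit D R lo hi) ∧ r' = r₁ ∨ r' = r₂)) s r := by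
  classical
  set base := s.reg 14 with hbase
  set kill := I.Killed (fun x => s.mem (dA + x)) (fun x => s.mem (rA + x)) lo hi with hkill
  have hP := O.good kill
  have hinit : (Store.init (I.restrict kill).encode).reg 0 = I.encLen := by
    simp only [Store.init, Function.update_self]
    exact (I.restrict kill).length_encode
  -- At the start of the simulated run register `0` holds the length of its input and has to fit
  -- into a word; hence the input lies inside the block.
  have hlen : I.encLen ≤ (I.encLen + 2) ^ κ := by
    have := hP.fits.1 0
    rwa [hinit] at this
  have hb1 := h.hdA
  have hb2 := h.hrA
  have hb3 := h.hbase
  refine WP.seq_le (t' := I.n * I.n * 95 + 2 * b + 3 * T + 33) (WP.conseq (wp_copyProg (by omega)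
    (by omega) (by omega) h.toEnv rfl) le_rfl ?_) (by rw [callTime]; omega)
  rintro s₁ _ _ f1 ⟨rfl, h1⟩
  have g1 : ∀ q, q < 33 → s₁.reg q = s.reg q := fun q hq => f1 q fun h => by
    have := writes_copyProg h; omega
  have low1 : ∀ a < base, s₁.mem a = s.mem a := fun a ha => by rw [h1, if_neg (by omega)]
  have L1 : Layout I stride dA rA s₁ := h.toLayout.of_eq (fun q _ _ => g1 q (by omega))
    (fun t ht => low1 t (by omega)) (by rw [g1 14 (by omega)])
  have hk1 : ∀ x y, x < I.n → y < I.n → (I.Killed (fun x => s₁.mem (dA + x))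
      (fun x => s₁.mem (rA + x)) lo hi x y ↔ kill x y) := fun x y hx hy => by
    simp only [hkill, NWTInstance.Killed]
    have := NWTInstance.pair_lt hx hy
    rw [low1 _ (by omega), low1 (rA + _) (by omega)]
  refine WP.seq_le (t' := 2 * b + 3 * T + 26) (WP.conseq (wp_killProg (base := base) rfl hm0 (by omega)
    L1 (g1 14 (by omega)) ((g1 27 (by omega)).trans h27) ((g1 29 (by omega)).trans h29)
    (fun i hi => by rw [h1, if_pos (by omega), Nat.add_sub_cancel_left])) le_rfl ?_) (by omega)
  rintro s₂ _ _ f2 ⟨rfl, h2⟩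
  have g2 : ∀ q, q < 33 → s₂.reg q = s.reg q := fun q hq => by
    rw [f2 q fun h => by have := writes_killProg h; omega, g1 q hq]
  refine WP.seq_le (t' := 3 * T + 24) (WP.conseq (wp_zeroRegs b) le_rfl ?_) (by omega)
  rintro s₃ _ _ f3 ⟨rfl, h3, z3⟩
  have g3 : ∀ q, q < 33 → s₃.reg q = s.reg q := fun q hq => by
    rw [f3 q fun h => by have := writes_zeroRegs h; omega, g2 q hq]
  refine WP.block_seq (t' := 3 * T + 10) (by omega) (by simp) ?_ ?_
    (by simp only [List.length_cons, List.length_nil]; omega)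
  · simp [Fine, Fine1, exec1, g3, h.len]; omega
  set s₄ := exec [.const 33 0, .op .add 64 9 33] s₃ with hs₄
  have r4 : ∀ q, s₄.reg q = if q = 64 then I.encLen else if q = 33 then 0 else s₃.reg q := fun q => by
    simp [hs₄, exec, exec1, BinOp.eval, g3, h.len]
  have m4 : ∀ a, s₄.mem a = if base ≤ a ∧ a < base + I.encLen then (I.restrict kill).word (a - base)
        else s.mem a := fun a => by
    rw [show s₄.mem = s₃.mem from rfl, h3, h2]
    by_cases ha : base ≤ a ∧ a < base + I.encLen
    · rw [if_pos ha, if_pos ha, I.word_restrict, I.word_restrict]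
      refine if_congr ?_ rfl rfl
      by_cases hc : 3 + I.n ≤ a - base ∧ a - base < 3 + I.n + I.n * I.n
      · have hi' : a - base - (3 + I.n) < I.n * I.n := by omega
        have hn : 0 < I.n := by
          by_contra h0
          rw [show I.n = 0 by omega] at hi'
          omega
        have hu := Nat.mod_lt (a - base - (3 + I.n)) hn
        have hv : (a - base - (3 + I.n)) / I.n < I.n := Nat.div_lt_of_lt_mul hi'
        rw [hk1 _ _ hu hv, hk1 _ _ hv hu]
      · tauto
    · rw [if_neg ha, if_neg ha, h1, if_neg ha]
  have hsim : Sim b base ((I.encLen + 2) ^ κ) (Store.init (I.restrict kill).encode) s₄ := by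
    refine ⟨fun q hq => ?_, fun a ha => ?_, ?_⟩
    · rw [r4]
      rcases Nat.eq_zero_or_pos q with rfl | hq0
      · rw [hinit]; simp
      · rw [if_neg (by omega), if_neg (by omega), z3 q hq]
        simp only [Store.init, Function.update_of_ne hq0.ne']
    · rw [m4, show (Store.init (I.restrict kill).encode).mem a = (I.restrict kill).word a from rfl]
      by_cases ha : a < I.encLen
      · rw [if_pos (by omega), Nat.add_sub_cancel_left]
      -- Behind the copied input the fresh block is still zero, like the memory of the simulated
      -- machine behind its input.
      · rw [if_neg (by omega), h.free _ (by omega), NWTInstance.word, List.getD_eq_default]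
        rw [(I.restrict kill).length_encode]
        change I.encLen ≤ a
        omega
    · rw [r4, if_neg (by omega), if_neg (by omega), g3 14 (by omega)]
  refine WP.seq_le (t' := 8) (WP.conseq (WP.relocate (by omega) hP O.below hsim h12 hr) le_rfl ?_)
    (by omega)
  rintro s₅ r₅ _ f5 ⟨s₀', hsim', h5, hr5⟩
  have g5 : ∀ q, q < 33 → s₅.reg q = s.reg q := fun q hq => by
    rw [f5 q fun h => by have := (writes_relocate h).1; omega, r4, if_neg (by omega),
      if_neg (by omega), g3 q hq]
  refine WP.block_le (by omega) (by simp) ?_ ?_ (by simp)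
  · simp [Fine, Fine1, exec1, g5, h.strideReg]; omega
  have e64 : s₅.reg 64 = s₀'.reg 0 := hsim'.reg 0 O.pos
  refine ⟨h.of_eq (fun q hq hq' => ?_) ?_ (fun a ha => ?_) (fun a ha => ?_), ?_, ?_, ?_⟩
  · simp only [exec, exec1, Store.setReg_reg]
    rw [if_neg (by omega), if_neg (by omega), if_neg (by omega), if_neg (by omega), g5 q (by omega)]
  · simp [exec, exec1, BinOp.eval, g5]
  · simp only [exec, exec1, Store.setReg_mem]
    rw [h5 a (by omega), m4, if_neg (by omega)]
  · simp [exec, exec1, BinOp.eval, g5, h.strideReg] at ha ⊢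
    rw [h5 a (by omega), m4, if_neg (by omega), h.free a (by omega)]
  · simp [exec, exec1, BinOp.eval, g5, h.strideReg, hbase]
  · simp only [exec, exec1, BinOp.eval, Store.setReg_reg, Nat.reduceEqDiff, if_false, if_true,
      ite_eq_zero_ite]
    split <;> omega
  · have e : (exec [.const 35 0, .op .eq 34 64 35, .op .eq 34 34 35, .op .add 14 14 11] s₅).reg 34 =
        if ¬ s₅.reg 64 = 0 then 1 else 0 := by
      simp only [exec, exec1, BinOp.eval, Store.setReg_reg, Nat.reduceEqDiff, if_false, if_true,
        ite_eq_zero_ite]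
    rw [e, e64, ← NWTInstance.hit_congr hhi h.dead h.rand, NWTInstance.Hit,
      ← NWTInstance.hasNegTriangle_restrict, ← hkill]
    rcases hr5 with ⟨h6, h7⟩ | h6
    · refine Or.inl ⟨?_, h7⟩
      rw [← h6]
      by_cases h0 : s₀'.reg 0 = 0 <;> simp [h0]
    · exact Or.inr h6

/-! ### Majority votes and binary search. -/

/-- Answers the current query by a majority vote. Register `30` becomes the answer. -/
def voteProg (P : Program) (b : ℕ) : Program :=
  .seq (.const 30 0) (.seq (forLoop 32 19 (.seq (callProg P b) (.op .add 30 30 34)))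
    (block [.op .add 35 30 30, .op .lt 30 19 35]))

theorem writes_voteProg {P : Program} {b q : ℕ} (h : writes (voteProg P b) q) :
    q = 14 ∨ q = 30 ∨ 32 ≤ q := by
  simp only [voteProg, forLoop, block, writes] at h
  have := writes_callProg (P := P) (b := b) (q := q)
  rcases h with h | ((h | h) | ((h | h) | h | h | h)) | h | h
  on_goal 4 => have := this h
  all_goals omega

/-- The running time of `voteProg` with `2 * v` votes. -/
def voteTime (I : NWTInstance) (b T v : ℕ) : ℕ := 2 * v * (callTime I b T + 10) + 20

/-- The credit is an exponential moment of the number of wrong answers: each of them doubles it. A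
call errs with probability at most 1/3, so the expected factor is `2/3 + 2/3 = 4/3`, and the `2 * v`
calls have to start with `(4/3) ^ (2 * v) / 2 ^ v = (8/9) ^ v`. Once `v` answers are wrong the
credit is at least 1 and nothing has to be shown; otherwise the majority is right. The part `ρ` is
left over for the rest of the program. -/
theorem wp_voteProg {P : Program} {κ b T lo hi v : ℕ} {ρ : ℝ} (O : Oracle I P κ b T)
    (hm : s.reg 14 + (2 * v + 2) * stride ≤ m) (hm0 : 10 ≤ m) (hmv : 10 * v ≤ m)
    (hst : stride = (I.encLen + 2) ^ κ + 1)
    (h : Ready I stride dA rA D R s) (h27 : s.reg 27 = lo) (h29 : s.reg 29 = hi) (hhi : hi ≤ I.n)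
    (h19 : s.reg 19 = 2 * v) (hρ : 0 ≤ ρ) (hr : r < 1 → ρ + (8 / 9) ^ v ≤ r) :
    WP m (voteProg P b) (voteTime I b T v) (fun s' r' => Ready I stride dA rA D R s' ∧
      s'.reg 14 = s.reg 14 + 2 * v * stride ∧
      (r' < 1 → r < 1 ∧ ρ ≤ r' ∧ (s'.reg 30 ≠ 0 ↔ I.Hit D R lo hi))) s r := by
  classical
  set base := s.reg 14 with hbase
  set X : ℕ → ℝ := fun j => (4 / 3) ^ j / 2 ^ v with hX
  have hX0 : ∀ j, 0 ≤ X j := fun j => by simp only [hX]; positivity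
  refine WP.seq_le (WP.const (Nat.zero_le _) ?_)
    (t' := 2 * v * (callTime I b T + 2 + 8) + 6 + 5) (by rw [voteTime]; linarith)
  have hready0 : Ready I stride dA rA D R (s.setReg 30 0) := h.of_reg (fun q _ _ => by
    rw [Store.setReg_reg, if_neg (by omega)]) rfl
  -- The number of wrong answers among `t` answers of which `c` are positive.
  let wrong : ℕ → ℕ → ℕ := fun t c => if I.Hit D R lo hi then t - c else c
  refine WP.seq_le (t' := 4) (WP.conseq (WP.forLoop (n := 2 * v) (tb := callTime I b T + 2)
    (fun t s' r' => Ready I stride dA rA D R s' ∧ s'.reg 14 = base + t * stride ∧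
      s'.reg 30 ≤ t ∧ (r' < 1 → r < 1 ∧ ρ + X (2 * v - t) * 2 ^ wrong t (s'.reg 30) ≤ r'))
    (by omega) (by simpa using h19) (by omega) (by omega) (by omega) ?_ ?_ ?_ ?_) le_rfl ?_) (by omega)
  · rintro (h | h)
    · have := writes_callProg h; omega
    · simp [writes] at h
  · rintro (h | h)
    · have := writes_callProg h; omega
    · simp [writes] at h
  · intro v'
    refine ⟨hready0.of_reg (fun q _ _ => ?_) rfl, ?_, ?_, ?_⟩
    · rw [Store.setReg_reg, if_neg (by omega), Store.setReg_reg, if_neg (by omega)]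
    · simp [hbase]
    · simp
    · intro hr1
      refine ⟨hr1, le_trans (le_of_eq ?_) (hr hr1)⟩
      have : wrong 0 0 = 0 := by simp [wrong]
      simp only [Store.setReg_reg, Nat.reduceEqDiff, if_false, if_true, this, hX, Nat.sub_zero]
      rw [pow_zero, mul_one, pow_mul, ← div_pow]
      norm_num
  · rintro t ht s₁ r₁ _ f1 hi1 ⟨h1, h2, h3, h4⟩
    have g1 : ∀ q, q < 30 → q ≠ 14 → s₁.reg q = s.reg q := fun q hq hq' => by
      rw [f1 q fun h => by
        simp only [forLoop, block, writes] at h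
        have := writes_callProg (P := P) (b := b) (q := q)
        rcases h with (h | h) | ((h | h) | h | h | h)
        on_goal 3 => have := this h
        all_goals omega, Store.setReg_reg, if_neg (by omega)]
    have hts : (t + 2) * stride ≤ (2 * v + 2) * stride := Nat.mul_le_mul_right _ (by omega)
    -- The credits after a right and after a wrong answer. If the credit has already reached 1, it
    -- is simply kept.
    obtain ⟨a₁, a₂, ha12, har, hap⟩ : ∃ a₁ a₂ : ℝ, a₁ ≤ a₂ ∧ a₁ + 1 / 3 * (a₂ - a₁) ≤ r₁ ∧
        (r₁ < 1 → ρ + X (2 * v - (t + 1)) * 2 ^ wrong t (s₁.reg 30) ≤ a₁ ∧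
          ρ + X (2 * v - (t + 1)) * 2 ^ (wrong t (s₁.reg 30) + 1) ≤ a₂) ∧
        (¬ r₁ < 1 → 1 ≤ a₁ ∧ 1 ≤ a₂) := by
      by_cases hr1 : r₁ < 1
      · refine ⟨ρ + X (2 * v - (t + 1)) * 2 ^ wrong t (s₁.reg 30),
          ρ + X (2 * v - (t + 1)) * 2 ^ (wrong t (s₁.reg 30) + 1), ?_, ?_, fun _ => ⟨le_rfl, le_rfl⟩,
          fun h => absurd hr1 h⟩
        · rw [pow_succ]
          nlinarith [mul_nonneg (hX0 (2 * v - (t + 1)))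
            (show (0 : ℝ) ≤ 2 ^ wrong t (s₁.reg 30) by positivity)]
        · refine le_trans (le_of_eq ?_) (h4 hr1).2
          have : X (2 * v - t) = X (2 * v - (t + 1)) * (4 / 3) := by
            simp only [hX]
            rw [show 2 * v - t = 2 * v - (t + 1) + 1 by omega, pow_succ]; ring
          rw [this, pow_succ]; ring
      · exact ⟨r₁, r₁, le_rfl, by linarith, fun h => absurd h hr1, fun _ => ⟨by linarith, by linarith⟩⟩
    refine WP.seq_le (t' := 1) (WP.conseq (wp_callProg O (by rw [h2]; nlinarith) hm0 hst h1
      ((g1 27 (by omega) (by omega)).trans h27) ((g1 29 (by omega) (by omega)).trans h29) hhi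
      ha12 har) le_rfl ?_) (by omega)
    rintro s₂ r₂ hs₂ f2 ⟨e1, e2, e3, e4⟩
    have e30 : s₂.reg 30 = s₁.reg 30 := f2 30 fun h => by have := writes_callProg h; omega
    refine WP.op (by simp only [BinOp.eval]; omega) ?_
    intro v'
    simp only [BinOp.eval]
    refine ⟨e1.of_reg (fun q hq hq' => ?_) rfl, ?_, ?_, ?_⟩
    · simp only [Store.setReg_reg]
      rw [if_neg (by omega), if_neg (by omega), if_neg (by omega), if_neg (by omega)]
    · simp [e2, h2]; ring
    · simp; omega
    · intro hr2
      simp only [Store.setReg_reg, Nat.reduceEqDiff, if_false, if_true]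
      rw [e30]
      have hr1 : r₁ < 1 := by
        by_contra hc
        have := hap.2 hc
        rcases e4 with ⟨-, rfl⟩ | rfl <;> linarith
      obtain ⟨hap1, hap2⟩ := hap.1 hr1
      refine ⟨(h4 hr1).1, ?_⟩
      have h2le : ∀ i j : ℕ, i ≤ j → ρ + X (2 * v - (t + 1)) * 2 ^ i ≤
          ρ + X (2 * v - (t + 1)) * 2 ^ j := fun i j hij => by
        have := hX0 (2 * v - (t + 1))
        gcongr
        norm_num
      rcases e4 with ⟨e4, rfl⟩ | rfl
      · refine le_trans (h2le _ _ ?_) hap1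
        by_cases hh : I.Hit D R lo hi
        · have := e4.2 hh
          simp only [wrong, hh, if_true]; omega
        · have : s₂.reg 34 = 0 := by
            have : s₂.reg 34 ≠ 1 := fun h => hh (e4.1 h)
            omega
          simp only [wrong, hh, if_false]; omega
      · refine le_trans (h2le _ _ ?_) hap2
        simp only [wrong]
        split <;> omega
  · rintro s₁ r₁ hs₁ f1 ⟨h1, h2, h3, h4⟩
    have e19 : s₁.reg 19 = 2 * v := by
      rw [f1 19 fun h => by
        simp only [forLoop, block, writes] at h
        have := writes_callProg (P := P) (b := b) (q := 19)
        rcases h with (h | h) | ((h | h) | h | h | h)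
        on_goal 3 => have := this h
        all_goals omega, Store.setReg_reg, if_neg (by omega), h19]
    refine WP.block_le (by omega) (by simp) ?_ ?_ (by simp)
    · simp [Fine, Fine1]; omega
    · refine ⟨h1.of_reg (fun q _ _ => ?_) rfl, ?_, fun hr1 => ?_⟩
      · simp only [exec, exec1, Store.setReg_reg]
        rw [if_neg (by omega), if_neg (by omega)]
      · simp [exec, exec1, h2]
      · obtain ⟨hr0, h5⟩ := h4 hr1
        simp only [Nat.sub_self, hX, pow_zero] at h5
        have h6 : wrong (2 * v) (s₁.reg 30) < v := by
          by_contra hc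
          have : (1 : ℝ) ≤ 1 / 2 ^ v * 2 ^ wrong (2 * v) (s₁.reg 30) := by
            rw [div_mul_eq_mul_div, one_mul, le_div_iff₀ (by positivity), one_mul]
            exact pow_le_pow_right₀ (by norm_num) (by omega)
          linarith
        refine ⟨hr0, ?_, ?_⟩
        · have : (0 : ℝ) ≤ 1 / 2 ^ v * 2 ^ wrong (2 * v) (s₁.reg 30) := by positivity
          linarith
        · simp only [exec, exec1, BinOp.eval, Store.setReg_reg, Nat.reduceEqDiff, if_false, if_true,
            e19]
          by_cases hh : I.Hit D R lo hi
          · simp only [wrong, hh, if_true] at h6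
            simp only [hh, iff_true]
            rw [if_pos (by omega)]; simp
          · simp only [wrong, hh, if_false] at h6
            simp only [hh, iff_false, not_not]
            rw [if_neg (by omega)]

/-- Binary search for a living vertex that forms a negative triangle with a chosen pair. -/
def searchBody (P : Program) (b : ℕ) : Program :=
  .seq (block [.op .add 29 27 28, .const 35 2, .op .div 29 29 35]) (.seq (voteProg P b)
    (.cond 30 (block [.const 35 0, .op .add 28 29 35]) (block [.const 35 0, .op .add 27 29 35])))

def searchProg (P : Program) (b : ℕ) : Program :=
  .seq (block [.const 27 0, .const 35 0, .op .add 28 3 35]) (forLoop 26 18 (searchBody P b))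

theorem writes_searchBody {P : Program} {b q : ℕ} (h : writes (searchBody P b) q) :
    q = 14 ∨ 27 ≤ q ∧ q ≠ 31 := by
  simp only [searchBody, block, writes] at h
  have := writes_voteProg (P := P) (b := b) (q := q)
  rcases h with (h | h | h) | h | (h | h) | h | h
  on_goal 4 => have := this h
  all_goals omega

theorem writes_searchProg {P : Program} {b q : ℕ} (h : writes (searchProg P b) q) :
    q = 14 ∨ 26 ≤ q ∧ q ≠ 31 := by
  simp only [searchProg, forLoop, block, writes] at h
  have := writes_searchBody (P := P) (b := b) (q := q)
  rcases h with (h | h | h) | (h | h) | h | h | h | h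
  on_goal 6 => have := this h
  all_goals omega

/-- The running time of `searchProg` with `σ` steps. -/
def searchTime (I : NWTInstance) (b T v σ : ℕ) : ℕ := σ * (voteTime I b T v + 30) + 20

/-- Only the lower half of the range is queried; after a negative answer a hit must be in the upper
half (`Hit.split`). If there is no hit at all, the search still ends at some vertex below `n`, which
the bookkeeping tolerates. The range has length at most `2 ^ (σ - t)` after `t` steps, and each of
the `σ` votes consumes `(8/9) ^ v` of the credit. -/
theorem wp_searchProg {P : Program} {κ b T v σ : ℕ} {ρ : ℝ} (O : Oracle I P κ b T)
    (hm : s.reg 14 + (σ * (2 * v) + 2) * stride ≤ m) (hm0 : 10 * I.n + 10 ≤ m) (hmv : 10 * v ≤ m)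
    (hst : stride = (I.encLen + 2) ^ κ + 1) (hn : 0 < I.n) (hσ : I.n ≤ 2 ^ σ)
    (h : Ready I stride dA rA D R s)
    (h18 : s.reg 18 = σ) (h19 : s.reg 19 = 2 * v) (hρ : 0 ≤ ρ)
    (hr : r < 1 → ρ + σ * (8 / 9) ^ v ≤ r) :
    WP m (searchProg P b) (searchTime I b T v σ) (fun s' r' => Ready I stride dA rA D R s' ∧
      s'.reg 14 = s.reg 14 + σ * (2 * v) * stride ∧ s'.reg 27 < I.n ∧
      (r' < 1 → r < 1 ∧ ρ ≤ r' ∧ (I.Hit D R 0 I.n → I.Hit D R (s'.reg 27) (s'.reg 27 + 1)))) s r := by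
  set base := s.reg 14 with hbase
  set η : ℝ := (8 / 9) ^ v with hη
  have hη0 : 0 ≤ η := by rw [hη]; positivity
  refine WP.block_seq (t' := σ * (voteTime I b T v + 18 + 8) + 6) (by omega) (by simp) ?_ ?_
    (by rw [searchTime]; simp only [List.length_cons, List.length_nil]; nlinarith)
  · simp [Fine, Fine1, exec1, h.n]; omega
  set s₀ := exec [.const 27 0, .const 35 0, .op .add 28 3 35] s with hs₀
  have r0 : ∀ q, s₀.reg q = if q = 28 then I.n else if q = 35 then 0 else if q = 27 then 0 else
      s.reg q := fun q => by simp [hs₀, exec, exec1, BinOp.eval, h.n]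
  refine WP.conseq (WP.forLoop (n := σ) (tb := voteTime I b T v + 18) (fun t s' r' =>
    Ready I stride dA rA D R s' ∧ s'.reg 14 = base + t * (2 * v) * stride ∧
    s'.reg 27 < I.n ∧ s'.reg 27 ≤ s'.reg 28 ∧ s'.reg 28 ≤ I.n ∧
    s'.reg 28 ≤ s'.reg 27 + 2 ^ (σ - t) ∧ (r' < 1 → r < 1 ∧ ρ + ((σ - t : ℕ) : ℝ) * η ≤ r' ∧
      (I.Hit D R 0 I.n → I.Hit D R (s'.reg 27) (s'.reg 28)))) (by omega) (by rw [r0]; simpa using h18)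
    (by omega) (by omega) (by omega) (fun h => by have := writes_searchBody h; omega)
    (fun h => by have := writes_searchBody h; omega) ?_ ?_) le_rfl ?_
  · intro v'
    refine ⟨h.of_reg (fun q _ _ => ?_) rfl, ?_, ?_, ?_, ?_, ?_, ?_⟩
    · rw [Store.setReg_reg, if_neg (by omega), Store.setReg_reg, if_neg (by omega), r0,
        if_neg (by omega), if_neg (by omega), if_neg (by omega)]
    all_goals simp only [Store.setReg_reg, r0, Nat.reduceEqDiff, if_false, if_true]
    · omega
    · exact hn
    · omega
    · exact le_rfl
    · simpa using hσ
    · intro hr1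
      exact ⟨hr1, by simpa using hr hr1, fun h => h⟩
  · rintro t ht s₁ r₁ _ f1 hi1 ⟨h1, h2, h3, h4, h5, h6, h7⟩
    have g1 : ∀ q, q < 26 → q ≠ 14 → s₁.reg q = s.reg q := fun q hq hq' => by
      rw [f1 q fun h => by have := writes_searchProg (Or.inr h); omega, r0,
        if_neg (by omega), if_neg (by omega), if_neg (by omega)]
    refine WP.block_seq (t' := voteTime I b T v + 11) (by omega) (by simp) ?_ ?_
      (by simp only [List.length_cons, List.length_nil]; omega)
    · simp [Fine, Fine1]; omega
    set lo := s₁.reg 27 with hlo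
    set hi := s₁.reg 28 with hhi
    set mid := (lo + hi) / 2 with hmid
    set s₂ := exec [.op .add 29 27 28, .const 35 2, .op .div 29 29 35] s₁ with hs₂
    have r2 : ∀ q, s₂.reg q = if q = 29 then mid else if q = 35 then 2 else s₁.reg q := fun q => by
      simp [hs₂, exec, exec1, BinOp.eval]
      split
      · rfl
      · split
        · rfl
        · rfl
    have hready2 : Ready I stride dA rA D R s₂ := h1.of_reg (fun q _ _ => by
      rw [r2, if_neg (by omega), if_neg (by omega)]) rfl
    have hts : (t * (2 * v) + (2 * v + 2)) * stride ≤ (σ * (2 * v) + 2) * stride := by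
      refine Nat.mul_le_mul_right _ ?_
      have : (t + 1) * (2 * v) ≤ σ * (2 * v) := Nat.mul_le_mul_right _ (by omega)
      linarith
    have e14 : s₂.reg 14 = base + t * (2 * v) * stride := by
      rw [r2, if_neg (by omega), if_neg (by omega), h2]
    refine WP.seq_le (t' := 5) (WP.conseq (wp_voteProg (ρ := ρ + ((σ - (t + 1) : ℕ) : ℝ) * η)
      (lo := lo) (hi := mid) O
      (by rw [e14]; linarith) (by omega) hmv hst hready2
      (by rw [r2, if_neg (by omega), if_neg (by omega)])
      (by rw [r2, if_pos (by omega)]) (by omega)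
      (by rw [r2, if_neg (by omega), if_neg (by omega), g1 19 (by omega) (by omega), h19])
      (by positivity) ?_) le_rfl ?_) (by omega)
    · intro hr1
      refine le_trans (le_of_eq ?_) (h7 hr1).2.1
      rw [show σ - t = σ - (t + 1) + 1 by omega]
      push_cast; rw [← hη]; ring
    rintro s₃ r₃ _ f3 ⟨k1, k2, k3⟩
    have g3 : s₃.reg 27 = lo ∧ s₃.reg 28 = hi ∧ s₃.reg 29 = mid := by
      refine ⟨?_, ?_, ?_⟩
      · rw [f3 _ fun h => by have := writes_voteProg h; omega, r2, if_neg (by omega), if_neg (by omega)]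
      · rw [f3 _ fun h => by have := writes_voteProg h; omega, r2, if_neg (by omega), if_neg (by omega)]
      · rw [f3 _ fun h => by have := writes_voteProg h; omega, r2, if_pos rfl]
    obtain ⟨e27, e28, e29⟩ := g3
    have hpow : 2 ^ (σ - t) = 2 * 2 ^ (σ - (t + 1)) := by
      rw [show σ - t = σ - (t + 1) + 1 by omega, pow_succ]; ring
    refine WP.mono_time (WP.cond (t := 4) (fun h30 => ?_) (fun h30 => ?_)) (by omega)
    · refine WP.block_le (by omega) (by simp) ?_ ?_ (by simp)
      · simp [Fine, Fine1, exec1]; omega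
      · intro v'
        refine ⟨k1.of_reg (fun q _ _ => ?_) rfl, ?_, ?_, ?_, ?_, ?_, ?_⟩
        · simp only [exec, exec1, Store.setReg_reg]
          repeat rw [if_neg (by omega)]
        all_goals simp only [exec, exec1, BinOp.eval, Store.setReg_reg, Nat.reduceEqDiff, if_false,
          if_true, e27, e28, e29, add_zero]
        · rw [k2, e14]; ring
        · omega
        · omega
        · omega
        · omega
        · intro hr3
          obtain ⟨q1, q2, q3⟩ := k3 hr3
          exact ⟨(h7 q1).1, q2, fun _ => q3.1 h30⟩
    · refine WP.block_le (by omega) (by simp) ?_ ?_ (by simp)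
      · simp [Fine, Fine1, exec1]; omega
      · intro v'
        refine ⟨k1.of_reg (fun q _ _ => ?_) rfl, ?_, ?_, ?_, ?_, ?_, ?_⟩
        · simp only [exec, exec1, Store.setReg_reg]
          repeat rw [if_neg (by omega)]
        all_goals simp only [exec, exec1, BinOp.eval, Store.setReg_reg, Nat.reduceEqDiff, if_false,
          if_true, e27, e28, e29, add_zero]
        · rw [k2, e14]; ring
        · omega
        · omega
        · omega
        · omega
        · intro hr3
          obtain ⟨q1, q2, q3⟩ := k3 hr3
          refine ⟨(h7 q1).1, q2, fun hh => ?_⟩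
          exact (((h7 q1).2.2 hh).split mid).resolve_left fun h => q3.2 h h30
  · rintro s₁ r₁ _ _ ⟨h1, h2, h3, h4, h5, h6, h7⟩
    refine ⟨h1, h2, h3, fun hr1 => ?_⟩
    obtain ⟨hr0, h8, h9⟩ := h7 hr1
    refine ⟨hr0, by simpa using h8, fun hh => ?_⟩
    obtain ⟨a, b1, b2, b3⟩ := h9 hh
    rw [Nat.sub_self, pow_zero] at h6
    exact ⟨a, b1, by omega, b3⟩

end RAM

/-! ### Parameters of the algorithm and arrays of random numbers. -/

namespace RAM

/-- The average of `F` over all ways to replace the values of `f` at `t`, …, `t + j - 1` by numbers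
smaller than `k`. -/
noncomputable def avg (k : ℕ) (F : (ℕ → ℕ) → ℝ) : ℕ → ℕ → (ℕ → ℕ) → ℝ
  | 0, _, f => F f
  | j + 1, t, f => (∑ v ∈ Finset.range k, avg k F j (t + 1) (Function.update f t v)) / k

/-- The decision algorithm and the numerical parameters of the counting algorithm. -/
structure Par where
  P : Program
  κ : ℕ
  b : ℕ
  T : ℕ
  v : ℕ
  σ : ℕ
  K : ℕ
  J : ℕ
  L : ℕ
  dA : ℕ
  rA : ℕ

/-- The distance of the memory blocks for the queries. -/
def Par.stride (p : Par) (I : NWTInstance) : ℕ := (I.encLen + 2) ^ p.κ + 1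

/-- The amount of memory that is used by one search. -/
def Par.chunk (p : Par) (I : NWTInstance) : ℕ := p.σ * (2 * p.v) * p.stride I

/-- The parameters fit to the instance, and words up to `m` are large enough. -/
structure Par.Ok (p : Par) (m : ℕ) (I : NWTInstance) : Prop where
  oracle : Oracle I p.P p.κ p.b p.T
  hn : 0 < I.n
  hσ : I.n ≤ 2 ^ p.σ
  len_le : I.encLen ≤ m
  base_le : 10 * 2 ^ I.wordLen + 10 ≤ m
  n_le : 10 * I.n + 10 ≤ m
  v_le : 10 * p.v ≤ m

/-- The memory is prepared and registers `15` to `19` contain the parameters. -/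
structure St (I : NWTInstance) (p : Par) (D R : ℕ → ℕ) (s : Store) : Prop
    extends Ready I (p.stride I) p.dA p.rA D R s where
  r15 : s.reg 15 = p.L
  r16 : s.reg 16 = p.J
  r17 : s.reg 17 = p.K
  r18 : s.reg 18 = p.σ
  r19 : s.reg 19 = 2 * p.v

variable {m : ℕ} {I : NWTInstance} {p : Par} {D R : ℕ → ℕ} {s s' : Store} {r : ℝ}

theorem St.of_ready {D' R' : ℕ → ℕ} (h : St I p D R s)
    (h' : Ready I (p.stride I) p.dA p.rA D' R' s')
    (hr : ∀ q, 15 ≤ q → q ≤ 19 → s'.reg q = s.reg q) : St I p D' R' s' :=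
  { h' with
    r15 := by rw [hr _ (by omega) (by omega), h.r15]
    r16 := by rw [hr _ (by omega) (by omega), h.r16]
    r17 := by rw [hr _ (by omega) (by omega), h.r17]
    r18 := by rw [hr _ (by omega) (by omega), h.r18]
    r19 := by rw [hr _ (by omega) (by omega), h.r19] }

theorem St.of_reg (h : St I p D R s) (hr : ∀ q, 3 ≤ q → q ≤ 19 → s'.reg q = s.reg q)
    (hm : s'.mem = s.mem) : St I p D R s' :=
  h.of_ready (h.toReady.of_reg (fun q h1 h2 => hr q h1 (by omega)) hm)
    (fun q h1 h2 => hr q (by omega) h2)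

/-- The effect of a write to the array of the random numbers. -/
theorem Ready.set_rand {stride dA rA t v : ℕ} (h : Ready I stride dA rA D R s)
    (ht : t < I.n * I.n) :
    Ready I stride dA rA D (Function.update R t v) (s.setMem (rA + t) v) := by
  have h1 := h.hdA
  have h2 := h.hrA
  have h3 := h.hbase
  refine ⟨h.toLayout.of_eq (fun _ _ _ => rfl) (fun a ha => ?_) le_rfl, fun x hx => ?_,
    fun x hx => ?_, fun a ha => ?_⟩
  · rw [Store.setMem_mem, if_neg (by omega)]
  · rw [Store.setMem_mem, if_neg (by omega), h.dead x hx]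
  · rw [Store.setMem_mem, Function.update_apply, h.rand x hx]
    exact if_congr (by omega) rfl rfl
  · simp only [Store.setMem_reg] at ha
    rw [Store.setMem_mem, if_neg (by omega), h.free a ha]

/-- The effect of a write to the array of the dead vertices. -/
theorem Ready.set_dead {stride dA rA x v : ℕ} (h : Ready I stride dA rA D R s) (hx : x < I.n) :
    Ready I stride dA rA (Function.update D x v) R (s.setMem (dA + x) v) := by
  have h1 := h.hdA
  have h2 := h.hrA
  have h3 := h.hbase
  refine ⟨h.toLayout.of_eq (fun _ _ _ => rfl) (fun a ha => ?_) le_rfl, fun y hy => ?_,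
    fun t ht => ?_, fun a ha => ?_⟩
  · rw [Store.setMem_mem, if_neg (by omega)]
  · rw [Store.setMem_mem, Function.update_apply, h.dead y hy]
    exact if_congr (by omega) rfl rfl
  · rw [Store.setMem_mem, if_neg (by omega), h.rand t ht]
  · simp only [Store.setMem_reg] at ha
    rw [Store.setMem_mem, if_neg (by omega), h.free a ha]

/-- Fills the first entries of the random array with random numbers smaller than the number in
register `21`; their number is in register `len`. -/
def fillProg (len : ℕ) : Program :=
  forLoop 33 len (.seq (.rand 34 21) (block [.op .add 35 13 33, .store 35 34]))

theorem writes_fillProg {len q : ℕ} (h : writes (fillProg len) q) : 33 ≤ q := by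
  simp [fillProg, forLoop, block, writes] at h; omega

/-- When the entries below `t` are fixed, the credit is the average of `F` over the remaining ones.
Drawing the next entry distributes this credit precisely as in the recursion of `avg`. -/
theorem wp_fillProg {len k l : ℕ} (F : (ℕ → ℕ) → ℝ) (hm : 1 ≤ m) (h : St I p D R s)
    (hlen : len < 20) (hl : s.reg len = l) (hle : l ≤ I.n * I.n) (hk : 0 < k) (h21 : s.reg 21 = k)
    (hbm : s.reg 14 ≤ m) (hr : r < 1 → avg k F l 0 R ≤ r) :
    WP m (fillProg len) (l * 14 + 6) (fun s' r' => ∃ R', St I p D R' s' ∧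
      (r' < 1 → r < 1 ∧ F R' ≤ r')) s r := by
  have h3 := h.hbase
  refine WP.conseq (WP.forLoop (n := l) (tb := 6) (fun t s' r' => ∃ R', St I p D R' s' ∧
      (r' < 1 → r < 1 ∧ avg k F (l - t) t R' ≤ r')) hm hl (by omega) (by omega) (by omega)
      (by simp [block, writes]; omega) (by simp [block, writes]) ?_ ?_) le_rfl ?_
  · intro v
    refine ⟨R, h.of_reg (fun q _ _ => ?_) rfl, fun hr1 => ⟨hr1, hr hr1⟩⟩
    rw [Store.setReg_reg, if_neg (by omega), Store.setReg_reg, if_neg (by omega)]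
  · rintro t ht s₁ r₁ _ f1 hi1 ⟨R', h1, h2⟩
    have g1 : ∀ q, q < 33 → s₁.reg q = s.reg q :=
      fun q hq => f1 q fun h => by have := writes_fillProg h; omega
    have e21 : s₁.reg 21 = k := (g1 21 (by omega)).trans h21
    have hk' : (0 : ℝ) < k := by exact_mod_cast hk
    refine WP.seq_le (t' := 4) (WP.rand (fun v => if r₁ < 1 then
      avg k F (l - (t + 1)) (t + 1) (Function.update R' t v) else r₁) (by omega) ?_ ?_) (by omega)
    · rw [e21]
      by_cases hr1 : r₁ < 1
      · simp only [hr1, if_true]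
        have := (h2 hr1).2
        rw [show l - t = l - (t + 1) + 1 by omega, avg, div_le_iff₀ hk'] at this
        linarith
      · simp [hr1]
    · intro v hv
      refine WP.block_le hm (by simp) ?_ ?_ (by simp)
      · simp [Fine, Fine1, h1.randReg, hi1]
        have := h1.hbase
        rw [g1 14 (by omega)] at this
        omega
      · intro v'
        refine ⟨Function.update R' t v, ?_, ?_⟩
        · have := h1.toReady.set_rand (t := t) (v := v) (by omega)
          refine h1.of_ready (this.of_reg (fun q _ _ => ?_) ?_) (fun q _ _ => ?_)
          · simp only [exec, exec1, Store.setReg_reg, Store.setMem_reg]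
            repeat rw [if_neg (by omega)]
          · funext a
            simp [exec, exec1, BinOp.eval, hi1, h1.randReg]
          · simp only [exec, exec1, Store.setReg_reg, Store.setMem_reg]
            repeat rw [if_neg (by omega)]
        · by_cases hr1 : r₁ < 1
          · simp only [hr1, if_true]
            exact fun _ => ⟨(h2 hr1).1, le_rfl⟩
          · simp [hr1]
  · rintro s₁ r₁ _ _ ⟨R', h1, h2⟩
    refine ⟨R', h1, fun hr1 => ?_⟩
    have := h2 hr1
    rwa [Nat.sub_self] at this

end RAM

namespace NWTInstance

variable (I : NWTInstance)

/-- The set of the living vertices. -/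
def alive (D : ℕ → ℕ) : Finset ℕ := (Finset.range I.n).filter fun a => D a = 0

/-- The number of negative triangles with first vertex in `A`. -/
noncomputable def degSum (A : Finset ℕ) : ℕ := ∑ a ∈ A, I.deg a

open Classical in
/-- The vertices of `A` that form a negative triangle with a chosen pair. -/
noncomputable def hits (A : Finset ℕ) (R : ℕ → ℕ) : Finset ℕ :=
  A.filter fun a => ∃ t ∈ I.nbr a, R t = 0

variable {I}

theorem mem_alive {D : ℕ → ℕ} {a : ℕ} : a ∈ I.alive D ↔ a < I.n ∧ D a = 0 := by
  simp [alive]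

theorem alive_update {D : ℕ → ℕ} {a : ℕ} : I.alive (Function.update D a 1) = (I.alive D).erase a := by
  ext x
  simp only [mem_alive, Finset.mem_erase, Function.update_apply]
  by_cases h : x = a <;> simp [h]

theorem mem_hits {A : Finset ℕ} {R : ℕ → ℕ} {a : ℕ} :
    a ∈ I.hits A R ↔ a ∈ A ∧ ∃ t ∈ I.nbr a, R t = 0 := by
  simp [hits]

theorem hits_erase {A : Finset ℕ} {R : ℕ → ℕ} {a : ℕ} :
    I.hits (A.erase a) R = (I.hits A R).erase a := by
  ext x; simp only [mem_hits, Finset.mem_erase]; tauto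

theorem hit_iff {D R : ℕ → ℕ} : I.Hit D R 0 I.n ↔ (I.hits (I.alive D) R).Nonempty := by
  constructor
  · rintro ⟨a, -, h1, h2, h3⟩
    exact ⟨a, mem_hits.2 ⟨mem_alive.2 ⟨h1, h2⟩, h3⟩⟩
  · rintro ⟨a, ha⟩
    obtain ⟨h1, h3⟩ := mem_hits.1 ha
    exact ⟨a, Nat.zero_le _, (mem_alive.1 h1).1, (mem_alive.1 h1).2, h3⟩

theorem Hit.mem_hits {D R : ℕ → ℕ} {a : ℕ} (ha : a < I.n) (h : I.Hit D R a (a + 1)) :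
    a ∈ I.hits (I.alive D) R := by
  obtain ⟨x, h1, h2, h3, h4⟩ := h
  obtain rfl : x = a := by omega
  exact NWTInstance.mem_hits.2 ⟨mem_alive.2 ⟨ha, h3⟩, h4⟩

theorem degSum_mono {A B : Finset ℕ} (h : A ⊆ B) : I.degSum A ≤ I.degSum B :=
  Finset.sum_le_sum_of_subset h

end NWTInstance

/-! ### One round: removing the vertices that are hit. -/

namespace RAM

variable {m : ℕ} {I : NWTInstance} {p : Par} {D R : ℕ → ℕ} {s s' : Store} {r : ℝ}

/-- Adds the contribution of the vertex in register `31` to register `22` if the vertex is alive,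
and marks it as dead. -/
def killVertex : Program := block [
  .op .add 33 12 31, .load 34 33, .const 35 0, .op .eq 36 34 35, .op .mul 37 32 36,
  .op .mul 37 37 20, .op .add 22 22 37, .const 35 1, .store 33 35]

/-- The quantity `Y` is the current estimate. It is preserved for every vertex `a`, hit or not: a
living vertex moves its exact weighted degree into register `22`, and a dead one contributes
nothing. So wrong answers of the oracle can leave hit vertices behind, but they never falsify the
estimate. -/
theorem wp_killVertex {a w Y : ℕ} (hm : 1 ≤ m) (h : St I p D R s) (ha : a < I.n)
    (h31 : s.reg 31 = a) (h32 : s.reg 32 = I.deg a) (h20 : s.reg 20 = w)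
    (h22 : s.reg 22 + w * I.degSum (I.alive D) = Y) (hY : Y ≤ m) (hd : I.deg a ≤ m)
    (hbm : s.reg 14 ≤ m) :
    WP m killVertex 18 (fun s' r' => r' = r ∧ St I p (Function.update D a 1) R s' ∧
      s'.reg 22 + w * I.degSum (I.alive (Function.update D a 1)) = Y) s r := by
  have e1 := h.hrA
  have e2 := h.hbase
  have hdead := h.dead a ha
  have key : s.reg 22 + (I.deg a * if D a = 0 then 1 else 0) * w +
      w * I.degSum (I.alive (Function.update D a 1)) = Y := by
    rw [← h22, NWTInstance.alive_update]
    by_cases hD : D a = 0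
    · have hmem : a ∈ I.alive D := NWTInstance.mem_alive.2 ⟨ha, hD⟩
      have := Finset.sum_erase_add (I.alive D) I.deg hmem
      rw [NWTInstance.degSum, NWTInstance.degSum, ← this, if_pos hD]
      ring
    · have hmem : a ∉ I.alive D := fun h => hD (NWTInstance.mem_alive.1 h).2
      rw [Finset.erase_eq_of_notMem hmem, if_neg hD]
      ring
  refine WP.block_le hm (by simp) ?_ ?_ (by simp)
  · simp only [Fine, Fine1, exec1, BinOp.eval, Store.setReg_reg, Store.setReg_mem, Nat.reduceEqDiff,
      if_false, if_true, h.deadReg, h31, h32, h20, hdead, true_and, and_true]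
    refine ⟨by omega, by omega, ?_, by omega, by omega, by omega⟩
    split <;> omega
  · refine ⟨rfl, ?_, ?_⟩
    · refine h.of_ready ((h.toReady.set_dead (v := 1) ha).of_reg (fun q _ _ => ?_) ?_)
        (fun q _ _ => ?_)
      · simp only [exec, exec1, Store.setReg_reg, Store.setMem_reg]
        repeat rw [if_neg (by omega)]
      · funext x
        simp [exec, exec1, BinOp.eval, h.deadReg, h31]
      · simp only [exec, exec1, Store.setReg_reg, Store.setMem_reg]
        repeat rw [if_neg (by omega)]
    · simp only [exec, exec1, BinOp.eval, Store.setReg_reg, Store.setReg_mem, Nat.reduceEqDiff,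
        Store.setMem_reg, if_false, if_true, h.deadReg, h31, h32, h20, hdead]
      exact key

/-- Finds a vertex, adds its contribution to register `22`, and marks it as dead. -/
def roundBody (P : Program) (b : ℕ) : Program :=
  .seq (searchProg P b) (.seq (block [.const 35 0, .op .add 31 27 35]) (.seq degProg killVertex))

/-- A random choice of pairs, and the removal of the vertices that form a negative triangle with a
chosen pair. -/
def roundProg (P : Program) (b : ℕ) : Program :=
  .seq (fillProg 6) (forLoop 25 17 (roundBody P b))

theorem writes_roundBody {P : Program} {b q : ℕ} (h : writes (roundBody P b) q) :
    q = 14 ∨ q = 22 ∨ 26 ≤ q := by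
  simp only [roundBody, killVertex, block, writes, or_false] at h
  have h1 := writes_searchProg (P := P) (b := b) (q := q)
  have h2 := writes_degProg (q := q)
  rcases h with h | (h | h) | h | h
  · have := h1 h; omega
  · omega
  · omega
  · have := h2 h; omega
  · omega

theorem writes_roundProg {P : Program} {b q : ℕ} (h : writes (roundProg P b) q) :
    q = 14 ∨ q = 22 ∨ 25 ≤ q := by
  simp only [roundProg, forLoop, block, writes] at h
  have h1 := writes_roundBody (P := P) (b := b) (q := q)
  rcases h with h | (h | h) | h | h | h | h
  · have := writes_fillProg h; omega
  · omega
  · omega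
  · have := h1 h; omega
  all_goals omega

/-- The running time of `roundBody`. -/
def roundBodyTime (I : NWTInstance) (p : Par) : ℕ :=
  searchTime I p.b p.T p.v p.σ + degTime I + 30

theorem wp_roundBody {w Y : ℕ} {ρ : ℝ} (hp : p.Ok m I) (h : St I p D R s)
    (hm : s.reg 14 + p.chunk I + 2 * p.stride I ≤ m) (h20 : s.reg 20 = w)
    (h22 : s.reg 22 + w * I.degSum (I.alive D) = Y) (hY : Y ≤ m) (hρ : 0 ≤ ρ)
    (hr : r < 1 → ρ + p.σ * (8 / 9) ^ p.v ≤ r) :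
    WP m (roundBody p.P p.b) (roundBodyTime I p) (fun s' r' => ∃ a < I.n,
      St I p (Function.update D a 1) R s' ∧ s'.reg 14 = s.reg 14 + p.chunk I ∧
      s'.reg 22 + w * I.degSum (I.alive (Function.update D a 1)) = Y ∧
      (r' < 1 → r < 1 ∧ ρ ≤ r' ∧
        ((I.hits (I.alive D) R).Nonempty → a ∈ I.hits (I.alive D) R))) s r := by
  have hb := h.hbase
  have hn := hp.n_le
  refine WP.seq_le (t' := degTime I + 25) (WP.conseq (wp_searchProg (m := m) (stride := p.stride I) hp.oracle
    (by rw [add_mul, ← Par.chunk]; omega) hp.n_le hp.v_le rfl hp.hn hp.hσ h.toReady h.r18 h.r19 hρ hr)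
    le_rfl ?_) (by rw [roundBodyTime]; omega)
  rintro s₁ r₁ _ f1 ⟨h1, h2, h3, h4⟩
  have g1 : ∀ q, q < 26 → q ≠ 14 → s₁.reg q = s.reg q := fun q hq hq' =>
    f1 q fun h => by have := writes_searchProg h; omega
  have hst1 : St I p D R s₁ := h.of_ready h1 (fun q _ _ => g1 q (by omega) (by omega))
  refine WP.block_seq (t' := degTime I + 19) (by omega) (by simp) ?_ ?_
    (by simp only [List.length_cons, List.length_nil]; omega)
  · simp [Fine, Fine1, exec1]; omega
  set s₂ := exec [.const 35 0, .op .add 31 27 35] s₁ with hs₂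
  have r2 : ∀ q, s₂.reg q = if q = 31 then s₁.reg 27 else if q = 35 then 0 else s₁.reg q := fun q => by
    simp [hs₂, exec, exec1, BinOp.eval]
  have hst2 : St I p D R s₂ := hst1.of_reg (fun q _ _ => by
    rw [r2, if_neg (by omega), if_neg (by omega)]) rfl
  refine WP.seq_le (t' := 18) (WP.conseq (wp_degProg (m := m) h3 hp.len_le hp.base_le hst2.toEnv
    (by rw [r2, if_pos rfl])) le_rfl ?_) (by omega)
  rintro s₃ r₃ _ f3 ⟨k1, k2, rfl⟩
  have g3 : ∀ q, q < 32 → s₃.reg q = s₂.reg q := fun q hq =>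
    f3 q fun h => by have := writes_degProg h; omega
  have hst3 : St I p D R s₃ := hst2.of_reg (fun q _ _ => g3 q (by omega)) k2
  have e : ∀ q, q < 26 → q ≠ 14 → s₃.reg q = s.reg q := fun q hq hq' => by
    rw [g3 q (by omega), r2, if_neg (by omega), if_neg (by omega), g1 q hq hq']
  have e14 : s₃.reg 14 = s.reg 14 + p.chunk I := by
    rw [g3 14 (by omega), r2, if_neg (by omega), if_neg (by omega), h2, Par.chunk]
  refine WP.conseq (wp_killVertex (w := w) (Y := Y) (by omega) hst3 h3
    (by rw [g3 31 (by omega), r2, if_pos rfl])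
    k1 ((e 20 (by omega) (by omega)).trans h20) (by rw [e 22 (by omega) (by omega), h22]) hY
    ((I.deg_le _).trans ?_) (by omega)) le_rfl ?_
  · omega
  · rintro s₄ r₄ _ f4 ⟨rfl, l1, l2⟩
    refine ⟨_, h3, l1, ?_, l2, fun hr1 => ?_⟩
    · rw [f4 14 (by simp [killVertex, block, writes]), e14]
    · obtain ⟨q1, q2, q3⟩ := h4 hr1
      exact ⟨q1, q2, fun hh => (q3 (NWTInstance.hit_iff.2 hh)).mem_hits h3⟩

open Classical in
/-- The value of the potential `Φ` after a round with the random choice `R` if at most `K` vertices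
have to be removed; otherwise the value before. -/
noncomputable def afterRound (I : NWTInstance) (K : ℕ) (Φ : Finset ℕ → ℝ) (A : Finset ℕ)
    (R : ℕ → ℕ) : ℝ :=
  if (I.hits A R).card ≤ K then Φ (A \ I.hits A R) else Φ A

/-- The running time of `roundProg`. -/
def roundTime (I : NWTInstance) (p : Par) : ℕ :=
  I.n * I.n * 14 + p.K * (roundBodyTime I p + 8) + 20

/-- If the searches are correct, each of the `K` repetitions removes a hit vertex as long as there
is one; at most `K` hits are thus removed completely, and possible further removals only decrease
the monotone `Φ`. If there are more than `K` hits, monotonicity alone bounds the potential. The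
random pairs are drawn anew in each round, so the average is taken with the living set before the
round held fixed. -/
theorem wp_roundProg {w Y k : ℕ} (Φ : Finset ℕ → ℝ) (hΦ : Monotone Φ) (hΦ0 : ∀ A, 0 ≤ Φ A)
    (hp : p.Ok m I) (h : St I p D R s)
    (hm : s.reg 14 + p.K * p.chunk I + 2 * p.stride I ≤ m) (h20 : s.reg 20 = w) (hk : 0 < k)
    (h21 : s.reg 21 = k) (h22 : s.reg 22 + w * I.degSum (I.alive D) = Y) (hY : Y ≤ m)
    (hr : r < 1 → avg k (fun R' => afterRound I p.K Φ (I.alive D) R' +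
      p.K * (p.σ * (8 / 9) ^ p.v)) (I.n * I.n) 0 R ≤ r) :
    WP m (roundProg p.P p.b) (roundTime I p) (fun s' r' => ∃ D' R', St I p D' R' s' ∧
      I.alive D' ⊆ I.alive D ∧ s'.reg 14 = s.reg 14 + p.K * p.chunk I ∧
      s'.reg 22 + w * I.degSum (I.alive D') = Y ∧
      (r' < 1 → r < 1 ∧ Φ (I.alive D') ≤ r')) s r := by
  classical
  set η : ℝ := p.σ * (8 / 9) ^ p.v with hη
  have hη0 : 0 ≤ η := by positivity
  have hn := hp.n_le
  refine WP.seq_le (t' := p.K * (roundBodyTime I p + 8) + 6) (WP.conseq (wp_fillProg _ (by omega) h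
    (by omega) h.nn le_rfl hk h21 (by omega) hr) le_rfl ?_) (by rw [roundTime]; omega)
  rintro s₁ r₁ _ f1 ⟨R', h1, h2⟩
  have g1 : ∀ q, q < 33 → s₁.reg q = s.reg q := fun q hq =>
    f1 q fun h => by have := writes_fillProg h; omega
  refine WP.conseq (WP.forLoop (n := p.K) (tb := roundBodyTime I p) (fun t s' r' => ∃ D',
    St I p D' R' s' ∧ I.alive D' ⊆ I.alive D ∧ s'.reg 14 = s.reg 14 + t * p.chunk I ∧
    s'.reg 22 + w * I.degSum (I.alive D') = Y ∧ s'.reg 20 = w ∧ (r' < 1 → r < 1 ∧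
      afterRound I p.K Φ (I.alive D) R' + ((p.K - t : ℕ) : ℝ) * η ≤ r' ∧
      ((I.hits (I.alive D) R').card ≤ p.K → (I.hits (I.alive D') R').card ≤ p.K - t)))
    (by omega) h1.r17 (by omega) (by omega) (by omega)
    (fun h => by have := writes_roundBody h; omega)
    (fun h => by have := writes_roundBody h; omega) ?_ ?_) le_rfl ?_
  · intro v'
    refine ⟨D, h1.of_reg (fun q _ _ => ?_) rfl, subset_rfl, ?_, ?_, ?_, ?_⟩
    · rw [Store.setReg_reg, if_neg (by omega), Store.setReg_reg, if_neg (by omega)]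
    · simp [g1]
    · simpa [g1] using h22
    · simpa [g1] using h20
    · intro hr1
      exact ⟨(h2 hr1).1, (h2 hr1).2, fun h => h⟩
  · rintro t ht s₂ r₂ _ f2 hi2 ⟨D', k1, k2, k3, k4, k5, k6⟩
    have hts : (t + 1) * p.chunk I ≤ p.K * p.chunk I := Nat.mul_le_mul_right _ (by omega)
    have hafter : 0 ≤ afterRound I p.K Φ (I.alive D) R' := by
      unfold afterRound; split <;> exact hΦ0 _
    refine WP.conseq (wp_roundBody (ρ := afterRound I p.K Φ (I.alive D) R' +
      ((p.K - (t + 1) : ℕ) : ℝ) * η) hp k1 (by rw [k3]; linarith) k5 k4 hY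
      (by positivity) ?_) le_rfl ?_
    · intro hr1
      refine le_trans (le_of_eq ?_) (k6 hr1).2.1
      rw [show p.K - t = p.K - (t + 1) + 1 by omega]
      push_cast; rw [← hη]; ring
    · rintro s₃ r₃ _ f3 ⟨a, ha, l1, l2, l3, l4⟩ v'
      refine ⟨_, l1.of_reg (fun q _ _ => ?_) rfl, ?_, ?_, ?_, ?_, ?_⟩
      · simp only [Store.setReg_reg]
        repeat rw [if_neg (by omega)]
      · rw [NWTInstance.alive_update]
        exact (Finset.erase_subset _ _).trans k2
      · simp [l2, k3]; ring
      · simpa using l3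
      · simp [f3 20 fun h => by have := writes_roundBody h; omega, k5]
      · intro hr3
        obtain ⟨q1, q2, q3⟩ := l4 hr3
        refine ⟨(k6 q1).1, q2, fun hc => ?_⟩
        have hc' := (k6 q1).2.2 hc
        rw [NWTInstance.alive_update, NWTInstance.hits_erase]
        rcases (I.hits (I.alive D') R').eq_empty_or_nonempty with he | he
        · rw [he]; simp
        · rw [Finset.card_erase_of_mem (q3 he)]; omega
  · rintro s₂ r₂ _ f2 ⟨D', k1, k2, k3, k4, k5, k6⟩
    refine ⟨D', R', k1, k2, k3, k4, fun hr2 => ?_⟩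
    obtain ⟨q1, q2, q3⟩ := k6 hr2
    refine ⟨q1, le_trans ?_ q2⟩
    simp only [Nat.sub_self, Nat.cast_zero, zero_mul, add_zero]
    rw [afterRound]
    split_ifs with hc
    · refine hΦ fun a ha => Finset.mem_sdiff.2 ⟨k2 ha, fun hh => ?_⟩
      have he : I.hits (I.alive D') R' = ∅ := by
        rw [← Finset.card_eq_zero]
        have := q3 hc
        omega
      have : a ∈ I.hits (I.alive D') R' :=
        NWTInstance.mem_hits.2 ⟨ha, (NWTInstance.mem_hits.1 hh).2⟩
      rw [he] at this
      simp at this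
    · exact hΦ k2

end RAM

/-! ### Halving, levels, and the main loop. -/

namespace RAM

variable {m : ℕ} {I : NWTInstance} {p : Par} {D R : ℕ → ℕ} {s s' : Store} {r : ℝ}

/-- A vertex dies if its random number is not `0`. -/
def halveBody : Program := block [
  .op .add 34 12 33, .load 35 34, .op .add 36 13 33, .load 36 36, .const 37 0, .op .eq 35 35 37,
  .op .eq 36 36 37, .op .mul 35 35 36, .op .eq 35 35 37, .store 34 35]

/-- Every vertex dies with probability `1 / 2`, and the number in register `20` is doubled. -/
def halveProg : Program :=
  .seq (.const 21 2) (.seq (fillProg 3) (.seq (forLoop 33 3 halveBody) (.op .add 20 20 20)))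

theorem writes_halveProg {q : ℕ} (h : writes halveProg q) : q = 20 ∨ q = 21 ∨ 33 ≤ q := by
  simp [halveProg, halveBody, fillProg, forLoop, block, writes] at h; omega

/-- The vertices of `A` whose random number is `0`. -/
def thin (A : Finset ℕ) (R : ℕ → ℕ) : Finset ℕ := A.filter fun a => R a = 0

/-- The running time of `halveProg`. -/
def halveTime (I : NWTInstance) : ℕ := I.n * 42 + 20

theorem wp_halveProg {w : ℕ} (Θ : Finset ℕ → ℝ) (hp : p.Ok m I) (h : St I p D R s)
    (hm : s.reg 14 ≤ m) (h20 : s.reg 20 = w) (hw : 2 * w ≤ m)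
    (hr : r < 1 → avg 2 (fun R' => Θ (thin (I.alive D) R')) I.n 0 R ≤ r) :
    WP m halveProg (halveTime I) (fun s' r' => ∃ D' R', St I p D' R' s' ∧
      I.alive D' ⊆ I.alive D ∧ s'.reg 20 = 2 * w ∧ s'.reg 14 = s.reg 14 ∧ s'.reg 22 = s.reg 22 ∧
      (r' < 1 → r < 1 ∧ Θ (I.alive D') ≤ r')) s r := by
  have hn := hp.n_le
  have hn0 := hp.hn
  have hnn : I.n ≤ I.n * I.n := Nat.le_mul_self _
  refine WP.seq_le (t' := I.n * 42 + 18) (WP.const (by omega) ?_) (by rw [halveTime]; omega)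
  have h0 : St I p D R (s.setReg 21 2) := h.of_ready
    (h.toReady.of_reg (fun q _ _ => by rw [Store.setReg_reg, if_neg (by omega)]) rfl)
    (fun q _ _ => by rw [Store.setReg_reg, if_neg (by omega)])
  refine WP.seq_le (t' := I.n * 28 + 8) (WP.conseq (wp_fillProg (k := 2) _ (by omega) h0 (by omega)
    h0.n hnn (by omega) (by simp) (by simpa using hm) hr) le_rfl ?_) (by omega)
  rintro s₁ r₁ _ f1 ⟨R', h1, h2⟩
  have g1 : ∀ q, q < 21 ∨ q = 22 → s₁.reg q = s.reg q := fun q hq => by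
    rw [f1 q fun h => by have := writes_fillProg h; omega, Store.setReg_reg, if_neg (by omega)]
  let DD : ℕ → ℕ → ℕ := fun t x => if x < t then (if D x = 0 ∧ R' x = 0 then 0 else 1) else D x
  refine WP.seq_le (t' := 1) (WP.conseq (WP.forLoop (n := I.n) (tb := 20) (fun t s' r' =>
    St I p (DD t) R' s' ∧ r' = r₁) (by omega) h1.n (by omega) (by omega) (by omega)
      (by simp [halveBody, block, writes]) (by simp [halveBody, block, writes]) ?_ ?_)
      le_rfl ?_) (by omega)
  · intro v
    have : DD 0 = D := by funext x; simp [DD]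
    rw [this]
    refine ⟨h1.of_reg (fun q _ _ => ?_) rfl, rfl⟩
    rw [Store.setReg_reg, if_neg (by omega), Store.setReg_reg, if_neg (by omega)]
  · rintro t ht s₂ r₂ _ f2 hi2 ⟨k1, rfl⟩
    have e0 := k1.hdA
    have e1 := k1.hrA
    have e2 := k1.hbase
    have e3 := k1.dead t ht
    have e4 := k1.rand t (by omega)
    have e14 : s₂.reg 14 = s.reg 14 := by
      rw [f2 14 fun h => by simp [halveBody, forLoop, block, writes] at h, g1 14 (by omega)]
    refine WP.block_le (by omega) (by simp) ?_ ?_ (by simp)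
    · simp only [Fine, Fine1, exec1, BinOp.eval, Store.setReg_reg, Store.setReg_mem,
        Nat.reduceEqDiff, if_false, if_true, k1.deadReg, k1.randReg, hi2, e3, e4, ite_mul_ite,
        true_and, and_true]
      refine ⟨by omega, by omega, by omega, ?_⟩
      split <;> omega
    · intro v
      refine ⟨?_, rfl⟩
      have e5 : DD (t + 1) = Function.update (DD t) t (if D t = 0 ∧ R' t = 0 then 0 else 1) := by
        funext x
        simp only [DD, Function.update_apply]
        by_cases hx : x = t
        · subst hx; simp
        · rw [if_neg hx]
          exact if_congr (by omega) rfl rfl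
      rw [e5]
      have e6 : DD t t = D t := by simp [DD]
      rw [e6] at e3
      refine k1.of_ready ((k1.toReady.set_dead ht).of_reg (fun q _ _ => ?_) ?_) (fun q _ _ => ?_)
      · simp only [exec, exec1, Store.setReg_reg, Store.setMem_reg]
        repeat rw [if_neg (by omega)]
      · funext x
        simp only [exec, exec1, BinOp.eval, Store.setReg_reg, Store.setReg_mem, Store.setMem_mem,
          Nat.reduceEqDiff, if_false, if_true, k1.deadReg, k1.randReg, hi2, e3, e4, ite_mul_ite,
          ite_eq_zero_ite]
        by_cases hd : D t = 0 ∧ R' t = 0 <;> simp [hd]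
      · simp only [exec, exec1, Store.setReg_reg, Store.setMem_reg]
        repeat rw [if_neg (by omega)]
  · rintro s₂ r₂ _ f2 ⟨k1, rfl⟩
    have g2 : ∀ q, q < 21 ∨ q = 22 → s₂.reg q = s.reg q := fun q hq => by
      rw [f2 q fun h => by simp [halveBody, forLoop, block, writes] at h; omega, g1 q hq]
    have e20 : s₂.reg 20 = w := (g2 20 (by omega)).trans h20
    have ealive : I.alive (DD I.n) = thin (I.alive D) R' := by
      ext x
      simp only [NWTInstance.mem_alive, thin, Finset.mem_filter, DD]
      constructor
      · rintro ⟨q1, q2⟩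
        rw [if_pos q1] at q2
        by_cases hd : D x = 0 ∧ R' x = 0
        · exact ⟨⟨q1, hd.1⟩, hd.2⟩
        · simp [hd] at q2
      · rintro ⟨⟨q1, q2⟩, q3⟩
        exact ⟨q1, by simp [q1, q2, q3]⟩
    refine WP.op (by simp only [BinOp.eval, e20]; omega) ?_
    refine ⟨_, R', k1.of_ready (k1.toReady.of_reg (fun q _ _ => ?_) rfl) (fun q _ _ => ?_), ?_, ?_,
      ?_, ?_, ?_⟩
    · rw [Store.setReg_reg, if_neg (by omega)]
    · rw [Store.setReg_reg, if_neg (by omega)]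
    · rw [ealive]; exact Finset.filter_subset _ _
    · simp [BinOp.eval, e20]; omega
    · simp [g2]
    · simp [g2]
    · rw [ealive]; exact h2

/-- One level: rounds with decreasing probabilities, then halving. -/
def levelProg (P : Program) (b : ℕ) : Program :=
  .seq (.const 21 1) (.seq (forLoop 24 16 (.seq (roundProg P b) (.op .add 21 21 21))) halveProg)

theorem writes_levelProg {P : Program} {b q : ℕ} (h : writes (levelProg P b) q) :
    q = 14 ∨ 20 ≤ q ∧ q ≠ 23 := by
  simp only [levelProg, forLoop, block, writes] at h
  have h1 := writes_roundProg (P := P) (b := b) (q := q)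
  rcases h with h | ((h | h) | ((h | h) | h | h | h)) | h
  on_goal 4 => have := h1 h
  on_goal 9 => have := writes_halveProg h
  all_goals omega

/-- The running time of `levelProg`. -/
def levelTime (I : NWTInstance) (p : Par) : ℕ := p.J * (roundTime I p + 10) + halveTime I + 20

/-- All rounds of a level preserve the estimate `Y`, so in `hlast` the counted part `z` is
determined by the living set. Only the final halving changes the estimate at random. -/
theorem wp_levelProg {w Y : ℕ} (Φ : ℕ → Finset ℕ → ℝ) (Θ : ℕ → Finset ℕ → ℝ)
    (hΦ : ∀ j, Monotone (Φ j)) (hΦ0 : ∀ j A, 0 ≤ Φ j A)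
    (hp : p.Ok m I) (h : St I p D R s)
    (hm : s.reg 14 + p.J * (p.K * p.chunk I) + 2 * p.stride I ≤ m) (h20 : s.reg 20 = w)
    (h22 : s.reg 22 + w * I.degSum (I.alive D) = Y) (hY : Y ≤ m) (hw : 2 * w ≤ m)
    (hJ : 2 ^ p.J ≤ m) (hr : r < 1 → Φ 0 (I.alive D) ≤ r)
    (hstep : ∀ j < p.J, ∀ A ⊆ I.alive D, ∀ R, avg (2 ^ j) (fun R' => afterRound I p.K (Φ (j + 1))
      A R' + p.K * (p.σ * (8 / 9) ^ p.v)) (I.n * I.n) 0 R ≤ Φ j A)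
    (hlast : ∀ A ⊆ I.alive D, ∀ z, z + w * I.degSum A = Y → ∀ R,
      avg 2 (fun R' => Θ z (thin A R')) I.n 0 R ≤ Φ p.J A) :
    WP m (levelProg p.P p.b) (levelTime I p) (fun s' r' => ∃ D' R', St I p D' R' s' ∧
      s'.reg 14 = s.reg 14 + p.J * (p.K * p.chunk I) ∧ s'.reg 20 = 2 * w ∧
      s'.reg 22 + w * I.degSum (I.alive D') ≤ Y ∧ I.alive D' ⊆ I.alive D ∧
      (r' < 1 → r < 1 ∧ Θ (s'.reg 22) (I.alive D') ≤ r')) s r := by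
  have hn := hp.n_le
  refine WP.seq_le (t' := p.J * (roundTime I p + 2 + 8) + 6 + halveTime I + 1) (WP.const (by omega) ?_)
    (by rw [levelTime]; linarith)
  have h0 : St I p D R (s.setReg 21 1) := h.of_ready
    (h.toReady.of_reg (fun q _ _ => by rw [Store.setReg_reg, if_neg (by omega)]) rfl)
    (fun q _ _ => by rw [Store.setReg_reg, if_neg (by omega)])
  refine WP.seq_le (t' := halveTime I) (WP.conseq (WP.forLoop (n := p.J) (tb := roundTime I p + 2)
    (fun j s' r' => ∃ D' R', St I p D' R' s' ∧ I.alive D' ⊆ I.alive D ∧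
      s'.reg 14 = s.reg 14 + j * (p.K * p.chunk I) ∧
      s'.reg 22 + w * I.degSum (I.alive D') = Y ∧ s'.reg 20 = w ∧ s'.reg 21 = 2 ^ j ∧
      (r' < 1 → r < 1 ∧ Φ j (I.alive D') ≤ r')) (by omega) h0.r16 (by omega) (by omega) (by omega)
      ?_ ?_ ?_ ?_) le_rfl ?_) (by omega)
  · rintro (h | h)
    · have := writes_roundProg h; omega
    · simp [writes] at h
  · rintro (h | h)
    · have := writes_roundProg h; omega
    · simp [writes] at h
  · intro v
    refine ⟨D, R, h0.of_reg (fun q _ _ => ?_) rfl, subset_rfl, ?_, ?_, ?_, ?_, fun hr1 => ⟨hr1, hr hr1⟩⟩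
    · rw [Store.setReg_reg, if_neg (by omega), Store.setReg_reg, if_neg (by omega)]
    all_goals simp [h20, h22]
  · rintro j hj s₁ r₁ _ f1 hi1 ⟨D', R', k1, k2, k3, k4, k5, k6, k7⟩
    have hjs : (j + 1) * (p.K * p.chunk I) ≤ p.J * (p.K * p.chunk I) := Nat.mul_le_mul_right _ (by omega)
    have hpow : 2 ^ (j + 1) ≤ m := (Nat.pow_le_pow_right (by norm_num) (by omega)).trans hJ
    refine WP.seq_le (t' := 1) (WP.conseq (wp_roundProg (Φ (j + 1)) (hΦ _) (hΦ0 _) hp k1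
      (by rw [k3]; linarith) k5 (by positivity) k6 k4 hY
      (fun hr1 => (hstep j hj _ k2 R').trans (k7 hr1).2)) le_rfl ?_) (by omega)
    rintro s₂ r₂ _ f2 ⟨D'', R'', l1, l2, l3, l4, l5⟩
    have g2 : ∀ q, q < 22 → q ≠ 14 → s₂.reg q = s₁.reg q := fun q hq hq' =>
      f2 q fun h => by have := writes_roundProg h; omega
    have e21 : s₂.reg 21 = 2 ^ j := (g2 21 (by omega) (by omega)).trans k6
    refine WP.op (by simp only [BinOp.eval, e21]; rw [← two_mul, ← pow_succ']; exact hpow) ?_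
    intro v
    refine ⟨D'', R'', l1.of_reg (fun q _ _ => ?_) rfl, l2.trans k2, ?_, ?_, ?_, ?_, ?_⟩
    · simp only [Store.setReg_reg]
      repeat rw [if_neg (by omega)]
    · simp [l3, k3]; ring
    · simpa using l4
    · simp [g2, k5]
    · simp [BinOp.eval, e21, pow_succ]; ring
    · intro hr2
      exact ⟨(k7 (l5 hr2).1).1, (l5 hr2).2⟩
  · rintro s₁ r₁ _ f1 ⟨D', R', k1, k2, k3, k4, k5, k6, k7⟩
    refine WP.conseq (wp_halveProg (w := w) (Θ (s₁.reg 22)) hp k1 (by omega) k5 hw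
      (fun hr1 => (hlast _ k2 _ k4 R').trans (k7 hr1).2)) le_rfl ?_
    rintro s₂ r₂ _ f2 ⟨D'', R'', l1, l2, l3, l4, l5, l6⟩
    refine ⟨D'', R'', l1, by rw [l4, k3], l3, ?_, l2.trans k2, fun hr2 => ?_⟩
    · rw [l5, ← k4]
      have := NWTInstance.degSum_mono (I := I) l2
      gcongr
    · rw [l5]
      exact ⟨(k7 (l6 hr2).1).1, (l6 hr2).2⟩

/-- The main loop of the counting algorithm. -/
def mainLoop (P : Program) (b : ℕ) : Program := forLoop 23 15 (levelProg P b)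

/-- A system of potentials for the main loop: `Θ i z A` bounds the probability of failure if before
level `i` the sum is `z` and the set of the living vertices is `A`. -/
def IsPotential (I : NWTInstance) (p : Par) (Θ : ℕ → ℕ → Finset ℕ → ℝ) : Prop :=
  ∀ i < p.L, ∀ z A, A ⊆ Finset.range I.n →
    z + 2 ^ i * I.degSum A ≤ 2 ^ i * I.degSum (Finset.range I.n) →
    ∃ Φ : ℕ → Finset ℕ → ℝ, (∀ j, Monotone (Φ j)) ∧ (∀ j A, 0 ≤ Φ j A) ∧ Φ 0 A ≤ Θ i z A ∧
      (∀ j < p.J, ∀ A' ⊆ A, ∀ R, avg (2 ^ j) (fun R' => afterRound I p.K (Φ (j + 1))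
        A' R' + p.K * (p.σ * (8 / 9) ^ p.v)) (I.n * I.n) 0 R ≤ Φ j A') ∧
      (∀ A' ⊆ A, ∀ z', z' + 2 ^ i * I.degSum A' = z + 2 ^ i * I.degSum A → ∀ R,
        avg 2 (fun R' => Θ (i + 1) z' (thin A' R')) I.n 0 R ≤ Φ p.J A')

theorem alive_subset : I.alive D ⊆ Finset.range I.n := Finset.filter_subset _ _

/-- Apart from the potential, the invariant carries a crude inequality that holds whatever the
random choices are. It bounds the numbers in the registers, and it forces `z = 0` if there is no
negative triangle. -/
theorem wp_mainLoop {Θ : ℕ → ℕ → Finset ℕ → ℝ} (hΘ : IsPotential I p Θ) (hp : p.Ok m I)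
    (h : St I p D R s)
    (hm : s.reg 14 + p.L * (p.J * (p.K * p.chunk I)) + 2 * p.stride I ≤ m) (h20 : s.reg 20 = 1)
    (h22 : s.reg 22 = 0) (hY : 2 ^ p.L * I.degSum (Finset.range I.n) ≤ m) (hL : 2 ^ p.L ≤ m)
    (hJ : 2 ^ p.J ≤ m) (hr : Θ 0 0 (I.alive D) ≤ r) :
    WP m (mainLoop p.P p.b) (p.L * (levelTime I p + 8) + 6) (fun s' r' => ∃ A,
      s'.reg 22 + 2 ^ p.L * I.degSum A ≤ 2 ^ p.L * I.degSum (Finset.range I.n) ∧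
      A ⊆ Finset.range I.n ∧ s'.reg 22 ≤ m ∧
      (r' < 1 → Θ p.L (s'.reg 22) A ≤ r')) s r := by
  have hn := hp.n_le
  refine WP.conseq (WP.forLoop (n := p.L) (tb := levelTime I p) (fun i s' r' => ∃ D' R',
    St I p D' R' s' ∧ s'.reg 14 = s.reg 14 + i * (p.J * (p.K * p.chunk I)) ∧ s'.reg 20 = 2 ^ i ∧
    s'.reg 22 + 2 ^ i * I.degSum (I.alive D') ≤ 2 ^ i * I.degSum (Finset.range I.n) ∧
    (r' < 1 → Θ i (s'.reg 22) (I.alive D') ≤ r')) (by omega) h.r15 (by omega) (by omega) (by omega)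
    (fun h => by have := writes_levelProg h; omega)
    (fun h => by have := writes_levelProg h; omega) ?_ ?_) le_rfl ?_
  · intro v
    refine ⟨D, R, h.of_reg (fun q _ _ => ?_) rfl, by simp, by simpa using h20, ?_, ?_⟩
    · rw [Store.setReg_reg, if_neg (by omega), Store.setReg_reg, if_neg (by omega)]
    · simp [h22]
      exact NWTInstance.degSum_mono alive_subset
    · intro _
      simpa [h22] using hr
  · rintro i hi s₁ r₁ _ f1 hi1 ⟨D', R', k1, k2, k3, k4, k5⟩
    have his : (i + 1) * (p.J * (p.K * p.chunk I)) ≤ p.L * (p.J * (p.K * p.chunk I)) :=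
      Nat.mul_le_mul_right _ (by omega)
    obtain ⟨Φ, hΦ, hΦ0, h0, hstep, hlast⟩ := hΘ i hi _ _ alive_subset k4
    have hpow : 2 ^ (i + 1) ≤ 2 ^ p.L := Nat.pow_le_pow_right (by norm_num) (by omega)
    have hYm : s₁.reg 22 + 2 ^ i * I.degSum (I.alive D') ≤ m := by
      refine k4.trans (le_trans ?_ hY)
      exact Nat.mul_le_mul_right _ (Nat.pow_le_pow_right (by norm_num) (by omega))
    refine WP.conseq (wp_levelProg Φ (Θ (i + 1)) hΦ hΦ0 hp k1 (by rw [k2]; linarith) k3 rfl hYm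
      (by rw [← pow_succ']; omega) hJ (fun hr1 => h0.trans (k5 hr1)) hstep hlast) le_rfl ?_
    rintro s₂ r₂ _ f2 ⟨D'', R'', l1, l2, l3, l4, l5, l6⟩ v
    refine ⟨D'', R'', l1.of_reg (fun q _ _ => ?_) rfl, ?_, ?_, ?_, ?_⟩
    · simp only [Store.setReg_reg]
      repeat rw [if_neg (by omega)]
    · simp [l2, k2]; ring
    · simp [l3, pow_succ]; ring
    · simp only [Store.setReg_reg, Nat.reduceEqDiff, if_false]
      -- The weight doubles, but at most `2 ^ i * e` of weighted degree is alive, so the estimate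
      -- grows by at most that amount.
      rw [pow_succ, mul_assoc, mul_assoc, mul_left_comm, mul_left_comm _ 2]
      have h2 : 2 ^ i * I.degSum (I.alive D'') ≤ 2 ^ i * I.degSum (I.alive D') :=
        Nat.mul_le_mul_left _ (NWTInstance.degSum_mono l5)
      omega
    · intro hr2
      simpa using (l6 hr2).2
  · rintro s₁ r₁ hs₁ _ ⟨D', R', k1, k2, k3, k4, k5⟩
    exact ⟨I.alive D', k4, alive_subset, hs₁.1 22, k5⟩

end RAM

/-! ### Moments of the random choices. -/

namespace RAM

section avg

variable {k : ℕ} {F G : (ℕ → ℕ) → ℝ}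

theorem avg_mono_of {j t : ℕ} {f : ℕ → ℕ} (h : ∀ R : ℕ → ℕ, (∀ x < t, R x = f x) → F R ≤ G R) :
    avg k F j t f ≤ avg k G j t f := by
  induction j generalizing t f with
  | zero => exact h f fun _ _ => rfl
  | succ j ih =>
    refine div_le_div_of_nonneg_right (Finset.sum_le_sum fun v _ => ih fun R hR => h R fun x hx => ?_)
      (Nat.cast_nonneg _)
    rw [hR x (by omega), Function.update_of_ne (by omega)]

theorem avg_mono {j t : ℕ} {f : ℕ → ℕ} (h : ∀ R, F R ≤ G R) : avg k F j t f ≤ avg k G j t f :=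
  avg_mono_of fun R _ => h R

theorem avg_congr_of {j t : ℕ} {f : ℕ → ℕ} (h : ∀ R : ℕ → ℕ, (∀ x < t, R x = f x) → F R = G R) :
    avg k F j t f = avg k G j t f :=
  le_antisymm (avg_mono_of fun R hR => (h R hR).le) (avg_mono_of fun R hR => (h R hR).ge)

theorem avg_const (hk : 0 < k) (c : ℝ) {j t : ℕ} {f : ℕ → ℕ} : avg k (fun _ => c) j t f = c := by
  have : (k : ℝ) ≠ 0 := by positivity
  induction j generalizing t f with
  | zero => rfl
  | succ j ih => rw [avg]; simp only [ih]; simp; field_simp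

theorem avg_add {j t : ℕ} {f : ℕ → ℕ} :
    avg k (fun R => F R + G R) j t f = avg k F j t f + avg k G j t f := by
  induction j generalizing t f with
  | zero => rfl
  | succ j ih => simp only [avg, ih, Finset.sum_add_distrib, add_div]

theorem avg_const_mul (c : ℝ) {j t : ℕ} {f : ℕ → ℕ} :
    avg k (fun R => c * F R) j t f = c * avg k F j t f := by
  induction j generalizing t f with
  | zero => rfl
  | succ j ih => simp only [avg, ih, ← Finset.mul_sum, mul_div_assoc]

theorem avg_sum {ι : Type*} (hk : 0 < k) (S : Finset ι) (F : ι → (ℕ → ℕ) → ℝ) {j t : ℕ} {f : ℕ → ℕ} :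
    avg k (fun R => ∑ a ∈ S, F a R) j t f = ∑ a ∈ S, avg k (F a) j t f := by
  classical
  induction S using Finset.induction_on with
  | empty => simp [avg_const hk]
  | insert a S ha ih => simp only [Finset.sum_insert ha, avg_add, ih]

/-- The probability that no entry with index in `S` is `0`. -/
theorem avg_forall_ne_zero (hk : 0 < k) (S : Finset ℕ) {j t : ℕ} {f : ℕ → ℕ}
    (hS : S ⊆ Finset.Ico t (t + j)) :
    avg k (fun R => if ∀ x ∈ S, R x ≠ 0 then 1 else 0) j t f = (1 - 1 / (k : ℝ)) ^ S.card := by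
  have hk' : (k : ℝ) ≠ 0 := by positivity
  induction j generalizing t f S with
  | zero =>
    obtain rfl : S = ∅ := by simpa using hS
    simp [avg]
  | succ j ih =>
    rw [avg]
    have hS' : S.erase t ⊆ Finset.Ico (t + 1) (t + 1 + j) := fun x hx => by
      have h1 := Finset.mem_erase.1 hx
      have h2 := Finset.mem_Ico.1 (hS h1.2)
      exact Finset.mem_Ico.2 (by omega)
    by_cases ht : t ∈ S
    · have key : ∀ v, avg k (fun R => if ∀ x ∈ S, R x ≠ 0 then (1 : ℝ) else 0) j (t + 1)
          (Function.update f t v) = if v = 0 then 0 else (1 - 1 / (k : ℝ)) ^ (S.erase t).card := by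
        intro v
        rw [← ih (S.erase t) (f := Function.update f t v) hS']
        by_cases hv : v = 0
        · rw [if_pos hv]
          refine (avg_congr_of fun R hR => if_neg fun (h : ∀ x ∈ S, R x ≠ 0) => h t ht ?_).trans
            (avg_const hk 0)
          rw [hR t (by omega)]; simpa
        · rw [if_neg hv]
          refine avg_congr_of fun R hR => if_congr ⟨fun h x hx => h x (Finset.mem_of_mem_erase hx),
            fun h x hx => ?_⟩ rfl rfl
          by_cases hxt : x = t
          · rw [hxt, hR t (by omega)]; simpa
          · exact h x (Finset.mem_erase.2 ⟨hxt, hx⟩)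
      obtain ⟨k, rfl⟩ : ∃ l, k = l + 1 := ⟨k - 1, by omega⟩
      -- Of the `k` values of the entry `t`, the value 0 contributes nothing and the other `k - 1`
      -- contribute equally, which gives the factor `1 - 1 / k`.
      simp only [key]
      rw [Finset.sum_range_succ', ← Finset.card_erase_add_one ht, pow_succ]
      simp
      push_cast at hk'
      field_simp
      ring
    · rw [Finset.erase_eq_of_notMem ht] at hS'
      simp only [ih S hS']
      simp; field_simp

/-- The second moment of a sum of independent random signs. -/
theorem avg_sq_signs (w : ℕ → ℝ) (c : ℝ) {j t : ℕ} {f : ℕ → ℕ} :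
    avg 2 (fun R => (c + ∑ a ∈ Finset.Ico t (t + j), w a * (if R a = 0 then 1 else -1)) ^ 2) j t f
      = c ^ 2 + ∑ a ∈ Finset.Ico t (t + j), w a ^ 2 := by
  induction j generalizing t f c with
  | zero => simp [avg]
  | succ j ih =>
    have key : ∀ v, avg 2 (fun R => (c + ∑ a ∈ Finset.Ico t (t + (j + 1)),
        w a * (if R a = 0 then 1 else -1)) ^ 2) j (t + 1) (Function.update f t v) =
        (c + w t * (if v = 0 then 1 else -1)) ^ 2 + ∑ a ∈ Finset.Ico (t + 1) (t + 1 + j), w a ^ 2 := by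
      intro v
      rw [← ih (f := Function.update f t v)]
      refine avg_congr_of fun R hR => ?_
      rw [Finset.sum_eq_sum_Ico_succ_bot (by omega), hR t (by omega), Function.update_self,
        show t + (j + 1) = t + 1 + j by omega, ← add_assoc]
    rw [avg, Finset.sum_eq_sum_Ico_succ_bot (by omega)]
    simp only [key, Finset.sum_range_succ, Finset.sum_range_zero]
    rw [show t + (j + 1) = t + 1 + j by omega]
    push_cast
    norm_num
    ring

end avg

variable {I : NWTInstance} {A : Finset ℕ} {R : ℕ → ℕ}

theorem nbr_subset {a : ℕ} : I.nbr a ⊆ Finset.Ico 0 (0 + I.n * I.n) := fun x hx => by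
  classical
  simp only [NWTInstance.nbr, Finset.mem_filter, Finset.mem_range] at hx
  simpa using hx.1

/-- The probability that a vertex is not hit. -/
theorem avg_notMem_hits {k a : ℕ} (hk : 0 < k) (ha : a ∈ A) :
    avg k (fun R => if a ∈ I.hits A R then 0 else 1) (I.n * I.n) 0 R =
      (1 - 1 / (k : ℝ)) ^ I.deg a := by
  rw [NWTInstance.deg, ← avg_forall_ne_zero hk _ nbr_subset (f := R)]
  refine avg_congr_of fun R _ => ?_
  have : a ∈ I.hits A R ↔ ¬ ∀ x ∈ I.nbr a, R x ≠ 0 := by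
    rw [NWTInstance.mem_hits]
    push Not
    exact ⟨fun h => h.2, fun h => ⟨ha, h⟩⟩
  rw [if_congr this rfl rfl, ite_not]

/-- Bernoulli's inequality for `(1 + 1 / (k - 1)) ^ d`, since `1 + 1 / (k - 1)` is the inverse of `1
- 1 / k`. The bound does not depend on `d`: a vertex of large degree is unlikely to be missed. -/
theorem mul_pow_le {k : ℕ} (hk : 0 < k) (d : ℕ) : (d : ℝ) * (1 - 1 / (k : ℝ)) ^ d ≤ k - 1 := by
  rcases Nat.eq_or_lt_of_le (show 1 ≤ k from hk) with rfl | hk1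
  · rcases d with - | d <;> simp
  · have h1 : (1 : ℝ) < k := by exact_mod_cast hk1
    have h2 : (0 : ℝ) < k - 1 := by linarith
    have h3 := one_add_mul_le_pow (a := 1 / ((k : ℝ) - 1)) (by
      have : 0 < 1 / ((k : ℝ) - 1) := by positivity
      linarith) d
    have h4 : (1 - 1 / (k : ℝ)) ^ d * (1 + 1 / ((k : ℝ) - 1)) ^ d = 1 := by
      rw [← mul_pow]
      have : (1 - 1 / (k : ℝ)) * (1 + 1 / ((k : ℝ) - 1)) = 1 := by
        have : (k : ℝ) ≠ 0 := by positivity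
        field_simp; ring
      rw [this, one_pow]
    have h5 : 0 ≤ 1 - 1 / (k : ℝ) := by
      rw [sub_nonneg, div_le_one (by linarith)]; exact h1.le
    have h6 := mul_le_mul_of_nonneg_left h3 (pow_nonneg h5 d)
    rw [h4] at h6
    have h7 : (1 - 1 / (k : ℝ)) ^ d * (d * (1 / ((k : ℝ) - 1))) ≤ 1 := by
      have := pow_nonneg h5 d
      linarith
    have h8 : (d : ℝ) * (1 - 1 / (k : ℝ)) ^ d =
        (1 - 1 / (k : ℝ)) ^ d * (d * (1 / ((k : ℝ) - 1))) * (k - 1) := by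
      field_simp
    rw [h8]
    nlinarith

/-- The expected sum of the squares of the degrees of the vertices that are not hit. -/
theorem avg_sum_sq_sdiff_hits {k : ℕ} (hk : 0 < k) :
    avg k (fun R => ∑ a ∈ A \ I.hits A R, (I.deg a : ℝ) ^ 2) (I.n * I.n) 0 R ≤
      I.degSum A * (k - 1) := by
  have : ∀ R, ∑ a ∈ A \ I.hits A R, (I.deg a : ℝ) ^ 2 =
      ∑ a ∈ A, (I.deg a : ℝ) ^ 2 * (if a ∈ I.hits A R then 0 else 1) := fun R => by
    rw [Finset.sdiff_eq_filter, Finset.sum_filter]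
    refine Finset.sum_congr rfl fun a _ => ?_
    split <;> simp_all
  simp only [this]
  rw [avg_sum hk, NWTInstance.degSum, Nat.cast_sum, Finset.sum_mul]
  refine Finset.sum_le_sum fun a ha => ?_
  rw [avg_const_mul, avg_notMem_hits hk ha, sq, mul_assoc]
  exact mul_le_mul_of_nonneg_left (mul_pow_le hk _) (Nat.cast_nonneg _)

/-- The probability that many vertices are hit. -/
theorem avg_card_hits {k K : ℕ} (hk : 0 < k) (hK : 0 < K) :
    avg k (fun R => if (I.hits A R).card ≤ K then 0 else 1) (I.n * I.n) 0 R ≤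
      I.degSum A / (k * K) := by
  have hK' : (0 : ℝ) < K := by exact_mod_cast hK
  have hk' : (0 : ℝ) < k := by exact_mod_cast hk
  -- Markov's inequality: the indicator of more than `K` hits is at most the number of hits divided
  -- by `K`. By Bernoulli's inequality a vertex is hit with probability at most `deg a / k`.
  have h1 : avg k (fun R => if (I.hits A R).card ≤ K then 0 else 1) (I.n * I.n) 0 R ≤
      avg k (fun R => (1 / (K : ℝ)) * ∑ a ∈ A, (1 + (-1) * if a ∈ I.hits A R then 0 else 1))
        (I.n * I.n) 0 R := by
    refine avg_mono fun R => ?_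
    have : ∑ a ∈ A, ((1 : ℝ) + (-1) * if a ∈ I.hits A R then 0 else 1) = (I.hits A R).card := by
      rw [Finset.card_eq_sum_ones, Nat.cast_sum]
      have hs : I.hits A R = A.filter fun a => a ∈ I.hits A R := by
        ext a; simp [NWTInstance.mem_hits]
      conv_rhs => rw [hs, Finset.sum_filter]
      refine Finset.sum_congr rfl fun a _ => ?_
      split <;> simp
    rw [this]
    split
    · positivity
    · rename_i h
      rw [div_mul_eq_mul_div, one_mul, le_div_iff₀ hK', one_mul]
      exact_mod_cast (not_le.1 h).le
  refine h1.trans ?_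
  rw [avg_const_mul, avg_sum hk, div_mul_eq_mul_div, one_mul, ← div_div]
  refine div_le_div_of_nonneg_right ?_ hK'.le
  rw [NWTInstance.degSum, Nat.cast_sum, Finset.sum_div]
  refine Finset.sum_le_sum fun a ha => ?_
  rw [avg_add, avg_const hk, avg_const_mul, avg_notMem_hits hk ha]
  have h2 : 1 / (k : ℝ) ≤ 1 := by
    rw [div_le_one hk']; exact_mod_cast hk
  have := one_add_mul_le_pow (a := -(1 / (k : ℝ))) (by linarith) (I.deg a)
  rw [← sub_eq_add_neg] at this
  have h3 : (I.deg a : ℝ) * -(1 / (k : ℝ)) = - (I.deg a / k) := by ring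
  rw [h3] at this
  linarith

/-- The variance of the estimate after halving. -/
theorem avg_sq_thin {w z e : ℝ} (hA : A ⊆ Finset.range I.n) :
    avg 2 (fun R => (z + 2 * w * I.degSum (thin A R) - e) ^ 2) I.n 0 R =
      (z + w * I.degSum A - e) ^ 2 + w ^ 2 * ∑ a ∈ A, (I.deg a : ℝ) ^ 2 := by
  have hsum : ∀ F : ℕ → ℝ, ∑ a ∈ Finset.Ico 0 (0 + I.n), (if a ∈ A then F a else 0) =
      ∑ a ∈ A, F a := fun F => by
    rw [← Finset.sum_filter]
    congr 1
    ext a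
    simp only [Finset.mem_filter, Finset.mem_Ico]
    refine ⟨fun h => h.2, fun h => ⟨?_, h⟩⟩
    have := Finset.mem_range.1 (hA h)
    omega
  have key := avg_sq_signs (fun a => if a ∈ A then w * I.deg a else 0)
    (z + w * I.degSum A - e) (j := I.n) (t := 0) (f := R)
  have e1 : ∀ a, (if a ∈ A then w * (I.deg a : ℝ) else 0) ^ 2 =
      if a ∈ A then w ^ 2 * (I.deg a : ℝ) ^ 2 else 0 := fun a => by split <;> ring
  simp only [e1, hsum] at key
  rw [← Finset.mul_sum] at key
  rw [← key]
  refine avg_congr_of fun R _ => ?_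
  congr 1
  -- Twice the indicator of survival, minus 1, is a random sign; so the estimate after halving is
  -- the old one plus a sum of independent signed degrees.
  have e2 : ∀ a, (if a ∈ A then w * (I.deg a : ℝ) else 0) * (if R a = 0 then 1 else -1) =
      if a ∈ A then w * (2 * (if R a = 0 then (I.deg a : ℝ) else 0) - I.deg a) else 0 := fun a => by
    split_ifs <;> ring
  simp only [e2, hsum]
  rw [← Finset.mul_sum, Finset.sum_sub_distrib, ← Finset.mul_sum, ← Finset.sum_filter]
  simp only [NWTInstance.degSum, thin, Nat.cast_sum]
  ring

theorem avg_card_thin (hA : A ⊆ Finset.range I.n) :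
    avg 2 (fun R => ((thin A R).card : ℝ)) I.n 0 R = A.card / 2 := by
  have : ∀ R, ((thin A R).card : ℝ) =
      ∑ a ∈ A, (1 + (-1) * if ∀ x ∈ ({a} : Finset ℕ), R x ≠ 0 then (1 : ℝ) else 0) := fun R => by
    rw [Finset.card_eq_sum_ones, thin, Nat.cast_sum, Finset.sum_filter]
    refine Finset.sum_congr rfl fun a _ => ?_
    by_cases h : R a = 0 <;> simp [h]
  simp only [this]
  rw [avg_sum two_pos, Finset.card_eq_sum_ones, Nat.cast_sum, Finset.sum_div]
  refine Finset.sum_congr rfl fun a ha => ?_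
  rw [avg_add, avg_const two_pos, avg_const_mul, avg_forall_ne_zero two_pos]
  · norm_num
  · have := Finset.mem_range.1 (hA ha)
    simp; omega

end RAM

/-! ### The potential function. -/

namespace RAM

/-- The bound for the probability of failure before level `i` if the answers to all queries are
correct. Here `X` bounds the relative precision `q` and the number `L` of levels. -/
noncomputable def theta (I : NWTInstance) (L : ℕ) (X q : ℝ) (i z : ℕ) (A : Finset ℕ) : ℝ :=
  (1 + 2 / X) ^ (L - i) * ((z + 2 ^ i * I.degSum A : ℝ) - I.degSum (Finset.range I.n)) ^ 2 *
    (q / I.degSum (Finset.range I.n)) ^ 2 + A.card * (2 ^ i / 2 ^ L) +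
    (L - i : ℕ) * (3 / (20 * L))

/-- The bound for the probability of failure before level `i`. -/
noncomputable def totalTheta (I : NWTInstance) (p : Par) (X q : ℝ) (i z : ℕ) (A : Finset ℕ) : ℝ :=
  min 1 (theta I p.L X q i z A) + (p.L - i : ℕ) * (p.J * (p.K * (p.σ * (8 / 9) ^ p.v)))

variable {I : NWTInstance} {L : ℕ} {X q : ℝ} {i z : ℕ} {A B : Finset ℕ} {R : ℕ → ℕ}

theorem theta_nonneg (hX : 0 < X) : 0 ≤ theta I L X q i z A := by
  unfold theta; positivity

/-- The expected value of `theta` after halving. -/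
noncomputable def thetaHalf (I : NWTInstance) (L : ℕ) (X q : ℝ) (i : ℕ) (Y : ℝ) (A : Finset ℕ) : ℝ :=
  (1 + 2 / X) ^ (L - (i + 1)) * ((Y - I.degSum (Finset.range I.n)) ^ 2 +
    (2 ^ i) ^ 2 * ∑ a ∈ A, (I.deg a : ℝ) ^ 2) *
    (q / I.degSum (Finset.range I.n)) ^ 2 + A.card * (2 ^ i / 2 ^ L) +
    (L - (i + 1) : ℕ) * (3 / (20 * L))

theorem thetaHalf_mono (hX : 0 < X) {Y : ℝ} : Monotone (thetaHalf I L X q i Y) := by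
  intro A B h
  unfold thetaHalf
  gcongr

theorem thetaHalf_nonneg (hX : 0 < X) {Y : ℝ} : 0 ≤ thetaHalf I L X q i Y A := by
  unfold thetaHalf; positivity

/-- Halving keeps the expectation of the estimate, and its square gains the variance. The number of
living vertices halves in expectation while its factor `2 ^ i / 2 ^ L` doubles, so the second term
does not change. -/
theorem avg_theta (hA : A ⊆ Finset.range I.n) :
    avg 2 (fun R => theta I L X q (i + 1) z (thin A R)) I.n 0 R =
      thetaHalf I L X q i (z + 2 ^ i * I.degSum A) A := by
  have e1 : ∀ R, theta I L X q (i + 1) z (thin A R) =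
      (1 + 2 / X) ^ (L - (i + 1)) * (q / I.degSum (Finset.range I.n)) ^ 2 *
      ((z : ℝ) + 2 * 2 ^ i * I.degSum (thin A R) - I.degSum (Finset.range I.n)) ^ 2 +
      ((2 * (2 ^ i / 2 ^ L)) * ((thin A R).card : ℝ) + (L - (i + 1) : ℕ) * (3 / (20 * L))) := by
    intro R
    rw [theta, pow_succ 2 i]
    ring
  simp only [e1]
  rw [avg_add, avg_const_mul, avg_add, avg_const_mul, avg_const two_pos, avg_sq_thin hA,
    avg_card_thin hA, thetaHalf]
  ring

/-- The factor grows by at most `exp (2 * L / X)`, and `2 * L / X = 1 / (20 * q ^ 2)` is at most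
1/2. -/
theorem one_add_pow_le_two {l : ℕ} (hq1 : 1 ≤ q) (hX : 0 < X) (hXq : 40 * L * q ^ 2 = X)
    (hl : l ≤ L) : (1 + 2 / X) ^ l ≤ 2 := by
  have h20 : 2 / X * L ≤ 1 / 2 := by
    have hq2 : 1 ≤ q ^ 2 := one_le_pow₀ hq1
    rw [div_mul_eq_mul_div, div_le_iff₀ hX, ← hXq]
    nlinarith
  calc (1 + 2 / X) ^ l ≤ Real.exp (2 / X) ^ l := by
        refine pow_le_pow_left₀ (by positivity) ?_ _
        have := Real.add_one_le_exp (2 / X)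
        linarith
    _ = Real.exp (l * (2 / X)) := (Real.exp_nat_mul _ _).symm
    _ ≤ Real.exp (1 / 2) := by
        refine Real.exp_le_exp.2 (le_trans ?_ h20)
        rw [mul_comm]
        gcongr
    _ ≤ 1 / (1 - 1 / 2) := Real.exp_bound_div_one_sub_of_interval (by norm_num) (by norm_num)
    _ = 2 := by norm_num

/-- The variance of a halving is bounded relative to the current estimate `Y`, which may differ from
the true value `e`. From `Y ^ 2 ≤ 2 * (Y - e) ^ 2 + 2 * e ^ 2`, the first part is absorbed by the
factor `1 + 2 / X` per level in `theta`, and the second costs at most `4 * q ^ 2 / X = 1 / (10 *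
L)`. -/
theorem quadratic_bound {c h e Y w x : ℝ} (hX : 0 < X) (hL : (1 : ℝ) ≤ L)
    (hXq : 40 * L * q ^ 2 = X) (hc0 : 0 ≤ c) (hc2 : c ≤ 2) (hh0 : 0 ≤ h)
    (hYx : (w * x) ^ 2 ≤ Y ^ 2) (heh : e ^ 2 * h ≤ q ^ 2) :
    c * w ^ 2 * h * (x ^ 2 / X) ≤ c * (2 / X) * (Y - e) ^ 2 * h + 1 / (10 * L) := by
  have h1 : Y ^ 2 ≤ 2 * (Y - e) ^ 2 + 2 * e ^ 2 := by nlinarith [sq_nonneg (Y - e - e)]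
  have h2 : 2 * (2 / X) * q ^ 2 = 1 / (10 * L) := by
    rw [mul_div_assoc', div_mul_eq_mul_div, div_eq_div_iff hX.ne' (by positivity), ← hXq]
    ring
  calc c * w ^ 2 * h * (x ^ 2 / X) = c * h / X * (w * x) ^ 2 := by ring
    _ ≤ c * h / X * (2 * (Y - e) ^ 2 + 2 * e ^ 2) := by
        gcongr
        exact hYx.trans h1
    _ = c * (2 / X) * (Y - e) ^ 2 * h + c * (2 / X) * (e ^ 2 * h) := by ring
    _ ≤ c * (2 / X) * (Y - e) ^ 2 * h + 2 * (2 / X) * q ^ 2 := by gcongr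
    _ = _ := by rw [h2]

/-- This is the decisive round, with `k` near `x / X` for the degree sum `x` at the start of the
level. The variance that remains costs `1 / (10 * L)` beyond the growth of the quadratic term, and
the event of more than `K` hits costs `1 / (20 * L)`; together these are the `3 / (20 * L)` that
`theta` reserves for each level. Earlier rounds may have removed vertices, hence the subset `B`. -/
theorem avg_afterRound_le {K k : ℕ} (hq1 : 1 ≤ q) (hX : 0 < X) (hK : 0 < K) (hk : 0 < k) (hiL : i < L)
    (hXq : 40 * L * q ^ 2 = X) (hKX : 40 * X * L ≤ K)
    (h1 : k = 1 ∨ k * X ≤ I.degSum A) (h2 : (I.degSum A : ℝ) ≤ 2 * k * X) (hB : B ⊆ A) :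
    avg k (fun R' => afterRound I K
      (fun C => min 1 (thetaHalf I L X q i (z + 2 ^ i * I.degSum A) C)) B R') (I.n * I.n) 0 R ≤
      theta I L X q i z A := by
  have hL : (1 : ℝ) ≤ L := by exact_mod_cast (by omega : 1 ≤ L)
  have hk1 : (1 : ℝ) ≤ k := by exact_mod_cast hk
  have hK0 : (0 : ℝ) < K := by exact_mod_cast hK
  have hq : q ^ 2 ≠ 0 := by positivity
  set e : ℝ := (I.degSum (Finset.range I.n) : ℝ) with he
  set x : ℝ := (I.degSum A : ℝ) with hx
  set Y : ℝ := z + 2 ^ i * x with hY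
  set c : ℝ := (1 + 2 / X) ^ (L - (i + 1)) with hc
  set h : ℝ := (q / e) ^ 2 with hh
  have hx0 : 0 ≤ x := by positivity
  have he0 : 0 ≤ e := by positivity
  have hc0 : 0 ≤ c := by positivity
  have hh0 : 0 ≤ h := by positivity
  have hBx : (I.degSum B : ℝ) ≤ x := Nat.cast_le.2 (NWTInstance.degSum_mono hB)
  have hBc : (B.card : ℝ) ≤ A.card := by exact_mod_cast Finset.card_le_card hB
  have hc2 : c ≤ 2 := one_add_pow_le_two hq1 hX hXq (Nat.sub_le _ _)
  have step1 : avg k (fun R' => afterRound I K (fun C => min 1 (thetaHalf I L X q i Y C)) B R')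
      (I.n * I.n) 0 R ≤ avg k (fun R' => (c * (2 ^ i) ^ 2 * h * ∑ a ∈ B \ I.hits B R', (I.deg a : ℝ) ^ 2)
        + ((if (I.hits B R').card ≤ K then 0 else 1) + (c * (Y - e) ^ 2 * h +
          A.card * (2 ^ i / 2 ^ L) + (L - (i + 1) : ℕ) * (3 / (20 * L))))) (I.n * I.n) 0 R := by
    refine avg_mono fun R' => ?_
    unfold afterRound
    split
    · refine (min_le_right _ _).trans ?_
      have hcard : ((B \ I.hits B R').card : ℝ) ≤ A.card := by
        exact_mod_cast Finset.card_le_card (Finset.sdiff_subset.trans hB)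
      have : ((B \ I.hits B R').card : ℝ) * (2 ^ i / 2 ^ L) ≤ A.card * (2 ^ i / 2 ^ L) := by gcongr
      rw [thetaHalf]
      simp only [← he, ← hc, ← hh]
      linarith
    -- With more than `K` hits the potential is capped at 1, and this is charged to the indicator of
    -- the event.
    · refine (min_le_left _ _).trans ?_
      have : 0 ≤ c * (2 ^ i) ^ 2 * h * ∑ a ∈ B \ I.hits B R', (I.deg a : ℝ) ^ 2 +
          (c * (Y - e) ^ 2 * h + A.card * (2 ^ i / 2 ^ L) + (L - (i + 1) : ℕ) * (3 / (20 * L))) := by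
        positivity
      linarith
  refine step1.trans ?_
  rw [avg_add, avg_const_mul, avg_add, avg_const hk]
  -- For `k = 1` all pairs are chosen, and every vertex of positive degree is hit. Otherwise `k ≤ x
  -- / X`.
  have b1 : I.degSum B * ((k : ℝ) - 1) ≤ x ^ 2 / X := by
    refine (mul_le_mul_of_nonneg_right hBx (by linarith)).trans ?_
    rcases h1 with rfl | h1
    · simp; positivity
    · rw [le_div_iff₀ hX]
      nlinarith
  -- Here `x / k ≤ 2 * X` and `K ≥ 40 * X * L`.
  have b2 : (I.degSum B : ℝ) / (k * K) ≤ 1 / (20 * L) := by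
    rw [div_le_div_iff₀ (by positivity) (by positivity)]
    have : 2 * k * X * (20 * L) ≤ k * K := by nlinarith
    nlinarith
  have b3 := avg_sum_sq_sdiff_hits (I := I) (A := B) (R := R) hk
  have b4 := avg_card_hits (I := I) (A := B) (R := R) hk hK
  have b5 : c * (2 ^ i) ^ 2 * h * (x ^ 2 / X) ≤ c * (2 / X) * (Y - e) ^ 2 * h + 1 / (10 * L) := by
    have hYx : (2 ^ i * x) ^ 2 ≤ Y ^ 2 := by
      have : 2 ^ i * x ≤ Y := by simp [hY]
      gcongr
    have heh : e ^ 2 * h ≤ q ^ 2 := by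
      rw [hh, ← mul_pow]
      by_cases h0 : e = 0
      · simp [h0]; positivity
      · rw [mul_div_cancel₀ _ h0]
    exact quadratic_bound hX hL hXq hc0 hc2 hh0 hYx heh
  have b6 : c * (2 ^ i) ^ 2 * h * avg k (fun R' => ∑ a ∈ B \ I.hits B R', (I.deg a : ℝ) ^ 2)
      (I.n * I.n) 0 R ≤ c * (2 ^ i) ^ 2 * h * (x ^ 2 / X) :=
    mul_le_mul_of_nonneg_left (b3.trans b1) (by positivity)
  have e1 : theta I L X q i z A = (c * (Y - e) ^ 2 * h + c * (2 / X) * (Y - e) ^ 2 * h) +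
      A.card * (2 ^ i / 2 ^ L) + ((L - (i + 1) : ℕ) * (3 / (20 * L)) + (1 / (10 * L) + 1 / (20 * L))) := by
    rw [theta, show L - i = L - (i + 1) + 1 by omega, pow_succ]
    push_cast
    simp only [← he, ← hc, ← hh, ← hx, ← hY]
    field_simp
    ring
  rw [e1]
  linarith [b4.trans b2]

/-- Within a level only one round matters for the analysis. Which one depends on the unknown degree
sum, but the potential, unlike the program, may depend on it. The errors of the queries are added as
a separate linear term. -/
theorem isPotential {p : Par} (hq1 : 1 ≤ q) (hX : 0 < X) (hK : 0 < p.K) (hXq : 40 * p.L * q ^ 2 = X)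
    (hKX : 40 * X * p.L ≤ p.K) (hJ : 0 < p.J)
    (hJX : (I.degSum (Finset.range I.n) : ℝ) ≤ 2 ^ p.J * X) :
    IsPotential I p (totalTheta I p X q) := by
  intro i hi z A hA _
  set x : ℝ := (I.degSum A : ℝ) with hx
  set η : ℝ := p.K * (p.σ * (8 / 9) ^ p.v) with hη
  have hη0 : 0 ≤ η := by positivity
  have hxe : x ≤ I.degSum (Finset.range I.n) := Nat.cast_le.2 (NWTInstance.degSum_mono hA)
  have hex : ∃ j, x ≤ 2 * (2 ^ j : ℕ) * X := ⟨p.J, by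
    push_cast
    have : 0 < 2 ^ p.J * X := by positivity
    linarith⟩
  classical
  -- The first round in which `k = 2 ^ s` is not too small. By minimality `2 ^ s * X ≤ x` unless `s
  -- = 0`, and `s < J` because `e ≤ 2 ^ J * X`.
  set s := Nat.find hex with hs
  have hs1 : x ≤ 2 * (2 ^ s : ℕ) * X := Nat.find_spec hex
  have hsJ : s < p.J := by
    refine lt_of_le_of_lt (Nat.find_le (n := p.J - 1) ?_) (by omega : p.J - 1 < p.J)
    push_cast
    rw [← pow_succ', Nat.sub_add_cancel hJ]
    linarith
  have hs2 : (2 ^ s : ℕ) = 1 ∨ (2 ^ s : ℕ) * X ≤ x := by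
    rcases Nat.eq_zero_or_pos s with h0 | h0
    · left; rw [h0]; rfl
    · right
      have := Nat.find_min hex (m := s - 1) (by omega)
      push_cast at this ⊢
      rw [← pow_succ', Nat.sub_add_cancel h0] at this
      linarith
  -- the potential without the errors of the queries
  set Y : ℝ := z + 2 ^ i * x with hY
  obtain ⟨Ψ, m1, m2, m3, m4, m5⟩ : ∃ Ψ : ℕ → Finset ℕ → ℝ, (∀ j, Monotone (Ψ j)) ∧
      (∀ j B, 0 ≤ Ψ j B) ∧ Ψ 0 A ≤ min 1 (theta I p.L X q i z A) ∧
      (∀ j < p.J, ∀ B ⊆ A, ∀ R, avg (2 ^ j) (fun R' => afterRound I p.K (Ψ (j + 1)) B R')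
        (I.n * I.n) 0 R ≤ Ψ j B) ∧ ∀ B, min 1 (thetaHalf I p.L X q i Y B) ≤ Ψ p.J B := by
    have hconst : ∀ (k : ℕ) (c : ℝ) B R, 0 < k → avg k (fun R' => afterRound I p.K
        (fun _ => c) B R') (I.n * I.n) 0 R = c := fun k c B R hk => by
      simp only [afterRound, ite_self]
      exact avg_const hk c
    -- If the bound is at least 1, it says nothing, and the constant potential 1 suffices.
    by_cases hθ : 1 ≤ theta I p.L X q i z A
    · refine ⟨fun _ _ => 1, fun _ _ _ _ => le_rfl, fun _ _ => zero_le_one, le_min le_rfl hθ,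
        fun j _ B _ R => (hconst _ _ _ _ (by positivity)).le, fun B => min_le_left _ _⟩
    · set ψ : Finset ℕ → ℝ := fun B => min 1 (thetaHalf I p.L X q i Y B) with hψ
      have hψm : Monotone ψ := fun B C h => min_le_min le_rfl (thetaHalf_mono hX h)
      -- Before round `s` the potential is constant, whatever is removed; round `s` brings it to
      -- `ψ`; later rounds only shrink the living set, and `ψ` is monotone.
      refine ⟨fun j B => if j ≤ s then theta I p.L X q i z A else ψ B, fun j B C h => ?_,
        fun j B => ?_, ?_, fun j hj B hB R => ?_, fun B => ?_⟩
      · dsimp only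
        split
        · exact le_rfl
        · exact hψm h
      · dsimp only
        split
        · exact theta_nonneg hX
        · exact le_min zero_le_one (thetaHalf_nonneg hX)
      · simp only [Nat.zero_le, if_true]
        exact le_min (not_le.1 hθ).le le_rfl
      · rcases lt_trichotomy j s with h | h | h
        · simp only [if_pos (show j + 1 ≤ s from h), if_pos h.le]
          exact (hconst _ _ _ _ (by positivity)).le
        · subst h
          simp only [if_neg (show ¬ s + 1 ≤ s by omega), le_refl, if_true]
          exact avg_afterRound_le hq1 hX hK (by positivity) hi hXq hKX hs2 hs1 hB
        · simp only [if_neg (show ¬ j + 1 ≤ s by omega), if_neg (show ¬ j ≤ s by omega)]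
          refine (avg_mono (G := fun _ => ψ B) fun R' => ?_).trans (avg_const (by positivity) _).le
          unfold afterRound
          split
          · exact hψm Finset.sdiff_subset
          · exact le_rfl
      · dsimp only
        rw [if_neg (by omega)]
  refine ⟨fun j B => Ψ j B + ((p.L - (i + 1) : ℕ) * (p.J * η) + (p.J - j : ℕ) * η),
    fun j B C h => add_le_add_left (m1 j h) _, fun j B => ?_, ?_, fun j hj B hB R => ?_,
    fun B hB z' hz' R => ?_⟩
  · have := m2 j B
    positivity
  · rw [totalTheta, ← hη, show p.L - i = p.L - (i + 1) + 1 by omega]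
    push_cast
    simp only [Nat.sub_zero]
    linarith
  · have e1 : ∀ R', afterRound I p.K (fun B => Ψ (j + 1) B + ((p.L - (i + 1) : ℕ) * (p.J * η) +
        (p.J - (j + 1) : ℕ) * η)) B R' + η = afterRound I p.K (Ψ (j + 1)) B R' +
        ((p.L - (i + 1) : ℕ) * (p.J * η) + (p.J - j : ℕ) * η) := fun R' => by
      rw [show p.J - j = p.J - (j + 1) + 1 by omega]
      unfold afterRound
      split <;> push_cast <;> ring
    simp only [e1]
    rw [avg_add, avg_const (by positivity)]
    linarith [m4 j hj B hB R]
  · have hz : (z' : ℝ) + 2 ^ i * I.degSum B = Y := by rw [hY, hx]; exact_mod_cast hz'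
    simp only [totalTheta, ← hη]
    rw [avg_add, avg_const two_pos]
    have h1 : avg 2 (fun R' => min 1 (theta I p.L X q (i + 1) z' (thin B R'))) I.n 0 R ≤
        min 1 (thetaHalf I p.L X q i Y B) := by
      refine le_min ((avg_mono fun R' => min_le_left _ _).trans (avg_const two_pos 1).le) ?_
      refine (avg_mono fun R' => min_le_right _ _).trans ?_
      rw [avg_theta (hB.trans hA), hz]
    have := m5 B
    simp only [Nat.sub_self, Nat.cast_zero, zero_mul, add_zero]
    linarith

/-- The potential at the start. -/
theorem totalTheta_zero_le {p : Par} (hL : 0 < p.L) (hA : A = Finset.range I.n)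
    (hn : (32 : ℝ) * I.n ≤ 2 ^ p.L)
    (hη : (p.L : ℝ) * (p.J * (p.K * (p.σ * (8 / 9) ^ p.v))) ≤ 1 / 20) :
    totalTheta I p X q 0 0 A ≤ 1 / 3 := by
  have hL' : (0 : ℝ) < p.L := by exact_mod_cast hL
  rw [totalTheta, Nat.sub_zero]
  -- At the start the estimate is exact. There remain 1/32 for vertices still alive at the end, 3/20
  -- for the levels and 1/20 for the queries, altogether less than 1/3.
  have : theta I p.L X q 0 0 A ≤ 1 / 32 + 3 / 20 := by
    rw [theta, hA]
    simp only [Nat.cast_zero, pow_zero, one_mul, zero_add, sub_self, Nat.sub_zero, Finset.card_range]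
    have h1 : (I.n : ℝ) * (1 / 2 ^ p.L) ≤ 1 / 32 := by
      rw [mul_one_div, div_le_div_iff₀ (by positivity) (by norm_num)]
      linarith
    have h2 : (p.L : ℝ) * (3 / (20 * p.L)) = 3 / 20 := by field_simp
    rw [h2]
    simp
    simpa using h1
  have := min_le_right 1 (theta I p.L X q 0 0 A)
  linarith

/-- The precision of the final estimate. -/
theorem abs_sub_mul_le {p : Par} (hq : 0 < q)
    (h0 : z + 2 ^ p.L * I.degSum A ≤ 2 ^ p.L * I.degSum (Finset.range I.n))
    (h : totalTheta I p X q p.L z A < 1) :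
    |(z : ℝ) - I.degSum (Finset.range I.n)| * q ≤ I.degSum (Finset.range I.n) := by
  rw [totalTheta, Nat.sub_self] at h
  simp only [Nat.cast_zero, zero_mul, add_zero] at h
  have h1 : theta I p.L X q p.L z A < 1 := by
    rcases min_lt_iff.1 h with h | h
    · exact absurd h (lt_irrefl _)
    · exact h
  rw [theta, Nat.sub_self] at h1
  simp only [pow_zero, one_mul, Nat.cast_zero, zero_mul, add_zero] at h1
  rw [div_self (by positivity), mul_one] at h1
  -- At the last level each living vertex contributes `2 ^ L / 2 ^ L = 1` to the potential.
  have hcard : A = ∅ := by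
    have h2 : (A.card : ℝ) < 1 := lt_of_le_of_lt (le_add_of_nonneg_left (by positivity)) h1
    have h3 : A.card < 1 := by exact_mod_cast h2
    exact Finset.card_eq_zero.1 (by omega)
  subst hcard
  have hd : I.degSum ∅ = 0 := rfl
  rw [hd] at h0 h1
  simp only [Nat.cast_zero, mul_zero, add_zero, Finset.card_empty] at h0 h1
  -- For `e = 0` the quotient `q / e` is 0 by convention and the potential says nothing; then `h0`
  -- gives the exact result.
  rcases Nat.eq_zero_or_pos (I.degSum (Finset.range I.n)) with he | he
  · rw [he] at h0 ⊢
    have : z = 0 := by simpa using h0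
    simp [this]
  · have he' : (0 : ℝ) < I.degSum (Finset.range I.n) := by exact_mod_cast he
    rw [← mul_pow, sq_lt_one_iff_abs_lt_one, abs_mul, abs_of_pos (div_pos hq he'), ← mul_div_assoc,
      div_lt_one he'] at h1
    exact h1.le

end RAM

/-! ### Size of the words and the leading digits of the tolerance. -/

theorem Nat.size_sq_le (k : ℕ) : (k + 2) ^ 2 ≤ 9 * 2 ^ (k - 1) := by
  induction k with
  | zero => norm_num
  | succ k ih =>
    rcases k with - | - | k
    · norm_num
    · norm_num
    · simp only [Nat.add_sub_cancel] at ih ⊢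
      have : 2 ^ (k + 1 + 1) = 2 * 2 ^ (k + 1) := by ring
      have h2 : (k + 1 + 1 + 1 + 2) ^ 2 ≤ 2 * (k + 1 + 1 + 2) ^ 2 := by
        ring_nf
        nlinarith [Nat.zero_le (k ^ 2)]
      omega

namespace NWTInstance

variable (I : NWTInstance)

theorem bitLen_lt : I.bitLen < I.wordLen * I.numWords := by
  unfold numWords
  exact Nat.lt_mul_div_succ _ (by simp [wordLen])

theorem n_lt_two_pow_wordLen : I.n < 2 ^ I.wordLen := by
  calc I.n ≤ I.n + I.bitLen := by omega
    _ < 2 ^ (I.n + I.bitLen).size := Nat.lt_size_self _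
    _ ≤ _ := Nat.pow_le_pow_right (by norm_num) (by rw [wordLen]; omega)

theorem two_le_two_pow_wordLen : 2 ≤ 2 ^ I.wordLen := by
  rw [wordLen, pow_succ]
  have := Nat.one_le_two_pow (n := (I.n + I.bitLen).size)
  omega

/-- Words have logarithmic length. -/
theorem two_pow_wordLen_le : 2 ^ I.wordLen ≤ (I.encLen + 2) ^ 8 := by
  set E := I.encLen with hE
  have hE3 : 3 ≤ E := by rw [hE, encLen]; omega
  set k := (I.n + I.bitLen).size with hk
  -- The longest weight takes `numWords ≤ E` words of `k + 1` bits, so `n + bitLen` is bounded by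
  -- about `E * k`. As `k` is itself logarithmic in `n + bitLen`, squaring and `Nat.size_sq_le`
  -- remove it.
  have key : 2 ^ (k - 1) ≤ E * (k + 2) + 1 := by
    rcases Nat.eq_zero_or_pos k with h0 | h0
    · rw [h0]; norm_num
    · have h1 : 2 ^ (k - 1) ≤ I.n + I.bitLen := Nat.lt_size.1 (by omega)
      rcases Nat.eq_zero_or_pos I.n with hn | hn
      · have : I.bitLen = 0 := by
          have : IsEmpty (Fin I.n) := by rw [hn]; infer_instance
          simp [bitLen]
        omega
      · have h2 := I.bitLen_lt
        have h3 : I.numWords ≤ E := by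
          have := Nat.le_mul_of_pos_left (I.numWords + 1) (Nat.mul_pos hn hn)
          rw [hE, encLen]; omega
        have h4 : I.n ≤ E := by rw [hE, encLen]; omega
        have h5 : I.wordLen = k + 1 := rfl
        rw [h5] at h2
        nlinarith
  have h1 := Nat.size_sq_le k
  have h2 : 2 ^ (k - 1) ≤ 9 * (E + 1) ^ 2 := by
    have h3 : 2 ^ (k - 1) ≤ (E + 1) * (k + 2) := by nlinarith
    have h4 : (2 ^ (k - 1)) ^ 2 ≤ (E + 1) ^ 2 * (9 * 2 ^ (k - 1)) := by
      calc (2 ^ (k - 1)) ^ 2 ≤ ((E + 1) * (k + 2)) ^ 2 := Nat.pow_le_pow_left h3 2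
        _ = (E + 1) ^ 2 * (k + 2) ^ 2 := by ring
        _ ≤ _ := by gcongr
    have h5 : 0 < 2 ^ (k - 1) := by positivity
    nlinarith
  have h3 : 2 ^ I.wordLen ≤ 4 * 2 ^ (k - 1) := by
    rw [show I.wordLen = k + 1 from rfl, show (4 : ℕ) = 2 ^ 2 by norm_num, ← pow_add]
    exact Nat.pow_le_pow_right (by norm_num) (by omega)
  calc 2 ^ I.wordLen ≤ 4 * (9 * (E + 1) ^ 2) := by omega
    _ ≤ (E + 2) ^ 6 * (E + 2) ^ 2 := by
        have : 36 ≤ (E + 2) ^ 6 := le_trans (by norm_num) (Nat.pow_le_pow_left (show 5 ≤ E + 2 by omega) 6)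
        have h6 : (E + 1) ^ 2 ≤ (E + 2) ^ 2 := Nat.pow_le_pow_left (by omega) 2
        rw [← mul_assoc]
        exact Nat.mul_le_mul this h6
    _ = _ := by ring

end NWTInstance

/-- The last digit of a number in the list of the digits. -/
theorem Nat.top_digit {B x : ℕ} (hB : 2 ≤ B) (hx : 0 < x) :
    0 < (Nat.digits B x).length ∧ 0 < (Nat.digits B x).getD ((Nat.digits B x).length - 1) 0 ∧
    (Nat.digits B x).getD ((Nat.digits B x).length - 1) 0 < B ∧
    (Nat.digits B x).getD ((Nat.digits B x).length - 1) 0 * B ^ ((Nat.digits B x).length - 1) ≤ x ∧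
    x < ((Nat.digits B x).getD ((Nat.digits B x).length - 1) 0 + 1) *
      B ^ ((Nat.digits B x).length - 1) := by
  set l := (Nat.digits B x).length with hl
  have hl0 : 0 < l := List.length_pos_of_ne_nil (Nat.digits_ne_nil_iff_ne_zero.2 hx.ne')
  have h1 : x < B ^ l := Nat.lt_base_pow_length_digits (by omega)
  have h2 : B ^ l ≤ B * x := Nat.base_pow_length_digits_le B x (by omega) hx.ne'
  have h3 : B ^ l = B * B ^ (l - 1) := by rw [← _root_.pow_succ', Nat.sub_add_cancel hl0]
  have h4 : B ^ (l - 1) ≤ x := by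
    rw [h3] at h2
    exact Nat.le_of_mul_le_mul_left h2 (by omega)
  have hpos : 0 < B ^ (l - 1) := by positivity
  have h5 : x / B ^ (l - 1) < B := by
    rw [Nat.div_lt_iff_lt_mul hpos, ← h3]; exact h1
  rw [Nat.getD_digits _ _ hB, Nat.mod_eq_of_lt h5]
  exact ⟨hl0, Nat.div_pos h4 hpos, h5, Nat.div_mul_le_self _ _, (Nat.div_lt_iff_lt_mul hpos).1 (Nat.lt_succ_self _)⟩

/-- An integer near to the inverse of a quotient of two numbers, from their leading digits in base
`B` and their lengths. -/
def precision (B lp lq pt qt : ℕ) : ℕ :=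
  ((qt + 1) * ((lq - lp) * (B - 1) + 1) / pt + 1) * (1 - if 1 < lq - lp then 1 else 0) +
    (if 1 < lq - lp then 1 else 0) * B

/-- The time bound leaves no room for reading all digits of `ε = p / q`, so only the leading digits
`pt`, `qt` and the lengths are used. Replacing a number by its leading digit loses a factor of at
most 2, hence `4 * q`; rounding up adds one more `p ≤ q`, hence 5. For `lq - lp ≤ 1` the number `(lq
- lp) * (B - 1) + 1` is `B ^ (lq - lp)`. If `q` has at least two digits more than `p`, the value `B`
is returned: it may be too small as a precision, but it exceeds `n` and leads to exact counting. -/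
theorem precision_spec {B p q lp lq pt qt : ℕ} (hB : 2 ≤ B) (hpq : p < q) (hlp : 0 < lp)
    (hpt : 0 < pt) (hqt : 0 < qt) (hlpq : lp ≤ lq) (hp1 : pt * B ^ (lp - 1) ≤ p)
    (hp2 : p < (pt + 1) * B ^ (lp - 1)) (hptB : pt < B)
    (hq1 : qt * B ^ (lq - 1) ≤ q) (hq2 : q < (qt + 1) * B ^ (lq - 1)) :
    0 < precision B lp lq pt qt ∧ precision B lp lq pt qt * p ≤ 5 * q ∧
      (q ≤ precision B lp lq pt qt * p ∨ precision B lp lq pt qt = B) := by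
  unfold precision
  by_cases h : 1 < lq - lp
  · simp only [h, if_true, Nat.sub_self, mul_zero, one_mul, zero_add]
    refine ⟨by omega, ?_, Or.inr trivial⟩
    have h1 : B * p ≤ B ^ (lq - 1) := by
      have h2 : p ≤ B ^ lp := by
        rw [show lp = lp - 1 + 1 by omega, pow_succ']
        exact hp2.le.trans (Nat.mul_le_mul_right _ (by omega))
      calc B * p ≤ B * B ^ lp := by gcongr
        _ = B ^ (lp + 1) := by rw [pow_succ']
        _ ≤ B ^ (lq - 1) := Nat.pow_le_pow_right (by omega) (by omega)
    nlinarith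
  · simp only [h, if_false, Nat.sub_zero, mul_one, zero_mul, add_zero]
    have hF : ((lq - lp) * (B - 1) + 1) * B ^ (lp - 1) = B ^ (lq - 1) := by
      rcases (by omega : lq = lp ∨ lq = lp + 1) with rfl | rfl
      · simp
      · rw [Nat.add_sub_cancel_left, Nat.add_sub_cancel, one_mul, Nat.sub_add_cancel (by omega),
          ← pow_succ', Nat.sub_add_cancel hlp]
    set F := (lq - lp) * (B - 1) + 1
    set u := (qt + 1) * F / pt
    have h1 : u * pt ≤ (qt + 1) * F := Nat.div_mul_le_self _ _
    have h2 : (qt + 1) * F < (u + 1) * pt :=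
      (Nat.div_lt_iff_lt_mul hpt).1 (Nat.lt_succ_self _)
    refine ⟨Nat.succ_pos _, ?_, Or.inl ?_⟩
    · have h3 : u * p ≤ 4 * q := by
        calc u * p ≤ u * ((2 * pt) * B ^ (lp - 1)) := by
              gcongr
              exact hp2.le.trans (Nat.mul_le_mul_right _ (by omega))
          _ = 2 * (u * pt) * B ^ (lp - 1) := by ring
          _ ≤ 2 * ((2 * qt) * F) * B ^ (lp - 1) :=
              Nat.mul_le_mul_right _ (Nat.mul_le_mul_left _
                (h1.trans (Nat.mul_le_mul_right F (show qt + 1 ≤ 2 * qt by omega))))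
          _ = 4 * (qt * (F * B ^ (lp - 1))) := by ring
          _ ≤ 4 * q := by rw [hF]; gcongr
      linarith
    · calc q ≤ (qt + 1) * (F * B ^ (lp - 1)) := by rw [hF]; exact hq2.le
        _ = ((qt + 1) * F) * B ^ (lp - 1) := by ring
        _ ≤ ((u + 1) * pt) * B ^ (lp - 1) := by gcongr
        _ = (u + 1) * (pt * B ^ (lp - 1)) := by ring
        _ ≤ (u + 1) * p := by gcongr

theorem precision_le {B lp lq pt qt Z : ℕ} (hB : 2 ≤ B) (hBZ : B ≤ Z) (hqt : qt < B)
    (hl : lq ≤ Z) :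
    (lq - lp) * (B - 1) + 1 ≤ Z ^ 2 ∧ (qt + 1) * ((lq - lp) * (B - 1) + 1) ≤ Z ^ 3 ∧
      precision B lp lq pt qt ≤ 2 * Z ^ 3 := by
  have h1 : (lq - lp) * (B - 1) + 1 ≤ Z ^ 2 := by
    have h2 : (lq - lp) * (B - 1) ≤ Z * (Z - 1) := Nat.mul_le_mul (by omega) (by omega)
    have h3 : Z * (Z - 1) + Z = Z ^ 2 := by
      rw [← Nat.mul_succ, Nat.succ_eq_add_one, Nat.sub_add_cancel (by omega), sq]
    omega
  have h2 : (qt + 1) * ((lq - lp) * (B - 1) + 1) ≤ Z ^ 3 := by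
    calc _ ≤ Z * Z ^ 2 := Nat.mul_le_mul (by omega) h1
      _ = Z ^ 3 := by ring
  refine ⟨h1, h2, ?_⟩
  have h3 := (Nat.div_le_self ((qt + 1) * ((lq - lp) * (B - 1) + 1)) pt).trans h2
  have h4 : B ≤ Z ^ 3 := hBZ.trans (Nat.le_self_pow (by norm_num) _)
  have h5 : 1 ≤ Z ^ 3 := Nat.one_le_pow _ _ (by omega)
  unfold precision
  split <;> omega

/-! ### Setup, exact counting, and correctness of the whole program. -/

namespace RAM

variable {m : ℕ} {I : NWTInstance} {s : Store} {r : ℝ}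

/-- Reads the header of the encoding and computes the constants. -/
def headerProg : Program := block [
  .const 60 0, .load 3 60, .const 60 1, .load 44 60, .const 60 2, .load 4 60, .const 60 1,
  .op .shl 5 60 44, .op .mul 6 3 3, .const 61 3, .op .add 7 61 3, .op .add 8 7 6, .op .add 10 4 60,
  .op .mul 9 6 10, .op .add 9 8 9]

theorem wp_headerProg (hmem : ∀ t < I.encLen, s.mem t = I.word t) (hE : I.encLen ≤ m)
    (hB : 2 ^ I.wordLen ≤ m) (hnw : I.numWords + 1 ≤ m) :
    WP m headerProg 30 (fun s' r' => r' = r ∧ s'.mem = s.mem ∧ Env I s' ∧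
      s'.reg 44 = I.wordLen) s r := by
  have h3 : 3 ≤ I.encLen := by rw [NWTInstance.encLen]; omega
  have e0 : s.mem 0 = I.n := (hmem 0 (by omega)).trans I.word_zero
  have e1 : s.mem 1 = I.wordLen := (hmem 1 (by omega)).trans I.word_one
  have e2 : s.mem 2 = I.numWords := (hmem 2 (by omega)).trans I.word_two
  have hlen : I.encLen = 3 + I.n + I.n * I.n + I.n * I.n * (I.numWords + 1) := rfl
  refine WP.block_le (by omega) (by simp) ?_ ?_ (by simp)
  · simp only [Fine, Fine1, exec1, BinOp.eval, Store.setReg_reg, Store.setReg_mem, Nat.reduceEqDiff,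
      if_false, if_true, e0, e1, e2, true_and, and_true, Nat.shiftLeft_eq, one_mul]
    refine ⟨by omega, by omega, by omega, by omega, hB, ?_⟩
    omega
  · refine ⟨rfl, rfl, ⟨?_, ?_, ?_, ?_, ?_, ?_, ?_, ?_, hmem⟩, ?_⟩
    all_goals simp [exec, exec1, BinOp.eval, e0, e1, e2, Nat.shiftLeft_eq, hlen]

/-- Computes the precision from the leading digits of the tolerance. -/
def precisionProg : Program := .seq (block [
  .const 60 1, .load 40 9, .op .add 61 9 60, .load 41 61, .op .add 61 61 40, .load 42 61,
  .op .add 61 61 41, .load 43 61, .op .sub 45 41 40, .op .lt 46 60 45]) (block [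
  .op .sub 47 5 60, .op .mul 47 45 47, .op .add 47 47 60, .op .add 49 43 60, .op .mul 47 49 47,
  .op .div 47 47 42, .op .add 47 47 60, .op .sub 50 60 46, .op .mul 47 47 50, .op .mul 50 46 5,
  .op .add 47 47 50])

theorem wp_precisionProg {B lp lq pt qt Z : ℕ} (h5 : s.reg 5 = B) (h9 : s.reg 9 = I.encLen)
    (h1 : s.mem I.encLen = lp) (h2 : s.mem (I.encLen + 1) = lq)
    (h3 : s.mem (I.encLen + 1 + lp) = pt) (h4 : s.mem (I.encLen + 1 + lp + lq) = qt)
    (hB : 2 ≤ B) (hBZ : B ≤ Z) (hqt : qt < B) (hl : I.encLen + 1 + lp + lq ≤ Z)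
    (hZ : 2 * Z ^ 3 ≤ m) :
    WP m precisionProg 43 (fun s' r' => r' = r ∧ s'.mem = s.mem ∧
      s'.reg 47 = precision B lp lq pt qt) s r := by
  obtain ⟨b1, b2, b3⟩ := precision_le (lp := lp) (pt := pt) hB hBZ hqt (by omega : lq ≤ Z)
  have b4 : Z ≤ Z ^ 3 := Nat.le_self_pow (by norm_num) _
  have b5 : Z ^ 2 ≤ Z ^ 3 := Nat.pow_le_pow_right (by omega) (by norm_num)
  have b6 := (Nat.div_le_self ((qt + 1) * ((lq - lp) * (B - 1) + 1)) pt).trans b2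
  have hm : 1 ≤ m := by omega
  refine WP.block_seq (t' := 22) hm (by simp) ?_ (WP.block_le hm (by simp) ?_ ?_ (by simp))
    (by simp)
  · simp only [Fine, Fine1, exec1, BinOp.eval, Store.setReg_reg, Store.setReg_mem, Nat.reduceEqDiff,
      if_false, if_true, h9, h1, h2, h3, true_and, and_true]
    omega
  · simp only [Fine, Fine1, exec, exec1, BinOp.eval, Store.setReg_reg, Store.setReg_mem,
      Nat.reduceEqDiff, if_false, if_true, h9, h1, h2, h3, h4, h5, true_and, and_true]
    refine ⟨by omega, by omega, by omega, by omega, by omega, ?_, ?_, ?_⟩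
    · split
      · simp
      · simp; omega
    · split <;> omega
    · refine le_trans ?_ (b3.trans hZ)
      exact le_rfl
  · refine ⟨rfl, rfl, ?_⟩
    simp only [exec, exec1, BinOp.eval, Store.setReg_reg, Store.setReg_mem,
      Nat.reduceEqDiff, if_false, if_true, h9, h1, h2, h3, h4, h5]
    rfl

/-- Computes the number of bits of the number in register `3`. -/
def sizeProg : Program := .seq (.const 18 0) (forLoop 51 44 (block [
  .op .shr 52 3 51, .const 53 0, .op .lt 52 53 52, .op .add 18 18 52]))

theorem wp_sizeProg {n l : ℕ} (h3 : s.reg 3 = n) (h44 : s.reg 44 = l) (hl : n.size ≤ l)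
    (hm : 1 ≤ m) :
    WP m sizeProg (l * 16 + 8) (fun s' r' => r' = r ∧ s'.mem = s.mem ∧ s'.reg 18 = n.size) s r := by
  refine WP.of_fits fun hs => ?_
  have hlm : l ≤ m := h44 ▸ hs.1 44
  refine WP.seq_le (t' := l * 16 + 6) (WP.const (by omega) ?_) (by omega)
  refine WP.conseq (WP.forLoop (n := l) (tb := 8) (fun t s' r' => r' = r ∧ s'.mem = s.mem ∧
    s'.reg 18 = min t n.size) hm (by simp [h44]) (by omega) (by omega) (by omega)
    (by simp [block, writes]) (by simp [block, writes]) (fun v => by simp) ?_) le_rfl ?_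
  · rintro t ht s' r' _ hfr hi ⟨rfl, k1, k2⟩
    have e3 : s'.reg 3 = n := by
      rw [hfr 3 (by simp [forLoop, block, writes])]; simp [h3]
    have key : (if 0 < n >>> t then 1 else 0) + min t n.size = min (t + 1) n.size := by
      have : 0 < n >>> t ↔ t < n.size := by
        rw [Nat.shiftRight_eq_div_pow, Nat.div_pos_iff, Nat.lt_size]
        exact ⟨fun h => h.2, fun h => ⟨by positivity, h⟩⟩
      rw [if_congr this rfl rfl]
      split <;> omega
    refine WP.block_le hm (by simp) ?_ ?_ (by simp)
    · simp only [Fine, Fine1, exec1, BinOp.eval, Store.setReg_reg, Nat.reduceEqDiff, if_false,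
        if_true, true_and, and_true, e3, hi, k2]
      omega
    · intro v
      refine ⟨rfl, k1, ?_⟩
      simp only [exec, exec1, BinOp.eval, Store.setReg_reg, Nat.reduceEqDiff, if_false,
        if_true, e3, hi, k2]
      omega
  · rintro s' r' _ _ ⟨rfl, k1, k2⟩
    exact ⟨rfl, k1, by rw [k2]; omega⟩

/-- Computes a power of the number in register `54`. -/
def powProg : ℕ → Program
  | 0 => .const 11 1
  | k + 1 => .seq (powProg k) (.op .mul 11 11 54)

theorem writes_powProg {k q : ℕ} (h : writes (powProg k) q) : q = 11 := by
  induction k with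
  | zero => exact h
  | succ k ih => exact h.elim ih id

theorem wp_powProg {k a : ℕ} (h54 : s.reg 54 = a) (ha : 1 ≤ a) (hm : a ^ k ≤ m) :
    WP m (powProg k) (2 * k + 1) (fun s' r' => r' = r ∧ s'.mem = s.mem ∧ s'.reg 11 = a ^ k) s r := by
  induction k with
  | zero => exact WP.const (by simpa using hm) ⟨rfl, rfl, by simp⟩
  | succ k ih =>
    have hle : a ^ k ≤ a ^ (k + 1) := Nat.pow_le_pow_right ha (by omega)
    refine WP.seq_le (t' := 1) (WP.conseq (ih (hle.trans hm)) le_rfl ?_) (by omega)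
    rintro s' r' _ hfr ⟨rfl, k1, k2⟩
    have e54 : s'.reg 54 = a := by
      rw [hfr 54 fun h => by have := writes_powProg h; omega, h54]
    refine WP.op (by rw [k2, e54]; exact hm) ⟨rfl, k1, ?_⟩
    simp [BinOp.eval, k2, e54, pow_succ]

/-- Computes the parameters of the main loop. -/
def paramProg : Program := .seq (block [
  .const 60 1, .op .add 11 11 60, .const 60 5, .op .add 15 18 60, .const 60 3, .op .mul 16 18 60,
  .const 60 1600, .op .mul 17 15 15, .op .mul 17 17 60, .op .mul 17 17 47, .op .mul 17 17 47]) (block [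
  .const 60 372, .op .mul 19 18 60, .const 60 0, .op .add 12 0 60, .op .add 13 12 3,
  .op .add 14 13 6, .const 20 1, .const 22 0, .op .mul 50 47 47, .op .mul 50 50 50,
  .op .lt 48 50 3])

theorem wp_paramProg {N ℓ M n S : ℕ} (h0 : s.reg 0 = N) (h3 : s.reg 3 = n) (h6 : s.reg 6 = n * n)
    (h11 : s.reg 11 = S) (h18 : s.reg 18 = ℓ) (h47 : s.reg 47 = M) (hm0 : 1600 ≤ m) (hS : S + 1 ≤ m)
    (hℓ : 372 * ℓ + 5 ≤ m) (hK : 1600 * ((ℓ + 5) * (ℓ + 5)) * M * M ≤ m)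
    (hK' : 1600 * ((ℓ + 5) * (ℓ + 5)) * M ≤ m) (hK'' : 1600 * ((ℓ + 5) * (ℓ + 5)) ≤ m)
    (hN : N + n + n * n ≤ m) (hM : M ^ 4 ≤ m) (hM' : M * M ≤ m) :
    WP m paramProg 45 (fun s' r' => r' = r ∧ s'.mem = s.mem ∧ s'.reg 11 = S + 1 ∧ s'.reg 12 = N ∧
      s'.reg 13 = N + n ∧ s'.reg 14 = N + n + n * n ∧ s'.reg 15 = ℓ + 5 ∧ s'.reg 16 = 3 * ℓ ∧
      s'.reg 17 = 1600 * (ℓ + 5) ^ 2 * M ^ 2 ∧ s'.reg 19 = 372 * ℓ ∧ s'.reg 20 = 1 ∧ s'.reg 22 = 0 ∧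
      s'.reg 48 = if M ^ 4 < n then 1 else 0) s r := by
  have e1 : (ℓ + 5) * (ℓ + 5) * 1600 = 1600 * ((ℓ + 5) * (ℓ + 5)) := by ring
  have e2 : M * M * (M * M) = M ^ 4 := by ring
  have e3 : 1600 * ((ℓ + 5) * (ℓ + 5)) * M * M = 1600 * (ℓ + 5) ^ 2 * M ^ 2 := by
    rw [sq, sq, mul_assoc _ M M]
  have hm : 1 ≤ m := by omega
  refine WP.block_seq (t' := 22) hm (by simp) ?_ (WP.block_le hm (by simp) ?_ ?_ (by simp))
    (by simp)
  · simp only [Fine, Fine1, exec1, BinOp.eval, Store.setReg_reg, Nat.reduceEqDiff,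
      if_false, if_true, h11, h18, h47, e1, and_true]
    omega
  · simp only [Fine, Fine1, exec, exec1, BinOp.eval, Store.setReg_reg, Nat.reduceEqDiff, if_false, if_true, h0, h3, h6, h18, h47, e2, and_true]
    omega
  · refine ⟨rfl, rfl, ?_⟩
    simp only [exec, exec1, BinOp.eval, Store.setReg_reg, Nat.reduceEqDiff,
      if_false, if_true, h0, h3, h6, h11, h18, h47, e1, e2]
    refine ⟨trivial, by omega, by omega, by omega, trivial, by omega, e3, Nat.mul_comm _ _, trivial,
      trivial, trivial⟩

/-- All computations before the main loop. -/
def setupProg (κ : ℕ) : Program :=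
  .seq headerProg (.seq precisionProg (.seq sizeProg (.seq (block [.const 60 2, .op .add 54 9 60])
    (.seq (powProg κ) paramProg))))

/-- The parameters of the algorithm; `N` is the length of the input and `M` is the precision. -/
def params (I : NWTInstance) (P : Program) (κ b T N M : ℕ) : Par where
  P := P
  κ := κ
  b := b
  T := T
  v := 186 * I.n.size
  σ := I.n.size
  K := 1600 * (I.n.size + 5) ^ 2 * M ^ 2
  J := 3 * I.n.size
  L := I.n.size + 5
  dA := N
  rA := N + I.n

/-- The running time of `setupProg`. -/
def setupTime (I : NWTInstance) (κ : ℕ) : ℕ := I.wordLen * 16 + 2 * κ + 150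

/-- The number `Z` dominates the input length and the base of the encoding, and every intermediate
result is a small power of it. The arrays of dead vertices and random numbers lie behind the input,
where the memory is zero, so they need no initialisation. The registers `48` and `22` prepare the
choice between sampling and exact counting. -/
theorem wp_setupProg {N lp lq pt qt Z P κ b T M} (h0 : s.reg 0 = N)
    (hmem : ∀ t < I.encLen, s.mem t = I.word t) (hfree : ∀ a, N ≤ a → s.mem a = 0)
    (h1 : s.mem I.encLen = lp) (h2 : s.mem (I.encLen + 1) = lq)
    (h3 : s.mem (I.encLen + 1 + lp) = pt) (h4 : s.mem (I.encLen + 1 + lp + lq) = qt)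
    (hM : M = precision (2 ^ I.wordLen) lp lq pt qt)
    (hBZ : 2 ^ I.wordLen ≤ Z) (hqt : qt < 2 ^ I.wordLen) (hN : I.encLen + 2 + lp + lq = N)
    (hNZ : N + 2 ≤ Z) (hZ0 : 2000 ≤ Z) (hZ : Z ^ 16 ≤ m) (hS : (I.encLen + 2) ^ κ + 1 ≤ m) :
    WP m (setupProg κ) (setupTime I κ) (fun s' r' => r' = r ∧
      St I (params I P κ b T N M) (fun _ => 0) (fun _ => 0) s' ∧
      s'.reg 14 = N + I.n + I.n * I.n ∧ s'.reg 20 = 1 ∧ s'.reg 22 = 0 ∧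
      s'.reg 48 = if M ^ 4 < I.n then 1 else 0) s r := by
  have hB := I.two_le_two_pow_wordLen
  have hlen : I.encLen = 3 + I.n + I.n * I.n + I.n * I.n * (I.numWords + 1) := rfl
  have pw : ∀ i ≤ 16, Z ^ i ≤ m := fun i hi => (Nat.pow_le_pow_right (by omega) hi).trans hZ
  have z1 : Z ≤ m := by simpa using pw 1 (by omega)
  have hsz : I.n.size ≤ I.n := Nat.size_le.2 Nat.lt_two_pow_self
  have hMle : M ≤ 2 * Z ^ 3 := hM ▸ (precision_le hB hBZ hqt (by omega : lq ≤ Z)).2.2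
  have hM4 : M ≤ Z ^ 4 := hMle.trans (by
    rw [pow_succ' Z 3]
    exact Nat.mul_le_mul_right _ (by omega))
  have hMM : M * M ≤ Z ^ 8 := by
    calc M * M ≤ Z ^ 4 * Z ^ 4 := Nat.mul_le_mul hM4 hM4
      _ = Z ^ 8 := by ring
  have hℓ : (I.n.size + 5) * (I.n.size + 5) ≤ Z ^ 2 := by
    rw [sq]; exact Nat.mul_le_mul (by omega) (by omega)
  have hK'' : 1600 * ((I.n.size + 5) * (I.n.size + 5)) ≤ Z ^ 3 := by
    rw [pow_succ' Z 2]
    exact Nat.mul_le_mul (by omega) hℓ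
  have hK' : 1600 * ((I.n.size + 5) * (I.n.size + 5)) * M ≤ Z ^ 7 := by
    rw [show Z ^ 7 = Z ^ 3 * Z ^ 4 by ring]
    exact Nat.mul_le_mul hK'' hM4
  have hK : 1600 * ((I.n.size + 5) * (I.n.size + 5)) * M * M ≤ Z ^ 11 := by
    rw [show Z ^ 11 = Z ^ 7 * Z ^ 4 by ring]
    exact Nat.mul_le_mul hK' hM4
  have hMf : M ^ 4 ≤ Z ^ 16 := by
    rw [show Z ^ 16 = (Z ^ 4) ^ 4 by ring]
    exact Nat.pow_le_pow_left hM4 4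
  have hZ2 : 2000 * Z ≤ Z ^ 2 := by rw [sq]; exact Nat.mul_le_mul_right _ hZ0
  have z2 := pw 2 (by omega)
  have hnw : I.numWords + 1 ≤ m := by
    refine le_trans ?_ z1
    rcases Nat.eq_zero_or_pos I.n with hn | hn
    · have : I.bitLen = 0 := by
        have : IsEmpty (Fin I.n) := by rw [hn]; infer_instance
        simp [NWTInstance.bitLen]
      simp [NWTInstance.numWords, this]; omega
    · have := Nat.le_mul_of_pos_left (I.numWords + 1) (Nat.mul_pos hn hn)
      omega
  unfold setupTime
  refine WP.seq_le (t' := I.wordLen * 16 + 2 * κ + 109) (WP.conseq (wp_headerProg hmem (by omega)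
    (by omega) hnw) le_rfl ?_) (by omega)
  rintro s₁ r₁ _ f1 ⟨rfl, m1, E1, w1⟩
  refine WP.seq_le (t' := I.wordLen * 16 + 2 * κ + 65) (WP.conseq (wp_precisionProg (Z := Z) E1.B
    E1.len (by rw [m1, h1]) (by rw [m1, h2]) (by rw [m1, h3]) (by rw [m1, h4]) hB hBZ hqt (by omega)
    ?_) le_rfl ?_) (by omega)
  · refine le_trans ?_ (pw 4 (by omega))
    rw [pow_succ' Z 3]
    exact Nat.mul_le_mul_right _ (by omega)
  rintro s₂ r₂ _ f2 ⟨rfl, m2, k2⟩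
  rw [← hM] at k2
  have g2 : ∀ q, q < 40 ∨ q = 44 → s₂.reg q = s₁.reg q := fun q hq => f2 q fun h => by
    simp [precisionProg, block, writes] at h; omega
  refine WP.seq_le (t' := 2 * κ + 56) (WP.conseq (wp_sizeProg (n := I.n) (l := I.wordLen)
    (by rw [g2 3 (by omega), E1.n]) (by rw [g2 44 (by omega), w1])
    (by rw [NWTInstance.wordLen]; have := Nat.size_le_size (show I.n ≤ I.n + I.bitLen by omega); omega)
    (by omega)) le_rfl ?_) (by omega)
  rintro s₃ r₃ _ f3 ⟨rfl, m3, k3⟩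
  have g3 : ∀ q, q ≠ 18 → q < 50 → s₃.reg q = s₂.reg q := fun q hq hq' => f3 q fun h => by
    simp [sizeProg, forLoop, block, writes] at h; omega
  have e9 : s₃.reg 9 = I.encLen := by rw [g3 9 (by omega) (by omega), g2 9 (by omega), E1.len]
  refine WP.block_seq (t' := 2 * κ + 50) (by omega) (by simp)
    (by simp [Fine, Fine1, exec1, e9]; omega) ?_
    (by simp only [List.length_cons, List.length_nil]; omega)
  refine WP.seq_le (t' := 45) (WP.conseq (wp_powProg (k := κ) (a := I.encLen + 2)
    (by simp [exec, exec1, BinOp.eval, e9]) (by omega) (by omega)) le_rfl ?_) (by omega)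
  rintro s₄ r₄ _ f4 ⟨rfl, m4, k4⟩
  have g4 : ∀ q, q ≠ 11 → q < 50 → s₄.reg q = s₃.reg q := fun q hq hq' => by
    rw [f4 q fun h => hq (writes_powProg h)]
    simp [exec, exec1, show q ≠ 54 by omega, show q ≠ 60 by omega]
  have g42 : ∀ q, q ≠ 11 → q ≠ 18 → q < 40 → s₄.reg q = s₁.reg q := fun q h1 h2 h3 => by
    rw [g4 q h1 (by omega), g3 q h2 (by omega), g2 q (by omega)]
  have e0 : s₁.reg 0 = N := by
    rw [f1 0 (by simp [headerProg, block, writes]), h0]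
  have mm : s₄.mem = s.mem := by rw [m4, ← m1, ← m2, ← m3]; rfl
  refine WP.conseq (wp_paramProg (N := N) (ℓ := I.n.size) (M := M) (n := I.n) (S := (I.encLen + 2) ^ κ)
    (by rw [g42 0 (by omega) (by omega) (by omega), e0])
    (by rw [g42 3 (by omega) (by omega) (by omega), E1.n])
    (by rw [g42 6 (by omega) (by omega) (by omega), E1.nn]) k4
    (by rw [g4 18 (by omega) (by omega), k3])
    (by rw [g4 47 (by omega) (by omega), g3 47 (by omega) (by omega), k2]) (by omega) hS (by omega)
    (hK.trans (pw 11 (by omega))) (hK'.trans (pw 7 (by omega))) (hK''.trans (pw 3 (by omega)))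
    (by omega) (hMf.trans hZ) (hMM.trans (pw 8 (by omega)))) le_rfl ?_
  rintro s₅ r₅ _ f5 ⟨rfl, m5, c11, c12, c13, c14, c15, c16, c17, c19, c20, c22, c48⟩
  have g5 : ∀ q, 3 ≤ q → q ≤ 10 → s₅.reg q = s₁.reg q := fun q h1 h2 => by
    rw [f5 q fun h => by simp [paramProg, block, writes] at h; omega,
      g42 q (by omega) (by omega) (by omega)]
  refine ⟨rfl, ⟨⟨⟨E1.of_eq g5 (fun t _ => by rw [m5, mm, m1]), c11, c12, c13, ?_, le_rfl, c14.ge⟩,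
    fun x _ => ?_, fun x _ => ?_, fun a ha => ?_⟩, c15, c16, c17, ?_, ?_⟩, c14, c20, c22, c48⟩
  · simp only [params]; omega
  · rw [m5, mm]; exact hfree _ (by simp only [params]; omega)
  · rw [m5, mm]; exact hfree _ (by simp only [params]; omega)
  · rw [m5, mm]; exact hfree _ (by omega)
  · rw [f5 18 (by simp [paramProg, block, writes]), g4 18 (by omega) (by omega), k3]; rfl
  · rw [c19]; simp only [params]; omega

/-- Counts the negative triangles exactly. -/
def bruteProg : Program :=
  forLoop 23 3 (.seq (block [.const 60 0, .op .add 31 23 60]) (.seq degProg (.op .add 22 22 32)))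

/-- The running time of `bruteProg`. -/
def bruteTime (I : NWTInstance) : ℕ := I.n * (degTime I + 16) + 6

theorem wp_bruteProg (E : Env I s) (h22 : s.reg 22 = 0) (hm1 : I.encLen ≤ m)
    (hm2 : 10 * 2 ^ I.wordLen + 10 ≤ m) (hm3 : I.degSum (Finset.range I.n) ≤ m) :
    WP m bruteProg (bruteTime I) (fun s' r' => r' = r ∧
      s'.reg 22 = I.degSum (Finset.range I.n)) s r := by
  have hw : ∀ {q}, writes bruteProg q → 22 ≤ q := fun {q} h => by
    simp only [bruteProg, forLoop, block, writes] at h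
    have h1 := @writes_degProg q
    by_cases h2 : writes degProg q
    · have := h1 h2; omega
    · simp only [h2, false_or] at h; omega
  have hlen : I.encLen = 3 + I.n + I.n * I.n + I.n * I.n * (I.numWords + 1) := rfl
  refine WP.conseq (WP.forLoop (n := I.n) (tb := degTime I + 8) (fun t s' r' => r' = r ∧
    s'.mem = s.mem ∧ s'.reg 22 = I.degSum (Finset.range t)) (by omega) E.n (by omega) (by omega)
    (by omega) ?_ ?_ ?_ ?_) le_rfl ?_
  · rintro (h | h | h)
    · simp [block, writes] at h
    · have := writes_degProg h; omega
    · simp [writes] at h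
  · rintro (h | h | h)
    · simp [block, writes] at h
    · have := writes_degProg h; omega
    · simp [writes] at h
  · intro v
    simp [h22, NWTInstance.degSum]
  · rintro a ha s₁ r₁ _ f1 hi ⟨rfl, k1, k2⟩
    have g1 : ∀ q, q < 22 → s₁.reg q = s.reg q := fun q hq => f1 q fun h => by
      have := hw h; omega
    have hsum : I.degSum (Finset.range a) + I.deg a ≤ m := by
      refine le_trans ?_ hm3
      have := NWTInstance.degSum_mono (I := I) (Finset.range_subset_range.2 (show a + 1 ≤ I.n by omega))
      rwa [NWTInstance.degSum, Finset.sum_range_succ] at this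
    refine WP.block_seq (t' := degTime I + 2) (by omega) (by simp)
      (by simp [Fine, Fine1, exec1, hi]; omega) ?_
      (by simp only [List.length_cons, List.length_nil]; omega)
    refine WP.seq_le (t' := 1) (WP.conseq (wp_degProg ha hm1 hm2 (E.of_eq (fun q h1 h2 => ?_)
      (fun t _ => ?_)) ?_) le_rfl ?_) (by omega)
    · simp [exec, exec1, show q ≠ 31 by omega, show q ≠ 60 by omega, g1 q (by omega)]
    · simp [exec, exec1, k1]
    · simp [exec, exec1, BinOp.eval, hi]
    · rintro s₂ r₂ _ f2 ⟨d1, d2, rfl⟩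
      have e22 : s₂.reg 22 = I.degSum (Finset.range a) := by
        rw [f2 22 fun h => by have := writes_degProg h; omega]
        simp [exec, exec1, k2]
      refine WP.op (by simp only [BinOp.eval, e22, d1]; exact hsum) ?_
      intro v
      refine ⟨rfl, ?_, ?_⟩
      · simp [d2, exec, exec1, k1]
      · simp [BinOp.eval, e22, d1, NWTInstance.degSum, Finset.sum_range_succ]
  · rintro s₁ r₁ _ _ ⟨rfl, -, h⟩
    exact ⟨rfl, h⟩

end RAM

namespace RAM

variable {m : ℕ} {I : NWTInstance} {s : Store} {r : ℝ}

/-- The errors of the queries have a small total probability. -/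
theorem total_error_le {n M : ℕ} (hM0 : 0 < M) (hn : M ^ 4 < n) :
    ((n.size + 5 : ℕ) : ℝ) * ((3 * n.size : ℕ) * ((1600 * (n.size + 5) ^ 2 * M ^ 2 : ℕ) *
      (n.size * (8 / 9) ^ (186 * n.size)))) ≤ 1 / 20 := by
  set ℓ := n.size with hℓ
  have hℓ1 : 1 ≤ ℓ := Nat.size_pos.2 (by omega)
  have hw : n < 2 ^ ℓ := Nat.lt_size_self n
  have hM : M ^ 2 ≤ 2 ^ ℓ := (Nat.pow_le_pow_right hM0 (by norm_num)).trans (hn.le.trans hw.le)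
  have hℓw : ℓ ≤ 2 ^ ℓ := Nat.lt_two_pow_self.le
  -- As `M ^ 4 < n ≤ 2 ^ ℓ`, the number of votes is polynomial in `2 ^ ℓ`.
  have h1 : (n.size + 5) * ((3 * ℓ) * ((1600 * (ℓ + 5) ^ 2 * M ^ 2) * ℓ)) * 20 ≤ (2 ^ ℓ) ^ 31 := by
    calc (ℓ + 5) * ((3 * ℓ) * ((1600 * (ℓ + 5) ^ 2 * M ^ 2) * ℓ)) * 20
        ≤ (6 * 2 ^ ℓ) * ((3 * 2 ^ ℓ) * ((1600 * (6 * 2 ^ ℓ) ^ 2 * 2 ^ ℓ) * 2 ^ ℓ)) * 20 := by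
          gcongr <;> omega
      _ = 20736000 * (2 ^ ℓ) ^ 6 := by ring
      _ ≤ (2 ^ ℓ) ^ 25 * (2 ^ ℓ) ^ 6 := by
          gcongr
          calc 20736000 ≤ (2 ^ 1) ^ 25 := by norm_num
            _ ≤ (2 ^ ℓ) ^ 25 := by gcongr; norm_num
      _ = (2 ^ ℓ) ^ 31 := by ring
  -- The constant is `186 = 6 * 31`, because `(8/9) ^ 6 ≤ 1/2`.
  have h2 : ((8 : ℝ) / 9) ^ (186 * ℓ) ≤ 1 / (2 ^ ℓ) ^ 31 := by
    calc ((8 : ℝ) / 9) ^ (186 * ℓ) = (((8 : ℝ) / 9) ^ 6) ^ (ℓ * 31) := by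
          rw [← pow_mul]; congr 1; ring
      _ ≤ (1 / 2) ^ (ℓ * 31) := pow_le_pow_left₀ (by positivity) (by norm_num) _
      _ = _ := by rw [one_div_pow, pow_mul]
  have h3 : (((n.size + 5) * ((3 * ℓ) * ((1600 * (ℓ + 5) ^ 2 * M ^ 2) * ℓ)) * 20 : ℕ) : ℝ) ≤
      (((2 ^ ℓ) ^ 31 : ℕ) : ℝ) := by exact_mod_cast h1
  have hpos : (0 : ℝ) < (2 ^ ℓ) ^ 31 := by positivity
  push_cast at h3 ⊢
  simp only [← hℓ] at h3 ⊢
  calc ((ℓ : ℝ) + 5) * (3 * ℓ * (1600 * (ℓ + 5) ^ 2 * M ^ 2 * (ℓ * (8 / 9) ^ (186 * ℓ))))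
      ≤ ((ℓ : ℝ) + 5) * (3 * ℓ * (1600 * (ℓ + 5) ^ 2 * M ^ 2 * (ℓ * (1 / (2 ^ ℓ : ℝ) ^ 31)))) := by
        gcongr
    _ = (((ℓ : ℝ) + 5) * (3 * ℓ * (1600 * (ℓ + 5) ^ 2 * M ^ 2 * ℓ)) * 20) / (2 ^ ℓ : ℝ) ^ 31 / 20 := by
        field_simp
    _ ≤ 1 / 20 := by
        gcongr
        rw [div_le_one hpos]
        exact h3

/-- The running time of the main loop. -/
def mainTime (I : NWTInstance) (p : Par) : ℕ := p.L * (levelTime I p + 8) + 6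

theorem degSum_le : I.degSum (Finset.range I.n) ≤ I.n ^ 3 := by
  refine (Finset.sum_le_card_nsmul _ _ (I.n * I.n) fun a _ => I.deg_le a).trans ?_
  simp
  apply le_of_eq
  ring

theorem two_pow_size_le {n : ℕ} (hn : 0 < n) : 2 ^ n.size ≤ 2 * n := by
  have h1 : 0 < n.size := Nat.size_pos.2 hn
  have h2 : 2 ^ (n.size - 1) ≤ n := Nat.lt_size.1 (by omega)
  have h3 : 2 ^ n.size = 2 * 2 ^ (n.size - 1) := by rw [← pow_succ', Nat.sub_add_cancel h1]
  omega

/-- The choices are `q = M`, `X = 40 * L * M ^ 2` and `K = 40 * X * L`. Moreover `2 ^ J ≥ n ^ 3 ≥ e`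
and `2 ^ L ≥ 32 * n`. The condition `M ^ 4 < n` makes the number of calls polynomial, which keeps
the addresses of the fresh memory blocks within the word size and the total error of the queries
below 1/20. -/
theorem wp_mainLoop_params {P : Program} {κ b T N M Z : ℕ} (O : Oracle I P κ b T)
    (hM0 : 0 < M) (hM : M ^ 4 < I.n)
    (S : St I (params I P κ b T N M) (fun _ => 0) (fun _ => 0) s)
    (h14 : s.reg 14 = N + I.n + I.n * I.n) (h20 : s.reg 20 = 1) (h22 : s.reg 22 = 0)
    (hEN : I.encLen ≤ N) (hNZ : N + 2 ≤ Z) (hBZ : 2 ^ I.wordLen ≤ Z) (hZ0 : 2000 ≤ Z)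
    (hm : m = Z ^ (κ + 20)) :
    WP m (mainLoop P b) (mainTime I (params I P κ b T N M)) (fun s' r' => r' < 1 → 0 ≤ r' ∧
      |(s'.reg 22 : ℝ) - I.degSum (Finset.range I.n)| * M ≤ I.degSum (Finset.range I.n)) s (1 / 3) := by
  set p := params I P κ b T N M with hp
  have hn0 : 0 < I.n := by omega
  have hlen : I.encLen = 3 + I.n + I.n * I.n + I.n * I.n * (I.numWords + 1) := rfl
  have hnE : I.n + 5 ≤ Z := by omega
  have hsz : I.n.size ≤ I.n := Nat.size_le.2 Nat.lt_two_pow_self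
  have hsz1 : 1 ≤ I.n.size := Nat.size_pos.2 hn0
  have pw : ∀ i ≤ κ + 20, Z ^ i ≤ m := fun i hi => hm ▸ Nat.pow_le_pow_right (by omega) hi
  have z2 := pw 2 (by omega)
  have hZ2 : 2000 * Z ≤ Z ^ 2 := by rw [sq]; exact Nat.mul_le_mul_right _ hZ0
  have hMn : M ^ 2 ≤ I.n := (Nat.pow_le_pow_right hM0 (by norm_num)).trans hM.le
  have hK : p.K ≤ Z ^ 4 := by
    change 1600 * (I.n.size + 5) ^ 2 * M ^ 2 ≤ Z ^ 4
    calc _ ≤ Z * Z ^ 2 * Z := by gcongr <;> omega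
      _ = Z ^ 4 := by ring
  have hstride : p.stride I ≤ Z ^ (κ + 1) := by
    change (I.encLen + 2) ^ κ + 1 ≤ Z ^ (κ + 1)
    have h1 : (I.encLen + 2) ^ κ ≤ Z ^ κ := Nat.pow_le_pow_left (by omega) κ
    have h2 : 1 ≤ Z ^ κ := Nat.one_le_pow _ _ (by omega)
    rw [pow_succ]
    nlinarith
  have hchunk : p.chunk I ≤ Z ^ (κ + 4) := by
    change I.n.size * (2 * (186 * I.n.size)) * p.stride I ≤ Z ^ (κ + 4)
    calc _ ≤ Z * (Z * Z) * Z ^ (κ + 1) := by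
          refine Nat.mul_le_mul (Nat.mul_le_mul (by omega) ?_) hstride
          calc 2 * (186 * I.n.size) ≤ 2000 * Z := by omega
            _ ≤ Z * Z := Nat.mul_le_mul_right _ hZ0
      _ = Z ^ (κ + 4) := by ring
  have hJ : p.J ≤ Z ^ 2 := by
    change 3 * I.n.size ≤ _
    omega
  have hL : p.L ≤ Z := by
    change I.n.size + 5 ≤ _
    omega
  have hmem : s.reg 14 + p.L * (p.J * (p.K * p.chunk I)) + 2 * p.stride I ≤ m := by
    have h1 : p.L * (p.J * (p.K * p.chunk I)) ≤ Z ^ (κ + 11) := by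
      calc _ ≤ Z * (Z ^ 2 * (Z ^ 4 * Z ^ (κ + 4))) := by gcongr
        _ = Z ^ (κ + 11) := by ring
    have h2 : p.stride I ≤ Z ^ (κ + 11) := hstride.trans (Nat.pow_le_pow_right (by omega) (by omega))
    have h3 : s.reg 14 ≤ Z ^ (κ + 11) := by
      refine le_trans ?_ (Nat.pow_le_pow_right (show 0 < Z by omega) (show 2 ≤ κ + 11 by omega))
      omega
    have h4 : 4 * Z ^ (κ + 11) ≤ m := by
      refine le_trans ?_ (pw (κ + 12) (by omega))
      rw [pow_succ' Z (κ + 11)]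
      exact Nat.mul_le_mul_right _ (by omega)
    omega
  have h2ℓ := two_pow_size_le hn0
  have hpL : 2 ^ p.L ≤ Z ^ 2 := by
    change 2 ^ (I.n.size + 5) ≤ _
    rw [pow_add]; omega
  have hpJ : 2 ^ p.J ≤ Z ^ 6 := by
    change 2 ^ (3 * I.n.size) ≤ _
    calc 2 ^ (3 * I.n.size) = (2 ^ I.n.size) ^ 3 := by rw [mul_comm, pow_mul]
      _ ≤ (Z ^ 2) ^ 3 := Nat.pow_le_pow_left (by omega) 3
      _ = Z ^ 6 := by ring
  have hdeg : I.degSum (Finset.range I.n) ≤ Z ^ 3 :=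
    degSum_le.trans (Nat.pow_le_pow_left (by omega) 3)
  have hok : p.Ok m I :=
    { oracle := O
      hn := hn0
      hσ := (Nat.lt_size_self _).le
      len_le := by omega
      base_le := by omega
      n_le := by omega
      v_le := by change 10 * (186 * I.n.size) ≤ m; omega }
  set X : ℝ := 40 * p.L * (M : ℝ) ^ 2 with hX
  have hL0 : 0 < p.L := by change 0 < I.n.size + 5; omega
  have hM1 : (1 : ℝ) ≤ M := by exact_mod_cast hM0
  have hL1 : (1 : ℝ) ≤ p.L := by exact_mod_cast hL0
  have hX1 : 1 ≤ X := by
    have : (1 : ℝ) ≤ (M : ℝ) ^ 2 := one_le_pow₀ hM1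
    nlinarith
  have hKX : 40 * X * p.L = p.K := by
    have h1 : (p.L : ℝ) = I.n.size + 5 := by simp [hp, params]
    have h2 : (p.K : ℝ) = 1600 * (I.n.size + 5) ^ 2 * M ^ 2 := by simp [hp, params]
    rw [hX, h1, h2]; ring
  have hK0 : 0 < p.K := by
    have : (0 : ℝ) < p.K := by rw [← hKX]; positivity
    exact_mod_cast this
  have hpot : IsPotential I p (totalTheta I p X M) := by
    refine isPotential hM1 (by linarith) hK0 hX.symm hKX.le (by change 0 < 3 * I.n.size; omega) ?_
    have h1 : I.degSum (Finset.range I.n) ≤ 2 ^ p.J := by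
      change _ ≤ 2 ^ (3 * I.n.size)
      rw [mul_comm, pow_mul]
      exact degSum_le.trans (Nat.pow_le_pow_left (Nat.lt_size_self _).le 3)
    have h2 : (I.degSum (Finset.range I.n) : ℝ) ≤ 2 ^ p.J := by exact_mod_cast h1
    have h3 : (0 : ℝ) < 2 ^ p.J := by positivity
    nlinarith
  have halive : I.alive (fun _ => 0) = Finset.range I.n := by simp [NWTInstance.alive]
  refine WP.conseq (wp_mainLoop hpot hok S hmem h20 h22 ?_ (hpL.trans z2) (hpJ.trans (pw 6 (by omega)))
    (totalTheta_zero_le hL0 halive ?_ ?_)) le_rfl ?_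
  · refine le_trans ?_ (pw 5 (by omega))
    calc _ ≤ Z ^ 2 * Z ^ 3 := Nat.mul_le_mul hpL hdeg
      _ = Z ^ 5 := by ring
  · have : 32 * I.n ≤ 2 ^ p.L := by
      change _ ≤ 2 ^ (I.n.size + 5)
      have := Nat.lt_size_self I.n
      rw [pow_add]; omega
    exact_mod_cast this
  · exact total_error_le hM0 hM
  · rintro s' r' _ _ ⟨A, h1, h2, h3, h4⟩ hr
    have h5 := h4 hr
    refine ⟨le_trans ?_ h5, abs_sub_mul_le (by linarith) h1 (lt_of_le_of_lt h5 hr)⟩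
    have h6 := theta_nonneg (I := I) (L := p.L) (q := M) (i := p.L) (z := s'.reg 22) (A := A)
      (show 0 < X by linarith)
    rw [totalTheta]
    have := le_min zero_le_one h6
    positivity

/-- The approximate counting algorithm. -/
def countProg (P : Program) (κ b : ℕ) : Program :=
  .seq (setupProg κ) (.seq (.cond 48 (mainLoop P b) bruteProg)
    (block [.const 60 0, .op .add 0 22 60, .const 1 1]))

/-- The final registers contain a good approximation. -/
def Approximates (I : NWTInstance) (ε : ℚ) (s : Store) : Prop :=
  s.reg 1 ≠ 0 ∧
    |(s.reg 0 : ℚ) / (s.reg 1 : ℚ) - (I.numNegTriangles : ℚ)| ≤ ε * (I.numNegTriangles : ℚ)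

/-- Without removed edges the query is the input itself, and the decision program has to hold its
words; no estimate of the encoding is needed. -/
theorem word_le_of_oracle {P : Program} {κ b T : ℕ} (O : Oracle I P κ b T) (t : ℕ) :
    I.word t ≤ (I.encLen + 2) ^ κ := by
  have h := (O.good fun _ _ => False).fits.2 t
  have h2 : (I.restrict fun _ _ => False).word t = I.word t := by simp [NWTInstance.word_restrict]
  rw [← h2]
  exact h

/-- The position of the tolerance in the memory, and the properties of the precision. -/
theorem exists_layout {ε : ℚ} (hε0 : 0 < ε) (hε1 : ε < 1) : ∃ lp lq pt qt : ℕ,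
    I.encLen + 2 + lp + lq = (I.encodeWithTolerance ε).length ∧
    (∀ t < I.encLen, (I.encodeWithTolerance ε).getD t 0 = I.word t) ∧
    (I.encodeWithTolerance ε).getD I.encLen 0 = lp ∧
    (I.encodeWithTolerance ε).getD (I.encLen + 1) 0 = lq ∧
    (I.encodeWithTolerance ε).getD (I.encLen + 1 + lp) 0 = pt ∧
    (I.encodeWithTolerance ε).getD (I.encLen + 1 + lp + lq) 0 = qt ∧
    qt < 2 ^ I.wordLen ∧
    (∀ t, I.encLen ≤ t → (I.encodeWithTolerance ε).getD t 0 ≤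
      max (2 ^ I.wordLen) (I.encodeWithTolerance ε).length) ∧
    0 < precision (2 ^ I.wordLen) lp lq pt qt ∧ precision (2 ^ I.wordLen) lp lq pt qt * ε ≤ 5 ∧
    (1 ≤ precision (2 ^ I.wordLen) lp lq pt qt * ε ∨
      precision (2 ^ I.wordLen) lp lq pt qt = 2 ^ I.wordLen) := by
  have hB2 : 2 ≤ 2 ^ I.wordLen := I.two_le_two_pow_wordLen
  have hnum : 0 < ε.num := Rat.num_pos.2 hε0
  have ha0 : 0 < ε.num.natAbs := by omega
  have hq0 : 0 < ε.den := ε.den_pos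
  have hεaq : ε = (ε.num.natAbs : ℚ) / ε.den := by
    have h1 : (ε.num.natAbs : ℤ) = ε.num := by omega
    have h2 : (ε.num.natAbs : ℚ) = ε.num := by rw [← h1, Int.cast_natCast]; simp
    rw [h2]; exact (Rat.num_div_den ε).symm
  have hq0' : (0 : ℚ) < ε.den := by exact_mod_cast hq0
  have haq : ε.num.natAbs < ε.den := by
    have h1 : (ε.num.natAbs : ℚ) < ε.den := by rwa [hεaq, div_lt_one hq0'] at hε1
    exact_mod_cast h1
  have hx : I.encodeWithTolerance ε = I.encode ++ ([(Nat.digits (2 ^ I.wordLen) ε.num.natAbs).length,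
      (Nat.digits (2 ^ I.wordLen) ε.den).length] ++ (Nat.digits (2 ^ I.wordLen) ε.num.natAbs ++
      Nat.digits (2 ^ I.wordLen) ε.den)) := by
    simp [NWTInstance.encodeWithTolerance]
  rw [hx]
  generalize 2 ^ I.wordLen = B at *
  generalize ε.num.natAbs = a at *
  generalize ε.den = q at *
  obtain ⟨p1, p2, p3, p4, p5⟩ := Nat.top_digit hB2 ha0
  obtain ⟨q1, q2, q3, q4, q5⟩ := Nat.top_digit hB2 hq0
  have hlpq := Nat.le_length_digits_le B a q haq.le
  have hda : ∀ x ∈ Nat.digits B a, x < B := fun x hx => Nat.digits_lt_base (by omega) hx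
  have hdq : ∀ x ∈ Nat.digits B q, x < B := fun x hx => Nat.digits_lt_base (by omega) hx
  obtain ⟨M1, M2, M3⟩ := precision_spec hB2 haq p1 p2 q2 hlpq p4 p5 p3 q4 q5
  generalize Nat.digits B a = la at *
  generalize Nat.digits B q = l at *
  have hlen := I.length_encode
  have hge : ∀ t, (I.encode ++ ([la.length, l.length] ++ (la ++ l))).getD (I.encLen + t) 0 =
      ([la.length, l.length] ++ (la ++ l)).getD t 0 := fun t => by
    rw [List.getD_append_right _ _ _ _ (by omega), hlen, Nat.add_sub_cancel_left]
  have hge2 : ∀ t, (I.encode ++ ([la.length, l.length] ++ (la ++ l))).getD (I.encLen + (2 + t)) 0 =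
      (la ++ l).getD t 0 := fun t => by
    rw [hge, List.getD_append_right _ _ _ _ (by simp)]
    simp
  refine ⟨la.length, l.length, la.getD (la.length - 1) 0, l.getD (l.length - 1) 0, ?_, ?_, hge 0,
    hge 1, ?_, ?_, q3, ?_, M1, ?_, ?_⟩
  · simp [hlen]; omega
  · intro t ht
    rw [List.getD_append _ _ _ _ (by omega)]; rfl
  · rw [show I.encLen + 1 + la.length = I.encLen + (2 + (la.length - 1)) by omega, hge2,
      List.getD_append _ _ _ _ (by omega)]
  · rw [show I.encLen + 1 + la.length + l.length = I.encLen + (2 + (la.length + (l.length - 1))) by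
      omega, hge2, List.getD_append_right _ _ _ _ (by omega), Nat.add_sub_cancel_left]
  · intro t ht
    rw [show t = I.encLen + (t - I.encLen) by omega, hge]
    by_cases h : t - I.encLen < ([la.length, l.length] ++ (la ++ l)).length
    · rw [List.getD_eq_getElem _ _ h]
      have h2 := List.getElem_mem h
      generalize ([la.length, l.length] ++ (la ++ l))[t - I.encLen] = x at h2
      simp only [List.mem_append, List.mem_cons, List.not_mem_nil, or_false] at h2
      simp only [List.length_append, List.length_cons, List.length_nil]
      rcases h2 with (h2 | h2) | h2 | h2
      · omega
      · omega
      · have := hda _ h2; omega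
      · have := hdq _ h2; omega
    · rw [List.getD_eq_default _ _ (by omega)]
      exact Nat.zero_le _
  · rw [hεaq, mul_div_assoc', div_le_iff₀ hq0']
    exact_mod_cast M2
  · refine M3.imp (fun h => ?_) id
    rw [hεaq, mul_div_assoc', le_div_iff₀ hq0', one_mul]
    exact_mod_cast h

/-- Sampling yields an error of at most `e / M`, which is good enough if `1 ≤ M * ε`. For `M ^ 4 ≥
n` the count is exact and the value of `M` plays no role for correctness. -/
theorem wp_countProg {P : Program} {κ b T N lp lq pt qt Z M : ℕ} {ε : ℚ} (O : Oracle I P κ b T)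
    (hε0 : 0 < ε) (s0 : s.reg 0 = N) (hword : ∀ t < I.encLen, s.mem t = I.word t)
    (sfree : ∀ a, N ≤ a → s.mem a = 0)
    (e1 : s.mem I.encLen = lp) (e2 : s.mem (I.encLen + 1) = lq)
    (e3 : s.mem (I.encLen + 1 + lp) = pt) (e4 : s.mem (I.encLen + 1 + lp + lq) = qt)
    (hM : M = precision (2 ^ I.wordLen) lp lq pt qt) (M1 : 0 < M)
    (M3 : 1 ≤ M * ε ∨ M = 2 ^ I.wordLen)
    (hBZ : 2 ^ I.wordLen ≤ Z) (hqt : qt < 2 ^ I.wordLen) (hN : I.encLen + 2 + lp + lq = N)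
    (hNZ : N + 2 ≤ Z) (hZ0 : 2000 ≤ Z) (hm : m = Z ^ (κ + 20)) :
    WP m (countProg P κ b) (setupTime I κ +
      (if M ^ 4 < I.n then mainTime I (params I P κ b T N M) else bruteTime I) + 20)
      (fun s' r' => r' < 1 → 0 ≤ r' ∧ Approximates I ε s') s (1 / 3) := by
  have pw : ∀ i ≤ κ + 20, Z ^ i ≤ m := fun i hi => hm ▸ Nat.pow_le_pow_right (by omega) hi
  have hEκ : (I.encLen + 2) ^ κ ≤ Z ^ κ := Nat.pow_le_pow_left (by omega) κ
  have hstr : (I.encLen + 2) ^ κ + 1 ≤ m := by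
    refine le_trans ?_ (pw (κ + 1) (by omega))
    have h2 : 1 ≤ Z ^ κ := Nat.one_le_pow _ _ (by omega)
    rw [pow_succ]
    nlinarith
  have z2 := pw 2 (by omega)
  have hZ2 : 2000 * Z ≤ Z ^ 2 := by rw [sq]; exact Nat.mul_le_mul_right _ hZ0
  have hdeg : I.degSum (Finset.range I.n) ≤ Z ^ 3 := by
    refine degSum_le.trans (Nat.pow_le_pow_left ?_ 3)
    have : I.n ≤ I.encLen := by rw [NWTInstance.encLen]; omega
    omega
  set p := params I P κ b T N M with hp
  set e := I.degSum (Finset.range I.n) with he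
  refine WP.seq_le (t' := (if M ^ 4 < I.n then mainTime I p else bruteTime I) + 15)
    (WP.conseq (wp_setupProg (I := I) (Z := Z) (κ := κ) (P := P) (b := b) (T := T) (M := M) s0
      hword sfree e1 e2 e3 e4 hM hBZ hqt hN hNZ hZ0 (pw 16 (by omega)) hstr) le_rfl ?_) (by omega)
  rintro s₁ r₁ _ _ ⟨rfl, S, k14, k20, k22, k48⟩
  refine WP.seq_le (t' := 6) (t := 1 + if M ^ 4 < I.n then mainTime I p else bruteTime I)
    (Post := fun s' r' => r' < 1 → 0 ≤ r' ∧ Approximates I ε s')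
    (WP.conseq (Post := fun s' r' => r' < 1 → 0 ≤ r' ∧
      |(s'.reg 22 : ℚ) - e| ≤ ε * e) (WP.cond (fun h => ?_) (fun h => ?_)) le_rfl ?_) (by omega)
  · have hMn : M ^ 4 < I.n := by
      by_contra hc
      rw [if_neg hc] at k48
      exact h k48
    rw [if_pos hMn]
    refine WP.conseq (wp_mainLoop_params O M1 hMn S k14 k20 k22 (by omega) hNZ hBZ hZ0 hm) le_rfl ?_
    intro s₂ r₂ _ _ h2 hr
    obtain ⟨h3, h4⟩ := h2 hr
    refine ⟨h3, ?_⟩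
    -- The exceptional value `M = 2 ^ wordLen` exceeds `n` and cannot occur in this branch.
    have h5 : 1 ≤ M * ε := by
      refine M3.resolve_right fun hMB => ?_
      have := I.n_lt_two_pow_wordLen
      have h5 : M ≤ M ^ 4 := Nat.le_self_pow (by norm_num) _
      omega
    have h6 : |(s₂.reg 22 : ℚ) - e| * M ≤ e := by exact_mod_cast h4
    have h7 : (0 : ℚ) ≤ |(s₂.reg 22 : ℚ) - e| := abs_nonneg _
    calc |(s₂.reg 22 : ℚ) - e| ≤ |(s₂.reg 22 : ℚ) - e| * (M * ε) := le_mul_of_one_le_right h7 h5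
      _ = |(s₂.reg 22 : ℚ) - e| * M * ε := by ring
      _ ≤ e * ε := by gcongr
      _ = ε * e := mul_comm _ _
  · have hMn : ¬ M ^ 4 < I.n := by
      intro hc
      rw [if_pos hc, h] at k48
      exact absurd k48 (by norm_num)
    rw [if_neg hMn]
    refine WP.conseq (wp_bruteProg S.toEnv k22 (by omega) (by omega)
      (hdeg.trans (pw 3 (by omega)))) le_rfl ?_
    rintro s₂ r₂ _ _ ⟨rfl, h2⟩ _
    refine ⟨by norm_num, ?_⟩
    rw [h2, ← he, sub_self, abs_zero]
    positivity
  · intro s₂ r₂ hs₂ _ h2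
    have h22 := hs₂.1 22
    refine WP.block_le (by omega) (by simp) (by simp [Fine, Fine1, exec1]; omega) ?_ (by simp)
    intro hr
    obtain ⟨h3, h4⟩ := h2 hr
    refine ⟨h3, by simp [exec, exec1], ?_⟩
    have : (I.numNegTriangles : ℚ) = e := by rw [I.numNegTriangles_eq]; rfl
    rw [this]
    simpa [exec, exec1, BinOp.eval] using h4

theorem runsIn_countProg {P : Program} {κ b T : ℕ} {ε : ℚ} (O : Oracle I P κ b T) (hε0 : 0 < ε)
    (hε1 : ε < 1) : ∃ M N : ℕ, 0 < M ∧ M * ε ≤ 5 ∧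
      RunsIn (countProg P κ b) (8 * (κ + 20)) (I.encodeWithTolerance ε)
        (setupTime I κ + (if M ^ 4 < I.n then mainTime I (params I P κ b T N M) else bruteTime I) + 20)
        (Approximates I ε) := by
  obtain ⟨lp, lq, pt, qt, hN, hword, e1, e2, e3, e4, hqt, hle, M1, M2, M3⟩ :=
    exists_layout (I := I) hε0 hε1
  generalize hM : precision (2 ^ I.wordLen) lp lq pt qt = M at M1 M2 M3
  refine ⟨M, (I.encodeWithTolerance ε).length, M1, M2, Good.runsIn ?_⟩
  have sfree : ∀ t, (I.encodeWithTolerance ε).length ≤ t → (I.encodeWithTolerance ε).getD t 0 = 0 :=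
    fun t ht => List.getD_eq_default _ _ ht
  generalize hx : I.encodeWithTolerance ε = x at *
  have hE3 : 3 ≤ I.encLen := by rw [NWTInstance.encLen]; omega
  set Z := (x.length + 2) ^ 8 with hZ
  have hZ0 : 2000 ≤ Z :=
    le_trans (by norm_num) (Nat.pow_le_pow_left (show 3 ≤ x.length + 2 by omega) 8)
  have hNZ : x.length + 2 ≤ Z := Nat.le_self_pow (by norm_num) _
  have hBZ : 2 ^ I.wordLen ≤ Z := I.two_pow_wordLen_le.trans (Nat.pow_le_pow_left (by omega) 8)
  have hm : (x.length + 2) ^ (8 * (κ + 20)) = Z ^ (κ + 20) := by rw [pow_mul]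
  rw [hm]
  have z1 : Z ≤ Z ^ (κ + 20) := Nat.le_self_pow (by omega) _
  have hfits : (Store.init x).Fits (Z ^ (κ + 20)) := by
    constructor
    · intro i
      simp only [Store.init, Function.update_apply]
      split <;> omega
    · intro t
      by_cases ht : t < I.encLen
      · refine (hword t ht).trans_le ((word_le_of_oracle O t).trans ?_)
        calc (I.encLen + 2) ^ κ ≤ Z ^ κ := Nat.pow_le_pow_left (by omega) κ
          _ ≤ _ := Nat.pow_le_pow_right (by omega) (by omega)
      · exact (hle t (by omega)).trans (by omega)
  have := wp_countProg (s := Store.init x) (N := x.length) O hε0 (by simp [Store.init]) hword sfree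
    e1 e2 e3 e4 hM.symm M1 M3 hBZ hqt hN hNZ hZ0 rfl (Approximates I ε) [] 0 hfits
    fun s' r' h1 _ h2 => ⟨⟨h1, rfl⟩, ?_⟩
  · simpa using this
  · change failure _ s' ≤ r'
    -- The final credit bounds the indicator of failure: below 1 the result is correct, and
    -- otherwise the bound is trivial.
    by_cases hr : r' < 1
    · obtain ⟨h3, h4⟩ := h2 hr
      rw [failure, if_pos h4]
      exact h3
    · exact (failure_le_one _ _).trans (not_lt.1 hr)

end RAM

/-! ### Running time. -/

namespace RAM

variable {I : NWTInstance}

theorem callTime_add_le (b T : ℕ) : callTime I b T + 10 ≤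
    (221 + 2 * b) * ((I.n + 1) ^ 2 * (I.bitLen + 1)) + 3 * T := by
  have hw : I.numWords ≤ I.bitLen + 1 := Nat.succ_le_succ (Nat.div_le_self _ _)
  have h1 : I.encLen ≤ 5 * ((I.n + 1) ^ 2 * (I.bitLen + 1)) := by
    calc I.encLen = 3 + I.n + 2 * (I.n * I.n) + I.n * I.n * I.numWords := by
          rw [NWTInstance.encLen]; ring
      _ ≤ 3 + I.n + 2 * (I.n * I.n) + I.n * I.n * (I.bitLen + 1) := by gcongr
      _ ≤ _ := by nlinarith [Nat.zero_le (I.n * I.n * I.bitLen), Nat.zero_le (I.n * I.bitLen)]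
  have h2 : I.n * I.n + 1 ≤ (I.n + 1) ^ 2 * (I.bitLen + 1) := by
    calc I.n * I.n + 1 ≤ (I.n + 1) ^ 2 * 1 := by nlinarith
      _ ≤ _ := by gcongr; omega
  have h3 : 2 * b * 1 ≤ 2 * b * ((I.n + 1) ^ 2 * (I.bitLen + 1)) := by gcongr; omega
  rw [callTime, add_mul]
  omega

theorem degTime_add_le : degTime I + 38 ≤ 207 * ((I.n + 1) ^ 2 * (I.bitLen + 1)) := by
  have hw : I.numWords ≤ I.bitLen + 1 := Nat.succ_le_succ (Nat.div_le_self _ _)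
  calc degTime I + 38 ≤ I.n * I.n * ((I.bitLen + 1) * 56 + 105) + 46 := by
        rw [degTime]
        have : I.n * I.n * (I.numWords * 56 + 105) ≤ I.n * I.n * ((I.bitLen + 1) * 56 + 105) := by
          gcongr
        omega
    _ ≤ _ := by nlinarith [Nat.zero_le (I.n * I.n * I.bitLen), Nat.zero_le (I.n * I.bitLen)]

/-- The six logarithmic factors: the number of votes, the depth of the search, two from `K`, the
number of rounds and the number of levels. The factor `M ^ 2` also comes from `K`. All remaining
work is `O(n ^ 2)` per unit of `bitLen + 1` and is absorbed into the cost of a call. -/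
theorem mainTime_le {P : Program} {κ b T N M : ℕ} (hM : 0 < M) :
    mainTime I (params I P κ b T N M) ≤ 600000000 * (I.n.size + 1) ^ 6 * M ^ 2 *
      ((221 + 2 * b) * ((I.n + 1) ^ 2 * (I.bitLen + 1)) + 3 * T) := by
  have h1 := callTime_add_le (I := I) b T
  have h2 := degTime_add_le (I := I)
  have h3 : I.n * 42 + I.n * I.n * 14 + 1 ≤ 70 * ((I.n + 1) ^ 2 * (I.bitLen + 1)) := by
    calc I.n * 42 + I.n * I.n * 14 + 1 ≤ 70 * ((I.n + 1) ^ 2 * 1) := by nlinarith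
      _ ≤ _ := by gcongr; omega
  have h4 : (I.n + 1) ^ 2 * (I.bitLen + 1) ≤
      (221 + 2 * b) * ((I.n + 1) ^ 2 * (I.bitLen + 1)) + 3 * T := by nlinarith
  set D := (I.n + 1) ^ 2 * (I.bitLen + 1) with hD
  have hD1 : 1 ≤ D := by rw [hD]; exact Nat.mul_pos (by positivity) (by omega)
  set G := (221 + 2 * b) * D + 3 * T with hG
  set p := params I P κ b T N M with hp
  set y := I.n.size + 1 with hy
  have hy1 : 1 ≤ y := by omega
  have hM1 : 1 ≤ M ^ 2 := Nat.one_le_pow _ _ hM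
  have hG1 : 1 ≤ G := hD1.trans h4
  have a1 : G ≤ y * G := Nat.le_mul_of_pos_left _ hy1
  have a2 : y * G ≤ y ^ 2 * G := Nat.mul_le_mul_right _ (Nat.le_self_pow (by norm_num) _)
  have a4 : y ^ 2 * G ≤ y ^ 4 * M ^ 2 * G := by
    refine Nat.mul_le_mul_right _ ?_
    calc y ^ 2 = y ^ 2 * 1 := by ring
      _ ≤ y ^ 4 * M ^ 2 := Nat.mul_le_mul (Nat.pow_le_pow_right hy1 (by norm_num)) hM1
  have a5 : y ^ 4 * M ^ 2 * G ≤ y ^ 5 * M ^ 2 * G := by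
    gcongr; omega
  have a6 : y ^ 5 * M ^ 2 * G ≤ y ^ 6 * M ^ 2 * G := by
    gcongr; omega
  have b1 : voteTime I b T (186 * I.n.size) + 30 ≤ 422 * (y * G) := by
    have : 2 * (186 * I.n.size) * (callTime I b T + 10) ≤ 372 * y * G :=
      Nat.mul_le_mul (by omega) h1
    rw [voteTime]; linarith
  have b2 : searchTime I b T (186 * I.n.size) I.n.size ≤ 442 * (y ^ 2 * G) := by
    have : I.n.size * (voteTime I b T (186 * I.n.size) + 30) ≤ y * (422 * (y * G)) :=
      Nat.mul_le_mul (by omega) b1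
    have e : y * (422 * (y * G)) = 422 * (y ^ 2 * G) := by ring
    rw [searchTime]; omega
  have b3 : roundBodyTime I p + 8 ≤ 700 * (y ^ 2 * G) := by
    change searchTime I b T (186 * I.n.size) I.n.size + degTime I + 30 + 8 ≤ _
    omega
  have b4 : roundTime I p + 10 ≤ 30000000 * (y ^ 4 * M ^ 2 * G) := by
    change I.n * I.n * 14 + 1600 * (I.n.size + 5) ^ 2 * M ^ 2 * (roundBodyTime I p + 8) + 20 + 10 ≤ _
    have : 1600 * (I.n.size + 5) ^ 2 * M ^ 2 * (roundBodyTime I p + 8) ≤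
        1600 * (5 * y) ^ 2 * M ^ 2 * (700 * (y ^ 2 * G)) := by gcongr; omega
    have e : 1600 * (5 * y) ^ 2 * M ^ 2 * (700 * (y ^ 2 * G)) =
        28000000 * (y ^ 4 * M ^ 2 * G) := by ring
    omega
  have b5 : levelTime I p + 8 ≤ 100000000 * (y ^ 5 * M ^ 2 * G) := by
    change 3 * I.n.size * (roundTime I p + 10) + (I.n * 42 + 20) + 20 + 8 ≤ _
    have : 3 * I.n.size * (roundTime I p + 10) ≤ 3 * y * (30000000 * (y ^ 4 * M ^ 2 * G)) :=
      Nat.mul_le_mul (by omega) b4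
    have e : 3 * y * (30000000 * (y ^ 4 * M ^ 2 * G)) = 90000000 * (y ^ 5 * M ^ 2 * G) := by ring
    omega
  change (I.n.size + 5) * (levelTime I p + 8) + 6 ≤ _
  have : (I.n.size + 5) * (levelTime I p + 8) ≤ 5 * y * (100000000 * (y ^ 5 * M ^ 2 * G)) :=
    Nat.mul_le_mul (by omega) b5
  have e : 5 * y * (100000000 * (y ^ 5 * M ^ 2 * G)) = 500000000 * (y ^ 6 * M ^ 2 * G) := by ring
  have e2 : 600000000 * y ^ 6 * M ^ 2 * G = 600000000 * (y ^ 6 * M ^ 2 * G) := by ring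
  omega

/-- Exact counting computes `n` degrees, and the branch is taken only for `n ≤ M ^ 4`; this is the
source of `ε ^ (-4)` in the theorem. -/
theorem bruteTime_le {M : ℕ} (hM : 0 < M) (hn : I.n ≤ M ^ 4) :
    bruteTime I ≤ 213 * M ^ 4 * ((I.n + 1) ^ 2 * (I.bitLen + 1)) := by
  have h2 := degTime_add_le (I := I)
  set D := (I.n + 1) ^ 2 * (I.bitLen + 1) with hD
  have hD1 : 1 ≤ D := by rw [hD]; exact Nat.mul_pos (by positivity) (by omega)
  have hM1 : 1 ≤ M ^ 4 := Nat.one_le_pow _ _ hM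
  have h3 : I.n * (degTime I + 16) ≤ M ^ 4 * (207 * D) := Nat.mul_le_mul hn (by omega)
  have h4 : 1 ≤ M ^ 4 * D := Nat.mul_pos hM1 hD1
  rw [bruteTime]
  linarith

theorem setupTime_le (κ : ℕ) : setupTime I κ + 20 ≤
    (202 + 2 * κ) * ((I.n + 1) ^ 2 * (I.bitLen + 1)) := by
  have h1 : I.wordLen ≤ I.n + I.bitLen + 1 :=
    Nat.succ_le_succ (Nat.size_le.2 Nat.lt_two_pow_self)
  have h2 : I.n + I.bitLen + 1 ≤ (I.n + 1) ^ 2 * (I.bitLen + 1) := by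
    calc I.n + I.bitLen + 1 ≤ (I.n + 1) * (I.bitLen + 1) := by nlinarith
      _ ≤ _ := Nat.mul_le_mul_right _ (Nat.le_self_pow (by norm_num) _)
  have h3 : 2 * κ * 1 ≤ 2 * κ * ((I.n + 1) ^ 2 * (I.bitLen + 1)) := by gcongr; omega
  rw [setupTime, add_mul]
  omega

theorem size_le_log {n : ℕ} (hn : 0 < n) : (n.size : ℝ) ≤ 1 + 2 * Real.log n := by
  have h1 : 0 < n.size := Nat.size_pos.2 hn
  have h2 : 2 ^ (n.size - 1) ≤ n := Nat.lt_size.1 (by omega)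
  have h3 : ((n.size - 1 : ℕ) : ℝ) * Real.log 2 ≤ Real.log n := by
    rw [← Real.log_pow]
    exact Real.log_le_log (by positivity) (by exact_mod_cast h2)
  have h4 := Real.log_two_gt_d9
  have h5 : ((n.size - 1 : ℕ) : ℝ) = n.size - 1 := by push_cast [h1]; ring
  have h6 : (0 : ℝ) ≤ ((n.size - 1 : ℕ) : ℝ) := Nat.cast_nonneg _
  rw [h5] at h3 h6
  nlinarith

theorem bitLen_add_one_le {W : ℕ} (h : I.WeightsIn W) :
    ((I.bitLen + 1 : ℕ) : ℝ) ≤ 4 * max 1 (Real.log W) := by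
  have h1 : I.bitLen ≤ W.size := Finset.sup_le fun p _ => Nat.size_le_size (by
    have := h p.1 p.2
    rw [Int.abs_eq_natAbs] at this
    exact_mod_cast this)
  have h2 := le_max_left 1 (Real.log W)
  have h3 := le_max_right 1 (Real.log W)
  have h4 : (W.size : ℝ) ≤ 1 + 2 * max 1 (Real.log W) := by
    -- Since `Real.log 0 = 0`, the maximum is 1 for `W = 0`, as the theorem prescribes.
    rcases Nat.eq_zero_or_pos W with rfl | hW
    · norm_num
    · have := size_le_log hW
      linarith
  have h5 : (I.bitLen : ℝ) ≤ W.size := by exact_mod_cast h1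
  push_cast
  linarith

theorem size_add_one_isBigO :
    (fun n : ℕ => (n.size + 1 : ℝ)) =O[atTop] fun n : ℕ => Real.log n := by
  refine IsBigO.of_bound 4 ?_
  filter_upwards [eventually_ge_atTop 3] with n hn
  have h1 := size_le_log (n := n) (by omega)
  have h2 : 1 ≤ Real.log n := by
    rw [Real.le_log_iff_exp_le (by positivity)]
    have : (3 : ℝ) ≤ n := by exact_mod_cast hn
    linarith [Real.exp_one_lt_d9]
  rw [Real.norm_of_nonneg (by positivity), Real.norm_of_nonneg (by linarith)]
  linarith

/-- The total running time. -/
theorem time_le {W M : ℕ} {ε : ℝ} {κ b T t : ℕ} (hW : I.WeightsIn W) (hε0 : 0 < ε) (hε1 : ε < 1)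
    (hMε : M * ε ≤ 5)
    (ht : t ≤ (202 + 2 * κ) * ((I.n + 1) ^ 2 * (I.bitLen + 1)) +
      (600000000 * (I.n.size + 1) ^ 6 * M ^ 2 *
        ((221 + 2 * b) * ((I.n + 1) ^ 2 * (I.bitLen + 1)) + 3 * T) +
      213 * M ^ 4 * ((I.n + 1) ^ 2 * (I.bitLen + 1)))) :
    (t : ℝ) ≤ (ε ^ 2)⁻¹ * T * (45000000000 * (I.n.size + 1) ^ 6) +
      (ε ^ 4)⁻¹ * max 1 (Real.log W) *
        ((4 * (202 + 2 * κ) + 60000000000 * (221 + 2 * b) + 532500) *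
          ((I.n.size + 1) ^ 6 * (I.n + 1) ^ 2)) := by
  have hw := bitLen_add_one_le hW
  set w := max 1 (Real.log W) with hw'
  have ht' : (t : ℝ) ≤ (((202 + 2 * κ) * ((I.n + 1) ^ 2 * (I.bitLen + 1)) +
      (600000000 * (I.n.size + 1) ^ 6 * M ^ 2 *
        ((221 + 2 * b) * ((I.n + 1) ^ 2 * (I.bitLen + 1)) + 3 * T) +
      213 * M ^ 4 * ((I.n + 1) ^ 2 * (I.bitLen + 1))) : ℕ) : ℝ) := by exact_mod_cast ht
  push_cast at ht' hw
  set u := ε⁻¹ with hu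
  have hu1 : 1 ≤ u := (one_le_inv₀ hε0).2 hε1.le
  -- The constants come from `M ≤ 5 / ε`: for the oracle term `600000000 * 25 * 3`, for the
  -- quadratic term `600000000 * 25 * 4`, and for exact counting `213 * 625 * 4`.
  have hMu : (M : ℝ) ≤ 5 * u := by
    rw [hu, ← div_eq_mul_inv, le_div_iff₀ hε0]
    exact hMε
  have hw0 : 0 < w := lt_of_lt_of_le one_pos (le_max_left _ _)
  rw [← inv_pow, ← inv_pow, ← hu]
  set y : ℝ := (I.n.size : ℝ) + 1 with hy
  have hy1 : 1 ≤ y := by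
    have : (0 : ℝ) ≤ I.n.size := Nat.cast_nonneg _
    linarith
  have hy6 : 1 ≤ y ^ 6 := one_le_pow₀ hy1
  have hu4 : 1 ≤ u ^ 4 := one_le_pow₀ hu1
  have hu24 : u ^ 2 ≤ u ^ 4 := pow_le_pow_right₀ hu1 (by norm_num)
  set Q : ℝ := ((I.n : ℝ) + 1) ^ 2 with hQ
  have hQ0 : 0 ≤ Q := by positivity
  have hM2 : (M : ℝ) ^ 2 ≤ (5 * u) ^ 2 := by gcongr
  have hM4 : (M : ℝ) ^ 4 ≤ (5 * u) ^ 4 := by gcongr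
  have hD : Q * ((I.bitLen : ℝ) + 1) ≤ Q * (4 * w) := by gcongr
  have c1 : (202 + 2 * (κ : ℝ)) * (Q * (I.bitLen + 1)) ≤
      u ^ 4 * w * (4 * (202 + 2 * κ) * (y ^ 6 * Q)) := by
    calc (202 + 2 * (κ : ℝ)) * (Q * (I.bitLen + 1)) ≤ (202 + 2 * κ) * (Q * (4 * w)) := by gcongr
      _ = (1 * w) * (4 * (202 + 2 * κ) * (1 * Q)) := by ring
      _ ≤ u ^ 4 * w * (4 * (202 + 2 * κ) * (y ^ 6 * Q)) := by gcongr
  have c2 : 600000000 * y ^ 6 * (M : ℝ) ^ 2 * ((221 + 2 * b) * (Q * (I.bitLen + 1)) + 3 * T) ≤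
      u ^ 2 * T * (45000000000 * y ^ 6) +
      u ^ 4 * w * (60000000000 * (221 + 2 * b) * (y ^ 6 * Q)) := by
    calc 600000000 * y ^ 6 * (M : ℝ) ^ 2 * ((221 + 2 * b) * (Q * (I.bitLen + 1)) + 3 * T)
        ≤ 600000000 * y ^ 6 * (5 * u) ^ 2 * ((221 + 2 * b) * (Q * (4 * w)) + 3 * T) := by gcongr
      _ = u ^ 2 * T * (45000000000 * y ^ 6) +
          u ^ 2 * w * (60000000000 * (221 + 2 * b) * (y ^ 6 * Q)) := by ring
      _ ≤ _ := by gcongr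
  have c3 : 213 * (M : ℝ) ^ 4 * (Q * (I.bitLen + 1)) ≤ u ^ 4 * w * (532500 * (y ^ 6 * Q)) := by
    calc 213 * (M : ℝ) ^ 4 * (Q * (I.bitLen + 1)) ≤ 213 * (5 * u) ^ 4 * (Q * (4 * w)) := by gcongr
      _ = u ^ 4 * w * (532500 * (1 * Q)) := by ring
      _ ≤ _ := by gcongr
  calc (t : ℝ) ≤ _ := ht'
    _ ≤ u ^ 4 * w * (4 * (202 + 2 * κ) * (y ^ 6 * Q)) + (u ^ 2 * T * (45000000000 * y ^ 6) +
        u ^ 4 * w * (60000000000 * (221 + 2 * b) * (y ^ 6 * Q)) +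
        u ^ 4 * w * (532500 * (y ^ 6 * Q))) := add_le_add c1 (add_le_add c2 c3)
    _ = _ := by ring

end RAM

theorem mainTheorem7 (T : ℕ → ℕ → ℕ) (hT : HasNWTAlgorithm T) :
    ∃ f g : ℕ → ℝ,
      f =O[atTop] (fun n : ℕ => Real.log n ^ 6) ∧
      IsSoftO g (fun n : ℕ => (n : ℝ) ^ 2) ∧
      HasApproxCountNWTAlgorithm fun ε n W =>
        ((ε : ℝ) ^ 2)⁻¹ * T n W * f n + ((ε : ℝ) ^ 4)⁻¹ * max 1 (Real.log W) * g n := by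
  obtain ⟨P, κ, hP⟩ := hT
  obtain ⟨b, hb⟩ := RAM.exists_regsBelow P
  have hf : (fun n : ℕ => (n.size + 1 : ℝ) ^ 6) =O[atTop] fun n : ℕ => Real.log n ^ 6 :=
    RAM.size_add_one_isBigO.pow 6
  refine ⟨fun n => 45000000000 * (n.size + 1) ^ 6, fun n => (4 * (202 + 2 * κ) +
    60000000000 * (221 + 2 * (b + 1 : ℕ)) + 532500) * ((n.size + 1) ^ 6 * (n + 1) ^ 2),
    hf.const_mul_left _, ⟨6, ?_⟩, RAM.countProg P κ (b + 1), 8 * (κ + 20), fun I W ε hW hε0 hε1 => ?_⟩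
  · refine IsBigO.const_mul_left (IsBigO.mul ?_ ?_) _
    · have : (fun n : ℕ => Real.log n ^ (6 : ℝ)) = fun n : ℕ => Real.log n ^ 6 := by
        funext n
        exact_mod_cast Real.rpow_natCast (Real.log n) 6
      rw [this]
      exact hf
    · refine IsBigO.of_bound 4 ?_
      filter_upwards [eventually_ge_atTop 1] with n hn
      have h1 : (1 : ℝ) ≤ n := by exact_mod_cast hn
      rw [Real.norm_of_nonneg (by positivity), Real.norm_of_nonneg (by positivity)]
      nlinarith
  · have O : RAM.Oracle I P κ (b + 1) (T I.n W) :=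
      -- A query has the same number of vertices and the same weights, so the bound `T I.n W` and
      -- the hypothesis `hW` apply to it unchanged.
      { good := fun kill => by
          have := (hP (I.restrict kill) W hW).good
          rwa [NWTInstance.length_encode] at this
        below := hb.mono (Nat.le_succ b)
        pos := Nat.succ_pos b }
    obtain ⟨M, N, hM, hMε, hrun⟩ := RAM.runsIn_countProg O hε0 hε1
    refine ⟨_, ?_, hrun⟩
    refine RAM.time_le (M := M) hW (by exact_mod_cast hε0) (by exact_mod_cast hε1)
      (by exact_mod_cast hMε) ?_
    have h1 := RAM.setupTime_le (I := I) κ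
    have h2 := RAM.mainTime_le (I := I) (P := P) (κ := κ) (b := b + 1) (T := T I.n W) (N := N) hM
    -- The two cases are the two branches of the program; the hypothesis of `time_le` contains the
    -- sum of both bounds.
    split
    · omega
    · have h3 := RAM.bruteTime_le (I := I) hM (by omega)
      omega
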